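/- All modules are over $\mathbb Z_2$, so there are no signs. **Definitions.** The *surjection operad* $\chi$ has as component $\chi(n)_d$ the $\mathbb Z_2$-vector space spanned by the nondegenerate surjections $u:\{1,\dots,n+d\}\to\{1,\dots,n\}$, $u(i)\ne u(i+1)$, written as strings $(u(1),\dots,u(n+d))$. Its differential is the sum over all deletions of one letter (strings that are not nondegenerate surjections being zero), the symmetric groups rename the letters, and $u\circ_i v$ is the sum over all ways to cut $v$ into as many consecutive pieces, each starting with the last letter of the previous one, as $i$ has occurrences in $u$, and to put these pieces in place of the occurrences of $i$ (with the usual renumbering of letters). It acts on singular cochains by interval cuts: $u(x_1,\dots,x_n)(\sigma)=\sum\prod_j x_j(\sigma|_{I_j})$, where the sum is over all cuts of $\{0,\dots,N\}$ into intervals $[t_{r-1},t_r]$, $1\le r\le n+d$, $0=t_0\le t_1\le\dots\le t_{n+d}=N$, for which the intervals with the same letter are disjoint, and $I_j$ is the union of the intervals with letter $j$. The string $(1,2)$ acts as the cup product. *Admissible strings.* Fix $k\ge 0$, $p,q\ge1$. An admissible table belonging to $E^k_{p,q}$ has $k+3$ rows. The first row is $1$. The second row is $p+1,1,p+2,1,\dots,1,p+t$,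 with increasing part $p+1,\dots,p+t$ ($t\ge1$) and stable number $1$. Each further row has the form $s,i,s+1,i,\dots,i,s+t$ with $t\ge0$, where $s$ is the stable number of the previous row and $i$, the stable number of the new row (also if it has only one term), is the last number of the previous row. The last row has one term, the first increasing sequence $1,2,\dots$ ends with $p$, and the second one $p+1,p+2,\dots$ ends with $p+q$. The admissible string is the concatenation of the rows, and $E^k_{p,q}$ is the sum of all admissible strings belonging to it; the letters $1,\dots,p$ stand for the inputs $a_1,\dots,a_p$, the letters $p+1,\dots,p+q$ for the inputs $b_1,\dots,b_q$. *Homotopy G-algebra.* A DG-algebra $(A,d,\cdot)$, $\deg d=1$, with multilinear operations $E_{1,q}:A\otimes A^{\otimes q}\to A$ of degree $-q$, $E_{1,0}=\mathrm{id}$, such that for $q\ge 1$ $$dE_{1,q}(a;b_1,\dots,b_q)+E_{1,q}(da;b_1,\dots,b_q)+\sum_iE_{1,q}(a;b_1,\dots,db_i,\dots,b_q)$$ $$=b_1E_{1,q-1}(a;b_2,\dots,b_q)+\sum_iE_{1,q-1}(a;b_1,\dots,b_ib_{i+1},\dots,b_q)+E_{1,q-1}(a;b_1,\dots,b_{q-1})b_q,$$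 $$a_1E_{1,q}(a_2;b_1,\dots,b_q)+E_{1,q}(a_1a_2;b_1,\dots,b_q)+E_{1,q}(a_1;b_1,\dots,b_q)a_2=\sum_{p=1}^{q-1}E_{1,p}(a_1;b_1,\dots,b_p)\,E_{1,q-p}(a_2;b_{p+1},\dots,b_q),$$ and for $m,n\ge1$ $$E_{1,n}(E_{1,m}(a;b_1,\dots,b_m);c_1,\dots,c_n)=\sum E_{1,n-\sum l_i+m}(a;c_1,\dots,c_{k_1},E_{1,l_1}(b_1;c_{k_1+1},\dots,c_{k_1+l_1}),c_{k_1+l_1+1},\dots,c_{k_m},E_{1,l_m}(b_m;c_{k_m+1},\dots,c_{k_m+l_m}),c_{k_m+l_m+1},\dots,c_n),$$ the sum being over all $k_i,l_i\ge0$ with $k_i+l_i\le k_{i+1}$ and $k_m+l_m\le n$. *Extended homotopy G-algebra.* A DG-algebra with multilinear operations $E^k_{p,q}:A^{\otimes p}\otimes A^{\otimes q}\to A$, $k\ge0$, $p,q\ge1$, of degree $1-k-p-q$, such that $E^0_{p,q}=0$ for $p>1$, $(A,d,\cdot,\{E^0_{1,q}\})$ is a homotopy G-algebra, and for all $k,m,n\ge1$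 $$\begin{aligned} &dE^k_{m,n}(a_1,\dots,a_m;b_1,\dots,b_n)+\sum_iE^k_{m,n}(\dots,da_i,\dots;b_1,\dots,b_n)+\sum_iE^k_{m,n}(a_1,\dots,a_m;\dots,db_i,\dots)\\ &+\sum_iE^k_{m-1,n}(\dots,a_ia_{i+1},\dots;b_1,\dots,b_n)+\sum_iE^k_{m,n-1}(a_1,\dots,a_m;\dots,b_ib_{i+1},\dots)\\ &+a_1E^k_{m-1,n}(a_2,\dots,a_m;b_1,\dots,b_n)+E^k_{m-1,n}(a_1,\dots,a_{m-1};b_1,\dots,b_n)a_m\\ &+b_1E^k_{m,n-1}(a_1,\dots,a_m;b_2,\dots,b_n)+E^k_{m,n-1}(a_1,\dots,a_m;b_1,\dots,b_{n-1})b_n\\ &+\sum_{i=0}^k\sum_{p=1}^{m-1}\sum_{q=1}^{n-1}E^i_{p,q}(a_1,\dots,a_p;b_1,\dots,b_q)\cdot T^iE^{k-i}_{m-p,n-q}(a_{p+1},\dots,a_m;b_{q+1},\dots,b_n)\\ &=E^{k-1}_{m,n}(a_1,\dots,a_m;b_1,\dots,b_n)+E^{k-1}_{n,m}(b_1,\dots,b_n;a_1,\dots,a_m),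 \end{aligned}\tag{ehga}$$ where $TE^j_{p,q}(x_1,\dots,x_p;y_1,\dots,y_q)=E^j_{q,p}(y_1,\dots,y_q;x_1,\dots,x_p)$ and operations with $p=0$ or $q=0$ count as $0$. (For $k=0$ this identity amounts to the first two identities of a homotopy G-algebra.) **Theorem.** (a) $E^0_{1,q}=(1,2,1,3,1,\dots,1,q+1,1)$ for $q\ge 1$. The elements $E^k_{p,q}$ lie in $\chi(p+q)_{k+p+q-1}$ and satisfy the defining identities of an extended homotopy G-algebra, in particular (ehga), already in $\chi$, that is, with the operad differential, the operad composition and the product $(1,2)$. (b) For every topological space $X$, the singular cochain complex $C^*(X;\mathbb Z_2)$ with the coboundary, the cup product and the operations given by the action of the elements $E^k_{p,q}\in\chi$ is an extended homotopy G-algebra. The element $(1,2)$ acts as the cup product, and the normalized cochains (those that vanish on degenerate simplices) contain the unit and are closed under the coboundary, the cup product and all $E^k_{p,q}$. -/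

import Mathlib

universe u

/-! ## The surjection operad over `ZMod 2` -/

namespace SurjOperad

/-- `u` is a nondegenerate surjection `{1, …, u.length} → {1, …, n}`, written as the string
`(u(1), u(2), …)`: its letters are exactly `1, …, n` and neighbouring letters differ. -/
def IsSurj (n : ℕ) (u : List ℕ) : Prop :=
  (∀ x, x ∈ u ↔ 1 ≤ x ∧ x ≤ n) ∧ u.IsChain (· ≠ ·)

instance (n : ℕ) (u : List ℕ) : Decidable (IsSurj n u) :=
  decidable_of_iff (((u.all fun x => decide (1 ≤ x ∧ x ≤ n)) = true ∧
      ((List.range' 1 n).all fun x => decide (x ∈ u)) = true) ∧ u.IsChain (· ≠ ·)) (by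
    simp only [IsSurj, List.all_eq_true, decide_eq_true_eq, List.mem_range'_1]
    refine and_congr_left fun _ => ⟨fun h x => ⟨h.1 x, fun hx => h.2 x ?_⟩,
      fun h => ⟨fun x hx => (h x).1 hx, fun x hx => (h x).2 ?_⟩⟩ <;> omega)

/-- The `ZMod 2`-vector space with basis all strings of natural numbers. The components of the
surjection operad are subspaces of it. -/
abbrev Strings : Type := List ℕ →₀ ZMod 2

/-- The basis element given by a string. -/
noncomputable def str (u : List ℕ) : Strings := Finsupp.single u 1

/-- The component of arity `n` and degree `d` of the surjection operad: the span of the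
nondegenerate surjections `{1, …, n + d} → {1, …, n}`. -/
noncomputable def chi (n d : ℕ) : Submodule (ZMod 2) Strings :=
  Submodule.span (ZMod 2) (str '' {u | IsSurj n u ∧ u.length = n + d})

/-- The differential in arity `n`: the sum of the strings obtained by deleting one letter, where
the strings that are not nondegenerate surjections onto `{1, …, n}` count as zero. -/
noncomputable def bdry (n : ℕ) (U : Strings) : Strings :=
  U.sum fun u c => ∑ j ∈ Finset.range u.length,
    if IsSurj n (u.eraseIdx j) then c • str (u.eraseIdx j) else 0

/-- The list of the terms of `u ∘ᵢ v`, where `v` has arity `m`. If `i` occurs `r` times in `u`,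
then `v` is cut in all possible ways into `r` consecutive nonempty pieces, where each piece starts
with the last letter of the piece before it, and the occurrences of `i` are replaced by the
pieces. Letters of `v` are raised by `i - 1` and the letters of `u` above `i` by `m - 1`. -/
def compStr (i m : ℕ) : List ℕ → List ℕ → List (List ℕ)
  | [], _ => [[]]
  | x :: u, v =>
    if x = i then
      if i ∈ u then
        (List.range v.length).flatMap fun s =>
          (compStr i m u (v.drop s)).map fun w => (v.take (s + 1)).map (· + i - 1) ++ w
      else (compStr i m u v).map fun w => v.map (· + i - 1) ++ w
    else (compStr i m u v).map fun w => (if x < i then x else x + m - 1) :: w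

/-- The partial composition `U ∘ᵢ V` of the surjection operad, where `V` has arity `m`. -/
noncomputable def circ (i m : ℕ) (U V : Strings) : Strings :=
  U.sum fun u c => V.sum fun v c' => ((compStr i m u v).map fun w => (c * c') • str w).sum

/-- The operation `U` with the letters `l₁, l₂, …` as its inputs: the letter `j` becomes `lⱼ`.
For a permutation `l` of `1, …, n` this is the action of the symmetric group. -/
noncomputable def relabel (U : Strings) (l : List ℕ) : Strings :=
  U.mapDomain (List.map fun x => l.getD (x - 1) 0)

/-- Put `V₁, V₂, …` into the inputs `i, i + 1, …` of `U`, where the arity of each `Vⱼ` is the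
length of the list that comes with it. -/
noncomputable def compAll (U : Strings) : ℕ → List (Strings × List ℕ) → Strings
  | _, [] => U
  | i, (V, l) :: L => circ i l.length (compAll U (i + 1) L) V

/-- The composite operation `U(V₁(l₁), …, Vᵣ(lᵣ))`, where the `lⱼ` are lists of letters. -/
noncomputable def subst (U : Strings) (L : List (Strings × List ℕ)) : Strings :=
  relabel (compAll U 1 L) (L.flatMap Prod.snd)

/-- The operad unit, the string `(1)`. -/
noncomputable def idOp : Strings := str [1]

/-- The product `⌣`, the string `(1,2)`. -/
noncomputable def mu : Strings := str [1, 2]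

/-- The product `U(l) ⌣ V(l')`. -/
noncomputable def prodOp (U : Strings) (l : List ℕ) (V : Strings) (l' : List ℕ) : Strings :=
  subst mu [(U, l), (V, l')]

/-! ### Admissible tables -/

/-- The row `s, i, s+1, i, …, i, s+t` with increasing part `s, …, s+t` and stable part `i`. -/
def row (s i : ℕ) : ℕ → List ℕ
  | 0 => [s]
  | t + 1 => s :: i :: row (s + 1) i t

/-- The rows with numbers of increments `t₁, t₂, …`, when the first one starts with `s` and has
stable number `i`. Each next row starts with the stable number of the row before it and has the
last number of the increasing part of that row as its stable number (also if that row has only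
one term). -/
def rows : ℕ → ℕ → List ℕ → List (List ℕ)
  | _, _, [] => []
  | s, i, t :: ts => row s i t :: rows i (s + t) ts

/-- The last numbers of the two increasing sequences that run through `rows s i ts`: first the
sequence that starts with `s`, then the one that starts with `i`. -/
def finals : ℕ → ℕ → List ℕ → ℕ × ℕ
  | s, i, [] => (s, i)
  | s, i, t :: ts => (finals i (s + t) ts).swap

/-- The table with first row `1`, second row starting with `p + 1`, and numbers of increments `ts`
in the second, third, … row. -/
def table (p : ℕ) (ts : List ℕ) : List (List ℕ) := [1] :: rows (p + 1) 1 ts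

/-- `w` is an admissible string belonging to `E^k_{p,q}`: it is read off row by row from an
admissible table with `k + 3` rows, whose last row has one term, whose first sequence `1, 2, …`
ends with `p` and whose second sequence `p + 1, p + 2, …` ends with `p + q`. -/
def IsAdmissible (k p q : ℕ) (w : List ℕ) : Prop :=
  ∃ ts : List ℕ, (table p ts).length = k + 3 ∧ ts.getLast? = some 0 ∧
    finals (p + 1) 1 ts = (p + q, p) ∧ w = (table p ts).flatten

/-- The finite set of all admissible strings belonging to `E^k_{p,q}`. -/
def admissible (k p q : ℕ) : Finset (List ℕ) :=
  ((Finset.univ : Finset (Fin (k + 2) → Fin (p + q + 1))).filter fun t =>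
    (List.ofFn fun j => (t j : ℕ)).getLast? = some 0 ∧
      finals (p + 1) 1 (List.ofFn fun j => (t j : ℕ)) = (p + q, p)).image
    fun t => (table p (List.ofFn fun j => (t j : ℕ))).flatten

theorem le_finals : ∀ (ts : List ℕ) (s i : ℕ), s ≤ (finals s i ts).1 ∧ i ≤ (finals s i ts).2 ∧
    ∀ t ∈ ts, t ≤ (finals s i ts).1 ∨ t ≤ (finals s i ts).2
  | [], s, i => by simp [finals]
  | t :: ts, s, i => by
    obtain ⟨h1, h2, h3⟩ := le_finals ts i (s + t)
    refine ⟨by simp only [finals, Prod.fst_swap]; omega, by simpa [finals] using h1, ?_⟩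
    intro x hx
    simp only [finals, Prod.fst_swap, Prod.snd_swap]
    rcases List.mem_cons.1 hx with rfl | hx
    · left; omega
    · exact (h3 x hx).symm

theorem length_rows : ∀ (ts : List ℕ) (s i : ℕ), (rows s i ts).length = ts.length
  | [], _, _ => rfl
  | _ :: ts, _, _ => by simp [rows, length_rows ts]

/-- The bound on the increments in `admissible` leaves out no admissible string. -/
theorem mem_admissible {k p q : ℕ} {w : List ℕ} :
    w ∈ admissible k p q ↔ IsAdmissible k p q w := by
  simp only [admissible, Finset.mem_image, Finset.mem_filter, Finset.mem_univ, true_and,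
    IsAdmissible]
  constructor
  · rintro ⟨t, ⟨h1, h2⟩, rfl⟩
    exact ⟨_, by simp [table, length_rows], h1, h2, rfl⟩
  · rintro ⟨ts, h0, h1, h2, rfl⟩
    have hl : ts.length = k + 2 := by simpa [table, length_rows] using h0
    have hb : ∀ t ∈ ts, t < p + q + 1 := by
      intro t ht
      have := (le_finals ts (p + 1) 1).2.2 t ht
      rw [h2] at this
      simp only at this
      omega
    have key : (List.ofFn fun j : Fin (k + 2) =>
        ((⟨ts.get (j.cast hl.symm), hb _ (List.get_mem _ _)⟩ : Fin (p + q + 1)) : ℕ)) = ts := by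
      apply List.ext_get
      · simp [hl]
      · intro n h1 h2
        rw [List.get_ofFn]
        rfl
    exact ⟨fun j => ⟨ts.get (j.cast hl.symm), hb _ (List.get_mem _ _)⟩, by rw [key]; exact ⟨h1, h2⟩,
      by rw [key]⟩

/-- The element `E^k_{p,q}` of the surjection operad, of arity `p + q`: the sum of all admissible
strings belonging to it. The letters `1, …, p` stand for the inputs `a₁, …, a_p` and the letters
`p + 1, …, p + q` for the inputs `b₁, …, b_q`. -/
noncomputable def E (k p q : ℕ) : Strings := ∑ w ∈ admissible k p q, str w

/-- The string `(1,2,1,3,1,…,1,q+1,1)`. -/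
def braceStr (q : ℕ) : List ℕ := 1 :: (List.range q).flatMap fun j => [j + 2, 1]

end SurjOperad

/-! ## Extended homotopy G-algebras over `ZMod 2` -/

/-- All `(k₁, l₁), …, (k_m, l_m)` with `0 ≤ k₁`, `kⱼ + lⱼ ≤ kⱼ₊₁` and `k_m + l_m ≤ n`: the ways to
choose in `c₁, …, c_n` consecutive disjoint, possibly empty, blocks
`c_{kⱼ+1}, …, c_{kⱼ+lⱼ}`, `j = 1, …, m`, in this order. -/
def blocks (m n : ℕ) : Finset (Fin m → Fin (n + 1) × Fin (n + 1)) :=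
  Finset.univ.filter fun f =>
    (∀ j, ((f j).1 : ℕ) + (f j).2 ≤ n) ∧
      ∀ i j, i < j → ((f i).1 : ℕ) + (f i).2 ≤ (f j).1

/-- The list `c_{s+1}, …, c_{k₁}, B₁, c_{k₁+l₁+1}, …, c_{k₂}, B₂, …, B_m, c_{k_m+l_m+1}, …, c_n` for
a list of triples `(kⱼ, lⱼ, Bⱼ)`, where `C j` stands for `c_{j+1}`. -/
def interleave {M : Type*} (C : ℕ → M) (n : ℕ) : ℕ → List (ℕ × ℕ × M) → List M
  | s, [] => (List.range' s (n - s)).map C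
  | s, (k, l, B) :: L => (List.range' s (k - s)).map C ++ B :: interleave C n (k + l) L

namespace SurjOperad

/-- The identities that define a homotopy G-algebra, for elements `e q = E_{1,q}` of arity
`1 + q` of the surjection operad, with the operad differential and composition. -/
structure IsHomotopyGInChi (e : ℕ → Strings) : Prop where
  e_zero : e 0 = idOp
  mem_chi : ∀ q, e q ∈ chi (1 + q) q
  /-- Letters: `a = 1`, `bⱼ = 1 + j`. -/
  diff : ∀ q, 1 ≤ q →
    bdry (1 + q) (e q) =
      prodOp idOp [2] (e (q - 1)) (1 :: List.range' 3 (q - 1)) +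
      ∑ j ∈ Finset.Ico 1 q, circ (1 + j) 2 (e (q - 1)) mu +
      prodOp (e (q - 1)) (List.range' 1 q) idOp [q + 1]
  /-- Letters: `a₁ = 1`, `a₂ = 2`, `bⱼ = 2 + j`. -/
  hirsch : ∀ q, 1 ≤ q →
    prodOp idOp [1] (e q) (2 :: List.range' 3 q) + circ 1 2 (e q) mu +
        prodOp (e q) (1 :: List.range' 3 q) idOp [2] =
      ∑ p ∈ Finset.Ico 1 q,
        prodOp (e p) (1 :: List.range' 3 p) (e (q - p)) (2 :: List.range' (3 + p) (q - p))
  /-- Letters: `a = 1`, `bⱼ = 1 + j`, `cⱼ = m + 1 + j`. -/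
  assoc : ∀ m n, 1 ≤ m → 1 ≤ n →
    circ 1 (1 + m) (e n) (e m) =
      ∑ f ∈ blocks m n,
        let inputs : List (Strings × List ℕ) :=
          interleave (fun j => (idOp, [m + 2 + j])) n 0
            (List.ofFn fun j : Fin m =>
              (((f j).1 : ℕ), ((f j).2 : ℕ),
                (e (f j).2, (2 + (j : ℕ)) :: List.range' (m + 2 + (f j).1) (f j).2)))
        subst (e inputs.length) ((idOp, [1]) :: inputs)

/-- The left side of the defining identity of an extended homotopy G-algebra (see
`IsExtendedHomotopyGAlgebra.ehga`), written in the surjection operad, where `bdry` collects the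
terms that contain a differential.
Letters: `aᵢ = i` for `1 ≤ i ≤ m` and `bⱼ = m + j` for `1 ≤ j ≤ n`. -/
noncomputable def ehgaLeft (E : ℕ → ℕ → ℕ → Strings) (k m n : ℕ) : Strings :=
  let a (s r : ℕ) : List ℕ := List.range' s r
  let b (s r : ℕ) : List ℕ := List.range' (m + s) r
  bdry (m + n) (E k m n) +
  ∑ i ∈ Finset.Ico 1 m, circ i 2 (E k (m - 1) n) mu +
  ∑ j ∈ Finset.Ico 1 n, circ (m + j) 2 (E k m (n - 1)) mu +
  prodOp idOp (a 1 1) (E k (m - 1) n) (a 2 (m - 1) ++ b 1 n) +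
  prodOp (E k (m - 1) n) (a 1 (m - 1) ++ b 1 n) idOp (a m 1) +
  prodOp idOp (b 1 1) (E k m (n - 1)) (a 1 m ++ b 2 (n - 1)) +
  prodOp (E k m (n - 1)) (a 1 m ++ b 1 (n - 1)) idOp (b n 1) +
  ∑ i ∈ Finset.range (k + 1), ∑ p ∈ Finset.Ico 1 m, ∑ q ∈ Finset.Ico 1 n,
    if Even i then
      prodOp (E i p q) (a 1 p ++ b 1 q)
        (E (k - i) (m - p) (n - q)) (a (p + 1) (m - p) ++ b (q + 1) (n - q))
    else
      prodOp (E i p q) (a 1 p ++ b 1 q)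
        (E (k - i) (n - q) (m - p)) (b (q + 1) (n - q) ++ a (p + 1) (m - p))

/-- The identities that define an extended homotopy G-algebra, for elements `E k p q` of arity
`p + q` of the surjection operad. For `k = 0` the identity is part of `homotopyG`. -/
structure IsExtendedHomotopyGInChi (E : ℕ → ℕ → ℕ → Strings) : Prop where
  mem_chi : ∀ k p q, 1 ≤ p → 1 ≤ q → E k p q ∈ chi (p + q) (k + p + q - 1)
  zero_left : ∀ k q, E k 0 q = 0
  zero_right : ∀ k p, E k p 0 = 0
  E_zero : ∀ p q, 1 < p → E 0 p q = 0
  homotopyG : IsHomotopyGInChi fun q => if q = 0 then idOp else E 0 1 q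
  ehga : ∀ k m n, 1 ≤ k → 1 ≤ m → 1 ≤ n →
    ehgaLeft E k m n =
      E (k - 1) m n +
      relabel (E (k - 1) n m) (List.range' (m + 1) n ++ List.range' 1 m)

end SurjOperad

section Algebras

variable {A : Type*} [AddCommGroup A] [Module (ZMod 2) A]

/-- A differential graded (unital, associative) algebra over `ZMod 2` with differential of degree
`1`. There are no signs. -/
structure IsDGAlgebra (𝒜 : ℤ → Submodule (ZMod 2) A) (d : A →ₗ[ZMod 2] A)
    (mul : A →ₗ[ZMod 2] A →ₗ[ZMod 2] A) (one : A) : Prop where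
  isInternal : DirectSum.IsInternal 𝒜
  d_mem : ∀ n, ∀ x ∈ 𝒜 n, d x ∈ 𝒜 (n + 1)
  d_d : ∀ x, d (d x) = 0
  one_mem : one ∈ 𝒜 0
  mul_mem : ∀ m n, ∀ x ∈ 𝒜 m, ∀ y ∈ 𝒜 n, mul x y ∈ 𝒜 (m + n)
  one_mul : ∀ x, mul one x = x
  mul_one : ∀ x, mul x one = x
  mul_assoc : ∀ x y z, mul (mul x y) z = mul x (mul y z)
  leibniz : ∀ x y, d (mul x y) = mul (d x) y + mul x (d y)

/-- Tuples are handled as sequences `x`, of which only the first entries matter, with `x j` for the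
entry number `j + 1`. This is the tuple of the first `n` entries. -/
def firsts (n : ℕ) (x : ℕ → A) : Fin n → A := fun j => x j

/-- The sequence without its first `s` entries. -/
def dropSeq (s : ℕ) (x : ℕ → A) : ℕ → A := fun j => x (s + j)

/-- The sequence with `x j` and `x (j + 1)` replaced by their product. -/
def mergeSeq (mul : A →ₗ[ZMod 2] A →ₗ[ZMod 2] A) (j : ℕ) (x : ℕ → A) : ℕ → A := fun i =>
  if i < j then x i else if i = j then mul (x j) (x (j + 1)) else x (i + 1)

/-- The sequence with `x j` replaced by `d (x j)`. -/
def diffSeq (d : A →ₗ[ZMod 2] A) (j : ℕ) (x : ℕ → A) : ℕ → A := Function.update x j (d (x j))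

/-- A homotopy G-algebra: a DG-algebra with multilinear operations `e q = E_{1,q}` on
`A ⊗ A^{⊗q}` of degree `-q`. -/
structure IsHomotopyGAlgebra (𝒜 : ℤ → Submodule (ZMod 2) A) (d : A →ₗ[ZMod 2] A)
    (mul : A →ₗ[ZMod 2] A →ₗ[ZMod 2] A) (one : A)
    (e : (q : ℕ) → A → (Fin q → A) → A) : Prop where
  dga : IsDGAlgebra 𝒜 d mul one
  multilinear : ∀ q, ∃ f : MultilinearMap (ZMod 2) (fun _ : Fin (q + 1) => A) A,
    ∀ a b, e q a b = f (Fin.cons a b)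
  degree : ∀ (q : ℕ) (s : ℤ) (t : Fin q → ℤ) (a : A) (b : Fin q → A),
    a ∈ 𝒜 s → (∀ j, b j ∈ 𝒜 (t j)) → e q a b ∈ 𝒜 (s + ∑ j, t j - q)
  e_zero : ∀ a b, e 0 a b = a
  diff : ∀ (q : ℕ), 1 ≤ q → ∀ (a : A) (b : ℕ → A),
    d (e q a (firsts q b)) + e q (d a) (firsts q b) +
        ∑ j ∈ Finset.range q, e q a (firsts q (diffSeq d j b)) =
      mul (b 0) (e (q - 1) a (firsts (q - 1) (dropSeq 1 b))) +
      ∑ j ∈ Finset.range (q - 1), e (q - 1) a (firsts (q - 1) (mergeSeq mul j b)) +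
      mul (e (q - 1) a (firsts (q - 1) b)) (b (q - 1))
  hirsch : ∀ (q : ℕ), 1 ≤ q → ∀ (a₁ a₂ : A) (b : ℕ → A),
    mul a₁ (e q a₂ (firsts q b)) + e q (mul a₁ a₂) (firsts q b) +
        mul (e q a₁ (firsts q b)) a₂ =
      ∑ p ∈ Finset.Ico 1 q,
        mul (e p a₁ (firsts p b)) (e (q - p) a₂ (firsts (q - p) (dropSeq p b)))
  assoc : ∀ (m n : ℕ), 1 ≤ m → 1 ≤ n → ∀ (a : A) (b c : ℕ → A),
    e n (e m a (firsts m b)) (firsts n c) =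
      ∑ f ∈ blocks m n,
        let inputs : List A := interleave c n 0
          (List.ofFn fun j : Fin m =>
            (((f j).1 : ℕ), ((f j).2 : ℕ), e (f j).2 (b j) (firsts (f j).2 (dropSeq (f j).1 c))))
        e inputs.length a inputs.get

/-- An extended homotopy G-algebra: a DG-algebra with multilinear operations `E k p q` on
`A^{⊗p} ⊗ A^{⊗q}` for `k ≥ 0` and `p, q ≥ 1`, of degree `1 - k - p - q`; operations with `p = 0` or
`q = 0` count as zero in `ehga`. There `F` is `E` on sequences and `T` is the `i`-th power of the
exchange of the two groups of inputs. For `k = 0` the identity `ehga` is the same as the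
conditions `diff` and `hirsch` of a homotopy G-algebra, so it is listed for `k ≥ 1`. -/
structure IsExtendedHomotopyGAlgebra (𝒜 : ℤ → Submodule (ZMod 2) A) (d : A →ₗ[ZMod 2] A)
    (mul : A →ₗ[ZMod 2] A →ₗ[ZMod 2] A) (one : A)
    (E : (k p q : ℕ) → (Fin p → A) → (Fin q → A) → A) : Prop where
  multilinear : ∀ k p q, ∃ f : MultilinearMap (ZMod 2) (fun _ : Fin p ⊕ Fin q => A) A,
    ∀ a b, E k p q a b = f (Sum.elim a b)
  degree : ∀ (k p q : ℕ) (s : Fin p → ℤ) (t : Fin q → ℤ) (a : Fin p → A) (b : Fin q → A),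
    (∀ i, a i ∈ 𝒜 (s i)) → (∀ j, b j ∈ 𝒜 (t j)) →
      E k p q a b ∈ 𝒜 (∑ i, s i + ∑ j, t j + (1 - k - p - q))
  zero_left : ∀ k q a b, E k 0 q a b = 0
  zero_right : ∀ k p a b, E k p 0 a b = 0
  E_zero : ∀ p q a b, 1 < p → E 0 p q a b = 0
  homotopyG : IsHomotopyGAlgebra 𝒜 d mul one
    fun q a b => if q = 0 then a else E 0 1 q (fun _ => a) b
  ehga : ∀ (k m n : ℕ), 1 ≤ k → 1 ≤ m → 1 ≤ n → ∀ (a b : ℕ → A),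
    let F (k p q : ℕ) (x y : ℕ → A) : A := E k p q (firsts p x) (firsts q y)
    let T (i k p q : ℕ) (x y : ℕ → A) : A := if Even i then F k p q x y else F k q p y x
    d (F k m n a b) +
    ∑ i ∈ Finset.range m, F k m n (diffSeq d i a) b +
    ∑ j ∈ Finset.range n, F k m n a (diffSeq d j b) +
    ∑ i ∈ Finset.range (m - 1), F k (m - 1) n (mergeSeq mul i a) b +
    ∑ j ∈ Finset.range (n - 1), F k m (n - 1) a (mergeSeq mul j b) +
    mul (a 0) (F k (m - 1) n (dropSeq 1 a) b) +
    mul (F k (m - 1) n a b) (a (m - 1)) +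
    mul (b 0) (F k m (n - 1) a (dropSeq 1 b)) +
    mul (F k m (n - 1) a b) (b (n - 1)) +
    ∑ i ∈ Finset.range (k + 1), ∑ p ∈ Finset.Ico 1 m, ∑ q ∈ Finset.Ico 1 n,
      mul (F i p q a b) (T i (k - i) (m - p) (n - q) (dropSeq p a) (dropSeq q b)) =
    F (k - 1) m n a b + F (k - 1) n m b a

end Algebras

/-! ## Cochains and the action of the surjection operad -/

namespace SSetCochains

open Simplicial in
/-- The set of `n`-simplices of a simplicial set. -/
abbrev Simp (S : SSet) (n : ℕ) : Type _ := S _⦋n⦌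

/-- The singular simplicial set of a topological space. -/
noncomputable abbrev Sing (X : TopCat.{u}) : SSet.{u} := TopCat.toSSet.obj X

variable (S : SSet)

/-- The cochain complex `⨁ₙ Cⁿ(S; ZMod 2)` of a simplicial set: the functions on the simplices of
all dimensions that vanish in all large dimensions. Here all cochains are meant, not only those
that vanish on degenerate simplices. -/
def Cochains : Submodule (ZMod 2) ((Σ n : ℕ, Simp S n) → ZMod 2) where
  carrier := {x | ∃ B, ∀ n, B < n → ∀ σ : Simp S n, x ⟨n, σ⟩ = 0}
  add_mem' := by
    rintro x y ⟨B, hB⟩ ⟨C, hC⟩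
    refine ⟨max B C, fun n hn σ => ?_⟩
    simp [hB n (lt_of_le_of_lt (le_max_left _ _) hn) σ,
      hC n (lt_of_le_of_lt (le_max_right _ _) hn) σ]
  zero_mem' := ⟨0, fun _ _ _ => rfl⟩
  smul_mem' := by
    rintro c x ⟨B, hB⟩
    exact ⟨B, fun n hn σ => by simp [hB n hn σ]⟩

/-- The cochains of degree `n`. -/
def deg (n : ℤ) : Submodule (ZMod 2) (Cochains S) where
  carrier := {x | ∀ (m : ℕ) (σ : Simp S m), (m : ℤ) ≠ n → x.1 ⟨m, σ⟩ = 0}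
  add_mem' := by
    intro x y hx hy m σ h
    simp [hx m σ h, hy m σ h]
  zero_mem' := fun _ _ _ => rfl
  smul_mem' := by
    intro c x hx m σ h
    simp [hx m σ h]

/-- The normalized cochains: those that vanish on all degenerate simplices. -/
def IsNormalized {S : SSet} (x : Cochains S) : Prop :=
  ∀ (n : ℕ) (σ : Simp S n), σ ∈ S.degenerate n → x.1 ⟨n, σ⟩ = 0

/-- The coboundary as a function: `(dx)(σ) = ∑ᵢ x(∂ᵢσ)`. -/
def dFun {S : SSet} (x : (Σ n : ℕ, Simp S n) → ZMod 2) : (Σ n : ℕ, Simp S n) → ZMod 2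
  | ⟨0, _⟩ => 0
  | ⟨n + 1, σ⟩ => ∑ i : Fin (n + 2), x ⟨n, S.δ i σ⟩

/-- The coboundary. -/
def d : Cochains S →ₗ[ZMod 2] Cochains S where
  toFun x := ⟨dFun x.1, by
    obtain ⟨B, hB⟩ := x.2
    refine ⟨B + 1, fun n hn σ => ?_⟩
    obtain ⟨m, rfl⟩ : ∃ m, n = m + 1 := ⟨n - 1, by omega⟩
    exact Finset.sum_eq_zero fun i _ => hB m (by omega) _⟩
  map_add' x y := by
    ext ⟨n, σ⟩
    cases n
    · simp [dFun]
    · simp [dFun, Finset.sum_add_distrib]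
  map_smul' c x := by
    ext ⟨n, σ⟩
    cases n
    · simp [dFun]
    · simp [dFun, Finset.mul_sum]

/-- The value of the cochain `x` on the face of the simplex `σ` spanned by the set `s` of
vertices, and `0` if `s` is empty. -/
noncomputable def evalFace {S : SSet} {N : ℕ} (x : (Σ n : ℕ, Simp S n) → ZMod 2) (σ : Simp S N)
    (s : Finset (Fin (N + 1))) : ZMod 2 :=
  if h : s.Nonempty then
    x ⟨s.card - 1, S.map (SimplexCategory.mkHom (s.orderEmbOfFin
      (k := s.card - 1 + 1) (Nat.sub_add_cancel h.card_pos).symm).toOrderHom).op σ⟩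
  else 0

theorem evalFace_add {S : SSet} {N : ℕ} (x y : (Σ n : ℕ, Simp S n) → ZMod 2) (σ : Simp S N)
    (s : Finset (Fin (N + 1))) : evalFace (x + y) σ s = evalFace x σ s + evalFace y σ s := by
  unfold evalFace; split_ifs <;> simp

theorem evalFace_smul {S : SSet} {N : ℕ} (c : ZMod 2) (x : (Σ n : ℕ, Simp S n) → ZMod 2)
    (σ : Simp S N) (s : Finset (Fin (N + 1))) : evalFace (c • x) σ s = c * evalFace x σ s := by
  unfold evalFace; split_ifs <;> simp

theorem evalFace_eq_zero {S : SSet} {N B : ℕ} {x : (Σ n : ℕ, Simp S n) → ZMod 2}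
    (hx : ∀ n, B < n → ∀ σ : Simp S n, x ⟨n, σ⟩ = 0) (σ : Simp S N) (s : Finset (Fin (N + 1)))
    (hs : B + 1 < s.card) : evalFace x σ s = 0 := by
  unfold evalFace
  split_ifs
  · exact hx _ (by omega) _
  · rfl

/-- The cup product: `(x ⌣ y)(σ) = ∑ᵢ x(σ[0,…,i]) y(σ[i,…,N])`. -/
noncomputable def cup : Cochains S →ₗ[ZMod 2] Cochains S →ₗ[ZMod 2] Cochains S :=
  LinearMap.mk₂ (ZMod 2)
    (fun x y => ⟨fun σ => ∑ i : Fin (σ.1 + 1),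
        evalFace x.1 σ.2 (Finset.Iic i) * evalFace y.1 σ.2 (Finset.Ici i), by
      obtain ⟨B, hB⟩ := x.2
      obtain ⟨C, hC⟩ := y.2
      refine ⟨B + C, fun n hn σ => Finset.sum_eq_zero fun i _ => ?_⟩
      by_cases h : B < (i : ℕ)
      · rw [evalFace_eq_zero hB, zero_mul]
        simpa [Fin.card_Iic] using h
      · rw [evalFace_eq_zero hC, mul_zero]
        simp only [Fin.card_Ici]
        omega⟩)
    (fun x y z => by
      ext σ
      simp [evalFace_add, add_mul, Finset.sum_add_distrib])
    (fun c x y => by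
      ext σ
      simp [evalFace_smul, mul_assoc, Finset.mul_sum])
    (fun x y z => by
      ext σ
      simp [evalFace_add, mul_add, Finset.sum_add_distrib])
    (fun c x y => by
      ext σ
      simp [evalFace_smul, mul_left_comm, Finset.mul_sum])

/-- The unit of the cup product: the cochain with value `1` on all `0`-simplices. -/
def one : Cochains S :=
  ⟨fun σ => if σ.1 = 0 then 1 else 0, 0, fun n hn _ => by
    simp [Nat.pos_iff_ne_zero.1 hn]⟩

/-- `t` cuts `{0, …, N}` into the intervals `[t_r, t_{r+1}]`, one for each letter of the string
`u`: neighbouring intervals share an endpoint, intervals may consist of one point, and two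
different intervals that belong to the same letter must be disjoint (otherwise the corresponding
vertex would be repeated). -/
def IsCut (u : List ℕ) (N : ℕ) (t : Fin (u.length + 1) → Fin (N + 1)) : Prop :=
  Monotone t ∧ t 0 = 0 ∧ t (Fin.last _) = Fin.last _ ∧
    ∀ r r' : Fin u.length, r < r' → u.get r = u.get r' → t r.succ < t r'.castSucc

/-- The union of the intervals that belong to the letter `j`. -/
def letterVerts (u : List ℕ) {N : ℕ} (t : Fin (u.length + 1) → Fin (N + 1)) (j : ℕ) :
    Finset (Fin (N + 1)) :=
  Finset.univ.filter fun v => ∃ r : Fin u.length, u.get r = j ∧ t r.castSucc ≤ v ∧ v ≤ t r.succ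

open Classical in
/-- The action of a string `u` of arity `n` on cochains `x₁, …, x_n` (`x j` stands for
`x_{j+1}`): the value on `σ` is the sum over all cuts of the products of the values of `x_j` on the
face of `σ` spanned by the vertices that belong to the letter `j`. It is the dual of the
interval-cut cooperation `σ ↦ ∑ₜ σ|₁ ⊗ ⋯ ⊗ σ|ₙ` on chains. Strings which are not nondegenerate
surjections act by zero. -/
noncomputable def actStr {S : SSet} (n : ℕ) (u : List ℕ) (x : Fin n → Cochains S) :
    Cochains S :=
  ⟨fun σ => if SurjOperad.IsSurj n u then
      ∑ t : Fin (u.length + 1) → Fin (σ.1 + 1),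
        if IsCut u σ.1 t then ∏ j : Fin n, evalFace (x j).1 σ.2 (letterVerts u t (j + 1)) else 0
    else 0, by
    choose B hB using fun j => (x j).2
    refine ⟨∑ j, (B j + 1), fun N hN σ => ?_⟩
    dsimp only
    split_ifs with hu
    swap
    · rfl
    refine Finset.sum_eq_zero fun t _ => ?_
    split_ifs with ht
    swap
    · rfl
    by_contra hne
    have hle : ∀ j : Fin n, (letterVerts u t (j + 1)).card ≤ B j + 1 := by
      intro j
      by_contra hlt
      exact hne (Finset.prod_eq_zero (Finset.mem_univ j)
        (evalFace_eq_zero (hB j) σ _ (by omega)))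
    have hcov : (Finset.univ : Finset (Fin (N + 1))) ⊆
        Finset.univ.biUnion fun j : Fin n => letterVerts u t (j + 1) := by
      intro v _
      obtain ⟨r, hr1, hr2⟩ : ∃ r : Fin u.length, t r.castSucc ≤ v ∧ v ≤ t r.succ := by
        by_contra hno
        push Not at hno
        have hall : ∀ i : Fin (u.length + 1), t i ≤ v := by
          intro i
          induction i using Fin.induction with
          | zero => rw [ht.2.1]; exact Fin.zero_le _
          | succ r ih => exact (hno r ih).le
        have hv : v = Fin.last N := by
          have := hall (Fin.last _)
          rw [ht.2.2.1] at this
          exact Fin.last_le_iff.1 this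
        have hpos : 0 < u.length := by
          rcases Nat.eq_zero_or_pos u.length with h0 | h0
          · exfalso
            have h1 := ht.2.1
            have h2 := ht.2.2.1
            have h3 : (Fin.last u.length : Fin (u.length + 1)) = 0 := by
              ext; simp [h0]
            rw [h3, h1] at h2
            have := congrArg Fin.val h2
            simp at this
            omega
          · exact h0
        have hlast := hno ⟨u.length - 1, by omega⟩ (hall _)
        have hs : (⟨u.length - 1, by omega⟩ : Fin u.length).succ = Fin.last _ := by
          ext
          simp only [Fin.val_succ, Fin.val_last]
          omega
        rw [hs, ht.2.2.1, hv] at hlast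
        exact lt_irrefl _ hlast
      have hm := (hu.1 (u.get r)).1 (List.get_mem _ _)
      refine Finset.mem_biUnion.2 ⟨⟨u.get r - 1, by omega⟩, Finset.mem_univ _, ?_⟩
      simp only [letterVerts, Finset.mem_filter, Finset.mem_univ, true_and]
      exact ⟨r, by omega, hr1, hr2⟩
    have h1 := (Finset.card_le_card hcov).trans Finset.card_biUnion_le
    have h2 := Finset.sum_le_sum fun (j : Fin n) (_ : j ∈ Finset.univ) => hle j
    simp only [Finset.card_univ, Fintype.card_fin] at h1
    omega⟩

/-- The action of an element of arity `n` of the surjection operad on cochains. -/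
noncomputable def act {S : SSet} (n : ℕ) (U : SurjOperad.Strings) (x : Fin n → Cochains S) :
    Cochains S :=
  U.sum fun u c => c • actStr n u x

/-- The operation `E^k_{p,q}` on cochains, given by the element `E^k_{p,q}` of the surjection
operad. -/
noncomputable def opE (k p q : ℕ) (a : Fin p → Cochains S) (b : Fin q → Cochains S) :
    Cochains S :=
  act (p + q) (SurjOperad.E k p q) (Fin.append a b)

/-- The normalized cochains are closed under the coboundary, the cup product and all operations
`E^k_{p,q}`, and they contain the unit, so that they form a sub-structure of all cochains. -/
structure NormalizedClosed : Prop where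
  d : ∀ x : Cochains S, IsNormalized x → IsNormalized (d S x)
  cup : ∀ x y : Cochains S, IsNormalized x → IsNormalized y → IsNormalized (cup S x y)
  one : IsNormalized (one S)
  opE : ∀ (k p q : ℕ) (a : Fin p → Cochains S) (b : Fin q → Cochains S),
    (∀ i, IsNormalized (a i)) → (∀ j, IsNormalized (b j)) → IsNormalized (opE S k p q a b)

end SSetCochains

/-! The identities in the operad. Read from left to right, an admissible string is a walk. It starts
with a₁, b₁, a₁, and from then on the last two letters x, y belong to different groups. Only two
continuations exist: x is repeated, which starts a new row and exchanges the roles of the groups, or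
the successor of x comes, followed by y again. `isRows_iff_walks` and `E_eq_G` identify the elements
E^k_{p,q} with sums of such walks, and `F_succ` is the resulting recursion.

Every kind of term in (ehga) obeys a recursion of the same shape: deletions of a letter, doublings
of a letter (compositions with the product), products of two walks, multiplications by a last
letter, walks with one change of rows less. Their sum `total` therefore reproduces itself: for one
state of the walk it is the sum of its values for the two following states, with letters put in
front, up to strings with two equal neighbours. So `total` lies in the span `Deg` of such strings
(`total_mem_Deg`), and these are zero in the surjection operad. The beginning a₁, b₁, a₁ is treated
by hand: if the first a₁ is deleted, the next step decides whether a string of E^{k-1}_{n,m}(b; a)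
or of b₁E^k_{m,n-1} is left (`pre_pre_F`). This yields `ehga_G`.

For k = 0 the same identity with m = 1 and m = 2 gives the first two identities of a homotopy
G-algebra, except for the differential of (1,2,1), which is computed directly. For the third one,
the string a, b₁, a, …, b_m, a is cut, and a letter c is put in at each cut. A cut at a leaves c
outside, a cut at b_j puts c into the block of b_j (`plugL_brace`).

Renumbering is kept out of these arguments: `relabel_circ` translates ∘ᵢ into `plug z`, the
substitution for a fresh letter z, and the product becomes concatenation (`prodOp_eq_cat`).

The action on cochains. A cut of {0, …, N} along a string u is a lattice path in a rectangle whose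
columns are the letters of u and whose rows are the vertices. Intervals of the same letter are
disjoint exactly if no pair (letter, vertex) occurs twice on the path. Delete one point of a path in
all ways: the deletions of corners cancel in pairs, and the others remove a whole column or a whole
row (`pathSum_dels`). Columns give the operad differential, rows the coboundary, so the action is a
chain map (`dFun_rawAct`). A path over a composite u ∘ v is a path over u together with a path over
v in the rows that the first path visits in the slot (`pathSum_plugL`), so the action respects
composition (`rawAct_plug`). Strings with equal neighbours act by zero, since the path repeats a
point where it passes between the equal columns. Hence each identity of the operad passes to
cochains; associativity and the Leibniz rule of the cup product are also obtained in this way. On a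
degenerate simplex some column contains both collapsed vertices, so normalized cochains are
preserved. -/

namespace SurjOperad

/-! ### Linear toolkit for strings -/

section Toolkit

variable {M : Type*} [AddCommGroup M] [Module (ZMod 2) M]

theorem add_self_eq_zero (x : M) : x + x = 0 := by
  have h : (1 + 1 : ZMod 2) • x = 0 := by
    rw [show (1 + 1 : ZMod 2) = 0 from rfl, zero_smul]
  rwa [add_smul, one_smul] at h

theorem eq_of_add_eq_zero {x y : M} (h : x + y = 0) : x = y := by
  have := add_self_eq_zero y
  calc x = x + (y + y) := by rw [this, add_zero]
    _ = y := by rw [← add_assoc, h, zero_add]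

/-- The linear extension of a function on strings. -/
noncomputable def lift (f : List ℕ → M) : Strings →ₗ[ZMod 2] M :=
  Finsupp.linearCombination (ZMod 2) f

@[simp] theorem lift_str (f : List ℕ → M) (u : List ℕ) : lift f (str u) = f u := by
  simp [lift, str]

theorem lift_apply (f : List ℕ → M) (U : Strings) : lift f U = U.sum fun u c => c • f u := rfl

theorem hom_ext {f g : Strings →ₗ[ZMod 2] M} (h : ∀ u, f (str u) = g (str u)) : f = g :=
  Finsupp.lhom_ext' fun u => LinearMap.ext_ring (h u)

end Toolkit

/-- The sum of a list of strings. -/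
noncomputable def strs (l : List (List ℕ)) : Strings := (l.map str).sum

@[simp] theorem strs_nil : strs [] = 0 := rfl

@[simp] theorem strs_cons (u : List ℕ) (l : List (List ℕ)) : strs (u :: l) = str u + strs l := by
  simp [strs]

@[simp] theorem strs_append (l l' : List (List ℕ)) : strs (l ++ l') = strs l + strs l' := by
  simp [strs]

theorem lift_strs {M : Type*} [AddCommGroup M] [Module (ZMod 2) M] (f : List ℕ → M)
    (l : List (List ℕ)) : lift f (strs l) = (l.map f).sum := by
  induction l with
  | nil => simp
  | cons u l ih => simp [ih]

/-- Put the letter `a` in front. -/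
noncomputable def pre (a : ℕ) : Strings →ₗ[ZMod 2] Strings := lift fun u => str (a :: u)

@[simp] theorem pre_str (a : ℕ) (u : List ℕ) : pre a (str u) = str (a :: u) := lift_str _ _

theorem strs_map_cons (a : ℕ) (l : List (List ℕ)) : strs (l.map (a :: ·)) = pre a (strs l) := by
  rw [pre, lift_strs, strs, List.map_map]; rfl

/-- Rename the letters. -/
noncomputable def rename (ρ : ℕ → ℕ) : Strings →ₗ[ZMod 2] Strings := lift fun u => str (u.map ρ)

@[simp] theorem rename_str (ρ : ℕ → ℕ) (u : List ℕ) : rename ρ (str u) = str (u.map ρ) :=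
  lift_str _ _

theorem rename_strs (ρ : ℕ → ℕ) (l : List (List ℕ)) :
    rename ρ (strs l) = strs (l.map (List.map ρ)) := by
  rw [rename, lift_strs, strs, List.map_map]; rfl

theorem relabel_eq_rename (U : Strings) (l : List ℕ) :
    relabel U l = rename (fun x => l.getD (x - 1) 0) U := by
  simp [relabel, rename, lift_apply, Finsupp.mapDomain, str]

theorem rename_pre (ρ : ℕ → ℕ) (a : ℕ) (U : Strings) :
    rename ρ (pre a U) = pre (ρ a) (rename ρ U) := by
  have : rename ρ ∘ₗ pre a = pre (ρ a) ∘ₗ rename ρ := hom_ext fun u => by simp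
  exact LinearMap.congr_fun this U

/-- Concatenation of strings, extended bilinearly. -/
noncomputable def cat : Strings →ₗ[ZMod 2] Strings →ₗ[ZMod 2] Strings :=
  lift fun u => lift fun v => str (u ++ v)

@[simp] theorem cat_str (u v : List ℕ) : cat (str u) (str v) = str (u ++ v) := by simp [cat]

@[simp] theorem cat_nil (U : Strings) : cat (str []) U = U := by
  have : cat (str []) = LinearMap.id := hom_ext fun u => by simp
  rw [this]; rfl

@[simp] theorem cat_pre (a : ℕ) (U V : Strings) : cat (pre a U) V = pre a (cat U V) := by
  have : cat ∘ₗ pre a = (LinearMap.llcomp _ _ _ _ (pre a)) ∘ₗ cat :=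
    hom_ext fun u => hom_ext fun v => by simp
  exact LinearMap.congr_fun (LinearMap.congr_fun this U) V

/-! ### Strings with a given set of letters -/

/-- `u` has no equal neighbours and its set of letters is `J`. -/
def HasLetters (J : Finset ℕ) (u : List ℕ) : Prop := u.toFinset = J ∧ u.IsChain (· ≠ ·)

theorem hasLetters_iff {J : Finset ℕ} {u : List ℕ} :
    HasLetters J u ↔ (∀ x, x ∈ u ↔ x ∈ J) ∧ u.IsChain (· ≠ ·) := by
  simp [HasLetters, Finset.ext_iff]

theorem isSurj_iff {n : ℕ} {u : List ℕ} : IsSurj n u ↔ HasLetters (Finset.Icc 1 n) u := by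
  simp [IsSurj, hasLetters_iff]

/-- The span of the strings without equal neighbours whose set of letters is `J`. -/
noncomputable def SJ (J : Finset ℕ) : Submodule (ZMod 2) Strings :=
  Submodule.span (ZMod 2) (str '' {u | HasLetters J u})

theorem str_mem_SJ {J : Finset ℕ} {u : List ℕ} (h : HasLetters J u) : str u ∈ SJ J :=
  Submodule.subset_span ⟨u, h, rfl⟩

theorem strs_mem {p : Submodule (ZMod 2) Strings} {l : List (List ℕ)} (h : ∀ u ∈ l, str u ∈ p) :
    strs l ∈ p := by
  induction l with
  | nil => simp
  | cons u l ih =>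
    rw [strs_cons]
    exact p.add_mem (h u (by simp)) (ih fun v hv => h v (by simp [hv]))

theorem SJ_ext {M : Type*} [AddCommGroup M] [Module (ZMod 2) M] {J : Finset ℕ}
    {f g : Strings →ₗ[ZMod 2] M} (h : ∀ u, HasLetters J u → f (str u) = g (str u)) {U : Strings}
    (hU : U ∈ SJ J) : f U = g U := by
  refine LinearMap.eqOn_span (s := str '' {u | HasLetters J u}) ?_ hU
  rintro _ ⟨u, hu, rfl⟩
  exact h u hu

theorem SJ_ext₂ {M : Type*} [AddCommGroup M] [Module (ZMod 2) M] {J K : Finset ℕ}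
    {f g : Strings →ₗ[ZMod 2] Strings →ₗ[ZMod 2] M}
    (h : ∀ u, HasLetters J u → ∀ v, HasLetters K v → f (str u) (str v) = g (str u) (str v))
    {U V : Strings} (hU : U ∈ SJ J) (hV : V ∈ SJ K) : f U V = g U V := by
  have h1 : ∀ u, HasLetters J u → f.flip V (str u) = g.flip V (str u) := fun u hu =>
    SJ_ext (f := f (str u)) (g := g (str u)) (h u hu) hV
  exact SJ_ext (f := f.flip V) (g := g.flip V) h1 hU

theorem SJ_map {J : Finset ℕ} {p : Submodule (ZMod 2) Strings} {f : Strings →ₗ[ZMod 2] Strings}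
    (h : ∀ u, HasLetters J u → f (str u) ∈ p) {U : Strings} (hU : U ∈ SJ J) : f U ∈ p := by
  have : SJ J ≤ p.comap f := by
    refine Submodule.span_le.2 ?_
    rintro _ ⟨u, hu, rfl⟩
    exact h u hu
  exact this hU

theorem idOp_mem : idOp ∈ SJ (Finset.Icc 1 1) := str_mem_SJ (by simp [HasLetters])

theorem mu_mem : mu ∈ SJ (Finset.Icc 1 2) := str_mem_SJ (by simp [HasLetters]; rfl)

theorem getD_injOn {l : List ℕ} (h : l.Nodup) :
    Set.InjOn (fun x => l.getD (x - 1) 0) (Finset.Icc 1 l.length : Set ℕ) := by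
  intro x hx y hy hxy
  simp only [Finset.coe_Icc, Set.mem_Icc] at hx hy
  simp only [List.getD_eq_getElem?_getD] at hxy
  rw [List.getElem?_eq_getElem (by omega), List.getElem?_eq_getElem (by omega)] at hxy
  simp only [Option.getD_some] at hxy
  have := (List.Nodup.getElem_inj_iff h).1 hxy
  omega

theorem image_getD (l : List ℕ) :
    (Finset.Icc 1 l.length).image (fun x => l.getD (x - 1) 0) = l.toFinset := by
  ext y
  simp only [Finset.mem_image, Finset.mem_Icc, List.mem_toFinset, List.mem_iff_getElem]
  constructor
  · rintro ⟨x, hx, rfl⟩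
    refine ⟨x - 1, by omega, ?_⟩
    simp [List.getD_eq_getElem?_getD, List.getElem?_eq_getElem (show x - 1 < l.length by omega)]
  · rintro ⟨i, hi, rfl⟩
    refine ⟨i + 1, by omega, ?_⟩
    simp [List.getD_eq_getElem?_getD, List.getElem?_eq_getElem hi]

theorem HasLetters.map {J : Finset ℕ} {u : List ℕ} (hu : HasLetters J u) {ρ : ℕ → ℕ}
    (h : Set.InjOn ρ J) : HasLetters (J.image ρ) (u.map ρ) := by
  obtain ⟨h1, h2⟩ := hu
  refine ⟨?_, ?_⟩
  · ext; simp [← h1]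
  · rw [List.isChain_map]
    have h3 : u.IsChain fun a b => a ∈ J ∧ b ∈ J ∧ a ≠ b := by
      have : ∀ x ∈ u, x ∈ J := by intro x hx; rw [← h1]; simpa using hx
      clear h1
      induction u with
      | nil => simp
      | cons a u ih =>
        cases u with
        | nil => simp
        | cons b u =>
          simp only [List.isChain_cons_cons] at h2 ⊢
          exact ⟨⟨this _ (by simp), this _ (by simp), h2.1⟩,
            ih h2.2 fun x hx => this x (by simp at hx ⊢; tauto)⟩
    exact h3.imp fun a b hab e => hab.2.2 (h hab.1 hab.2.1 e)

theorem relabel_mem {U : Strings} {l : List ℕ} (hl : l.Nodup)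
    (hU : U ∈ SJ (Finset.Icc 1 l.length)) : relabel U l ∈ SJ l.toFinset := by
  rw [relabel_eq_rename, ← image_getD]
  refine SJ_map (fun u hu => ?_) hU
  rw [rename_str]
  exact str_mem_SJ (hu.map (getD_injOn hl))

/-! ### Plugging a string into a letter -/

/-- The slot of `plugL`: `f` is the plugging into the rest of the string. -/
def plugSlot (f : List ℕ → List (List ℕ)) : List ℕ → List (List ℕ)
  | [] => []
  -- The letter c is written. Either the piece ends with c, and c stays in front of the remainder
  -- because the next piece starts with it, or the piece goes on.
  | c :: v => (f (c :: v) ++ plugSlot f v).map (c :: ·)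

/-- The terms of `u ∘_z v` without renumbering of letters. -/
def plugL (z : ℕ) : List ℕ → List ℕ → List (List ℕ)
  -- The letter written last stays in the remainder, so a remainder of length one means that v is
  -- used up.
  | [], v => if v.length = 1 then [[]] else []
  | a :: u, v => if a = z then plugSlot (plugL z u) v else (plugL z u v).map (a :: ·)

/-- The bilinear extension of `plugL`. -/
noncomputable def plug (z : ℕ) : Strings →ₗ[ZMod 2] Strings →ₗ[ZMod 2] Strings :=
  lift fun u => lift fun v => strs (plugL z u v)

@[simp] theorem plug_str (z : ℕ) (u v : List ℕ) :
    plug z (str u) (str v) = strs (plugL z u v) := by simp [plug]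

/-- The index s is the position in v of the last letter of the piece. This is the form in which
`compStr` cuts. -/
theorem plugSlot_eq (f : List ℕ → List (List ℕ)) (v : List ℕ) :
    plugSlot f v = (List.range v.length).flatMap fun s =>
      (f (v.drop s)).map (v.take (s + 1) ++ ·) := by
  induction v with
  | nil => rfl
  | cons c v ih =>
    simp [plugSlot, ih, List.range_succ_eq_map, List.flatMap_map, List.map_flatMap,
      Function.comp_def]

theorem plugL_eq_of_notMem {z : ℕ} {u : List ℕ} (h : z ∉ u) (v : List ℕ) :
    plugL z u v = if v.length = 1 then [u] else [] := by
  induction u with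
  | nil => rfl
  | cons a u ih =>
    simp only [List.mem_cons, not_or] at h
    rw [plugL, if_neg (Ne.symm h.1), ih h.2]
    split_ifs <;> simp

/-- If the slot does not occur again, the remainder has to shrink to one letter, so the piece is all
of v. -/
theorem plugSlot_singleton (u : List ℕ) {v : List ℕ} (hv : v ≠ []) :
    plugSlot (fun v => if v.length = 1 then [u] else []) v = [v ++ u] := by
  induction v with
  | nil => exact absurd rfl hv
  | cons c v ih =>
    rw [plugSlot]
    cases v with
    | nil => simp [plugSlot]
    | cons d v => rw [ih (by simp)]; simp

theorem plugL_slot_of_notMem {z : ℕ} {u v : List ℕ} (h : z ∉ u) (hv : v ≠ []) :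
    plugL z (z :: u) v = [v ++ u] := by
  rw [plugL, if_pos rfl]
  simp only [funext (plugL_eq_of_notMem h)]
  exact plugSlot_singleton u hv

/-- Here ρ names the letters of the composite, while ρ' and σ name those of u and v, with z for the
slot. The two recursions agree up to the last occurrence of i. There `compStr` inserts all that is
left of v, and `plugL` is forced to do the same by its base case. The slot must have a name of its
own, whence the hypothesis on ρ' x = z. -/
theorem compStr_eq_plugL {i m z : ℕ} {ρ ρ' σ : ℕ → ℕ} :
    ∀ {u v : List ℕ}, i ∈ u → v ≠ [] →
    (∀ x ∈ u, x < i → ρ' x = ρ x) → (∀ x ∈ u, i < x → ρ' x = ρ (x + m - 1)) → ρ' i = z →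
    (∀ x ∈ u, ρ' x = z → x = i) → (∀ y ∈ v, σ y = ρ (y + i - 1)) →
    (compStr i m u v).map (List.map ρ) = plugL z (u.map ρ') (v.map σ)
  | [], v, hi, _, _, _, _, _, _ => by simp at hi
  | x :: u, v, hi, hv, h1, h2, h3, h4, h5 => by
    have hnot : i ∉ u → ∀ v, (compStr i m u v).map (List.map ρ) = [u.map ρ'] := by
      intro hu v
      clear hi h4
      induction u with
      | nil => rfl
      | cons y u ih =>
        simp only [List.mem_cons, not_or] at hu
        rw [compStr, if_neg (Ne.symm hu.1), List.map_map, List.map_cons]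
        have := ih (fun x hx => h1 x (by simp at hx ⊢; tauto))
          (fun x hx => h2 x (by simp at hx ⊢; tauto)) hu.2
        have e : ρ (if y < i then y else y + m - 1) = ρ' y := by
          split_ifs with hy
          · exact (h1 y (by simp) hy).symm
          · exact (h2 y (by simp) (by have := hu.1; omega)).symm
        have : (List.map (List.map ρ) (compStr i m u v)).map (ρ' y :: ·) = [ρ' y :: u.map ρ'] := by
          rw [this]; rfl
        rw [← this, List.map_map]
        refine List.map_congr_left fun w _ => ?_
        simp [e]
    have hz : i ∉ u → z ∉ u.map ρ' := by
      intro hu hm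
      obtain ⟨y, hy, hyz⟩ := List.mem_map.1 hm
      exact hu (h4 y (by simp [hy]) hyz ▸ hy)
    have hσ : ∀ v' : List ℕ, (∀ y ∈ v', y ∈ v) →
        (v'.map (· + i - 1)).map ρ = v'.map σ := by
      intro v' hv'
      rw [List.map_map]
      exact List.map_congr_left fun y hy => (h5 y (hv' y hy)).symm
    by_cases hx : x = i
    · subst hx
      rw [compStr, if_pos rfl, List.map_cons, h3]
      by_cases hu : x ∈ u
      · rw [if_pos hu, plugL, if_pos rfl, plugSlot_eq, List.map_flatMap]
        rw [List.length_map]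
        refine List.flatMap_congr fun s hs => ?_
        rw [List.mem_range] at hs
        have := compStr_eq_plugL (m := m) (z := z) (ρ := ρ) (ρ' := ρ') (σ := σ) (u := u)
          (v := v.drop s) hu (by simp; omega)
          (fun x hx => h1 x (by simp [hx])) (fun x hx => h2 x (by simp [hx])) h3
          (fun x hx => h4 x (by simp [hx])) (fun y hy => h5 y (List.mem_of_mem_drop hy))
        rw [← List.map_drop, ← this, List.map_map, List.map_map, ← List.map_take]
        refine List.map_congr_left fun w _ => ?_
        simp only [Function.comp_apply, List.map_append]
        rw [hσ _ fun y hy => List.mem_of_mem_take hy]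
      · rw [if_neg hu, plugL_slot_of_notMem (hz hu) (by simpa using hv), List.map_map]
        have : (List.map (List.map ρ) (compStr x m u v)).map (v.map σ ++ ·)
            = [v.map σ ++ u.map ρ'] := by rw [hnot hu]; rfl
        rw [← this, List.map_map]
        refine List.map_congr_left fun w _ => ?_
        simp only [Function.comp_apply, List.map_append]
        rw [hσ _ fun y hy => hy]
    · have hu : i ∈ u := by
        rcases List.mem_cons.1 hi with h | h
        · exact absurd h.symm hx
        · exact h
      have hne : ρ' x ≠ z := fun h => hx (h4 x (by simp) h)
      rw [compStr, if_neg hx, List.map_cons, plugL, if_neg hne, ← compStr_eq_plugL (m := m) (z := z)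
          (ρ := ρ) (ρ' := ρ') (σ := σ) (u := u) (v := v) hu hv
          (fun x hx => h1 x (by simp [hx])) (fun x hx => h2 x (by simp [hx])) h3
          (fun x hx => h4 x (by simp [hx])) h5, List.map_map, List.map_map]
      have e : ρ (if x < i then x else x + m - 1) = ρ' x := by
        split_ifs with hy
        · exact (h1 x (by simp) hy).symm
        · exact (h2 x (by simp) (by omega)).symm
      refine List.map_congr_left fun w _ => ?_
      simp [e]

/-- `circ`, extended bilinearly. -/
noncomputable def circB (i m : ℕ) : Strings →ₗ[ZMod 2] Strings →ₗ[ZMod 2] Strings :=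
  lift fun u => lift fun v => strs (compStr i m u v)

theorem circ_eq_circB (i m : ℕ) (U V : Strings) : circ i m U V = circB i m U V := by
  rw [circB, lift_apply, Finsupp.sum, LinearMap.sum_apply, circ, Finsupp.sum]
  refine Finset.sum_congr rfl fun u _ => ?_
  rw [LinearMap.smul_apply, lift_apply, Finsupp.smul_sum]
  refine Finset.sum_congr rfl fun v _ => ?_
  change _ = U u • V v • (List.map str _).sum
  rw [List.smul_sum, List.smul_sum, List.map_map, List.map_map]
  simp [mul_smul, Function.comp_def]

theorem getD_append_left {l l' : List ℕ} {k : ℕ} (h : k < l.length) :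
    (l ++ l').getD k 0 = l.getD k 0 := by
  simp [List.getD_eq_getElem?_getD, List.getElem?_append_left h]

theorem getD_append_right {l l' : List ℕ} {k : ℕ} (h : l.length ≤ k) :
    (l ++ l').getD k 0 = l'.getD (k - l.length) 0 := by
  simp [List.getD_eq_getElem?_getD, List.getElem?_append_right h]

/-- The bridge from numbered inputs to named letters: the shifts of ∘ᵢ disappear once U carries a
fresh letter z at input i and V carries its final letters l. -/
theorem relabel_circ {U V : Strings} {l₁ l l₃ : List ℕ} {z : ℕ}
    (hU : U ∈ SJ (Finset.Icc 1 (l₁.length + 1 + l₃.length)))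
    (hV : V ∈ SJ (Finset.Icc 1 l.length)) (hl : l ≠ []) (h1 : z ∉ l₁) (h3 : z ∉ l₃) :
    relabel (circ (l₁.length + 1) l.length U V) (l₁ ++ l ++ l₃) =
      plug z (relabel U (l₁ ++ z :: l₃)) (relabel V l) := by
  have hpos : 0 < l.length := List.length_pos_iff.2 hl
  simp only [relabel_eq_rename, circ_eq_circB]
  have key : ∀ u, HasLetters (Finset.Icc 1 (l₁.length + 1 + l₃.length)) u →
      ∀ v, HasLetters (Finset.Icc 1 l.length) v →
      rename (fun x => (l₁ ++ l ++ l₃).getD (x - 1) 0)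
          (circB (l₁.length + 1) l.length (str u) (str v)) =
        plug z (rename (fun x => (l₁ ++ z :: l₃).getD (x - 1) 0) (str u))
          (rename (fun x => l.getD (x - 1) 0) (str v)) := by
    intro u hu v hv
    rw [hasLetters_iff] at hu hv
    simp only [Finset.mem_Icc] at hu hv
    simp only [circB, lift_str, rename_strs, rename_str, plug_str]
    congr 1
    apply compStr_eq_plugL
    · exact (hu.1 _).2 ⟨by omega, by omega⟩
    · rintro rfl
      simpa using (hv.1 1).2 ⟨le_rfl, hpos⟩
    · intro x hx hlt
      have := (hu.1 x).1 hx
      simp only [List.append_assoc]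
      rw [getD_append_left (by omega), getD_append_left (by omega)]
    · intro x hx hlt
      have := (hu.1 x).1 hx
      rw [getD_append_right (by omega), getD_append_right (by simp; omega)]
      rw [show x - 1 - l₁.length = (x - l₁.length - 2) + 1 by omega, List.getD_cons_succ]
      congr 1
      simp
      omega
    · rw [getD_append_right (by simp)]
      simp
    · intro x hx hz
      have := (hu.1 x).1 hx
      by_contra hne
      rcases Nat.lt_or_ge (x - 1) l₁.length with h | h
      · rw [getD_append_left h] at hz
        apply h1
        rw [← hz, List.getD_eq_getElem?_getD, List.getElem?_eq_getElem h]
        exact List.getElem_mem _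
      · rw [getD_append_right h, show x - 1 - l₁.length = (x - l₁.length - 2) + 1 by omega,
          List.getD_cons_succ] at hz
        apply h3
        have h' : x - l₁.length - 2 < l₃.length := by omega
        rw [← hz, List.getD_eq_getElem?_getD, List.getElem?_eq_getElem h']
        exact List.getElem_mem _
    · intro y hy
      have := (hv.1 y).1 hy
      rw [getD_append_left (by simp; omega), getD_append_right (by omega)]
      congr 1
      omega
  have := SJ_ext₂ (f := (circB (l₁.length + 1) l.length).compr₂
    (rename fun x => (l₁ ++ l ++ l₃).getD (x - 1) 0))
    (g := (plug z).compl₁₂ (rename fun x => (l₁ ++ z :: l₃).getD (x - 1) 0)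
      (rename fun x => l.getD (x - 1) 0)) key hU hV
  simpa only [LinearMap.compr₂_apply, LinearMap.compl₁₂_apply] using this

/-! ### Letters of composites -/

theorem mem_of_mem_plugSlot {f : List ℕ → List (List ℕ)} {v w : List ℕ} (h : w ∈ plugSlot f v) :
    ∃ c v₁ v₂ w', v = v₁ ++ c :: v₂ ∧ w' ∈ f (c :: v₂) ∧ w = v₁ ++ c :: w' := by
  induction v generalizing w with
  | nil => simp [plugSlot] at h
  | cons c v ih =>
    simp only [plugSlot, List.mem_map, List.mem_append] at h
    obtain ⟨w', h | h, rfl⟩ := h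
    · exact ⟨c, [], v, w', rfl, h, rfl⟩
    · obtain ⟨d, v₁, v₂, w', rfl, h2, rfl⟩ := ih h
      exact ⟨d, c :: v₁, v₂, w', rfl, h2, rfl⟩

/-- The last clause depends on the base case of `plugL`: no letter of v may be left over. -/
theorem mem_letters_plugL {z : ℕ} {u v w : List ℕ} (h : w ∈ plugL z u v) :
    (∀ x ∈ w, (x ∈ u ∧ x ≠ z) ∨ x ∈ v) ∧ (∀ x ∈ u, x ≠ z → x ∈ w) ∧
      (z ∈ u → ∀ x ∈ v, x ∈ w) := by
  induction u generalizing v w with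
  | nil =>
    simp only [plugL] at h
    split_ifs at h <;> simp at h
    subst h; simp
  | cons a u ih =>
    rw [plugL] at h
    split_ifs at h with ha
    · subst ha
      obtain ⟨c, v₁, v₂, w', rfl, h2, rfl⟩ := mem_of_mem_plugSlot h
      obtain ⟨i1, i2, i3⟩ := ih h2
      refine ⟨?_, ?_, ?_⟩
      · intro x hx
        simp only [List.mem_append, List.mem_cons] at hx ⊢
        rcases hx with hx | hx | hx
        · tauto
        · tauto
        · have := i1 x hx
          simp only [List.mem_cons] at this
          tauto
      · intro x hx hxa
        simp only [List.mem_append, List.mem_cons] at hx ⊢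
        have := i2 x
        tauto
      · intro _ x hx
        simp only [List.mem_append, List.mem_cons] at hx ⊢
        by_cases hu : a ∈ u
        · have := i3 hu x
          simp only [List.mem_cons] at this
          tauto
        · rw [plugL_eq_of_notMem hu] at h2
          split_ifs at h2 with hl
          · simp only [List.length_cons, Nat.add_eq_right, List.length_eq_zero_iff] at hl
            subst hl
            simp only [List.not_mem_nil, or_false] at hx
            tauto
          · simp at h2
    · obtain ⟨w', h', rfl⟩ := List.mem_map.1 h
      obtain ⟨i1, i2, i3⟩ := ih h'
      refine ⟨?_, ?_, ?_⟩
      · intro x hx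
        simp only [List.mem_cons] at hx ⊢
        rcases hx with rfl | hx
        · tauto
        · have := i1 x hx
          tauto
      · intro x hx hxa
        simp only [List.mem_cons] at hx ⊢
        have := i2 x
        tauto
      · intro hz x hx
        have hz' : z ∈ u := by
          rcases List.mem_cons.1 hz with h | h
          · exact absurd h.symm ha
          · exact h
        exact List.mem_cons_of_mem _ (i3 hz' x hx)

theorem head_plugL {z : ℕ} {u v w : List ℕ} (h : w ∈ plugL z u v) :
    ∀ y ∈ w.head?, (y ∈ u.head? ∧ y ≠ z) ∨ (u.head? = some z ∧ y ∈ v.head?) := by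
  cases u with
  | nil =>
    simp only [plugL] at h
    split_ifs at h <;> simp at h
    subst h; simp
  | cons a u =>
    rw [plugL] at h
    split_ifs at h with ha
    · subst ha
      obtain ⟨c, v₁, v₂, w', rfl, h2, rfl⟩ := mem_of_mem_plugSlot h
      cases v₁ <;> simp
    · obtain ⟨w', h', rfl⟩ := List.mem_map.1 h
      simp [ha]

/-- Equal neighbours could only arise where a piece meets the rest of u. The letter of u there is
not the slot, because u has no equal neighbours, and then it is not a letter of v either. -/
theorem isChain_plugL {z : ℕ} {u v w : List ℕ} (hu : u.IsChain (· ≠ ·)) (hv : v.IsChain (· ≠ ·))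
    (hd : ∀ x ∈ u, x ≠ z → x ∉ v) (h : w ∈ plugL z u v) : w.IsChain (· ≠ ·) := by
  induction u generalizing v w with
  | nil =>
    simp only [plugL] at h
    split_ifs at h <;> simp at h
    subst h; simp
  | cons a u ih =>
    rw [List.isChain_cons] at hu
    rw [plugL] at h
    split_ifs at h with ha
    · subst ha
      induction v generalizing w with
      | nil => simp [plugSlot] at h
      | cons c v ihv =>
        simp only [plugSlot, List.mem_map, List.mem_append] at h
        obtain ⟨w', h, rfl⟩ := h
        rw [List.isChain_cons]
        rcases h with h | h
        · refine ⟨fun y hy hcy => ?_, ih hu.2 hv (fun x hx => hd x (by simp [hx])) h⟩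
          rcases head_plugL h y hy with ⟨h1, h2⟩ | ⟨h1, h2⟩
          · exact hd y (List.mem_cons_of_mem _ (List.mem_of_mem_head? h1)) h2 (by simp [hcy])
          · exact hu.1 a (by simp [h1]) rfl
        · rw [List.isChain_cons] at hv
          refine ⟨fun y hy => hv.1 y ?_, ihv hv.2 (fun x hx hxa hxv => hd x hx hxa (by simp [hxv])) h⟩
          have h' : w' ∈ plugL a (a :: u) v := by rw [plugL, if_pos rfl]; exact h
          rcases head_plugL h' y hy with ⟨h1, h2⟩ | ⟨h1, h2⟩
          · simp at h1; exact absurd h1.symm h2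
          · exact h2
    · obtain ⟨w', h', rfl⟩ := List.mem_map.1 h
      rw [List.isChain_cons]
      refine ⟨fun y hy hay => ?_, ih hu.2 hv (fun x hx => hd x (by simp [hx])) h'⟩
      rcases head_plugL h' y hy with ⟨h1, h2⟩ | ⟨h1, h2⟩
      · exact hu.1 y h1 hay
      · exact hd a (by simp) ha (hay ▸ List.mem_of_mem_head? h2)

theorem hasLetters_plugL {J K : Finset ℕ} {z : ℕ} {u v w : List ℕ} (hz : z ∈ J)
    (hd : Disjoint (J.erase z) K) (hu : HasLetters J u) (hv : HasLetters K v)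
    (h : w ∈ plugL z u v) : HasLetters (J.erase z ∪ K) w := by
  rw [hasLetters_iff] at *
  obtain ⟨h1, h2, h3⟩ := mem_letters_plugL h
  constructor
  · intro x
    simp only [Finset.mem_union, Finset.mem_erase, ← hu.1, ← hv.1]
    constructor
    · intro hx; have := h1 x hx; tauto
    · rintro (⟨hx, hxu⟩ | hx)
      · exact h2 x hxu hx
      · exact h3 ((hu.1 z).2 hz) x hx
  · refine isChain_plugL hu.2 hv.2 (fun x hx hxz hxv => ?_) h
    exact Finset.disjoint_left.1 hd (Finset.mem_erase.2 ⟨hxz, (hu.1 x).1 hx⟩) ((hv.1 x).1 hxv)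

theorem relabel_range' {n : ℕ} {U : Strings} (hU : U ∈ SJ (Finset.Icc 1 n)) :
    relabel U (List.range' 1 n) = U := by
  rw [relabel_eq_rename]
  refine SJ_ext (g := LinearMap.id) (fun u hu => ?_) hU
  rw [rename_str, LinearMap.id_apply]
  congr 1
  conv_rhs => rw [← List.map_id u]
  refine List.map_congr_left fun x hx => ?_
  have := ((hasLetters_iff.1 hu).1 x).1 hx
  rw [Finset.mem_Icc] at this
  rw [List.getD_eq_getElem?_getD, List.getElem?_eq_getElem (by simp; omega)]
  simp
  omega

theorem circ_mem {n m i : ℕ} (hi : 1 ≤ i) (hin : i ≤ n) (hm : 1 ≤ m) {U V : Strings}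
    (hU : U ∈ SJ (Finset.Icc 1 n)) (hV : V ∈ SJ (Finset.Icc 1 m)) :
    circ i m U V ∈ SJ (Finset.Icc 1 (n + m - 1)) := by
  rw [circ_eq_circB]
  refine SJ_map (f := (circB i m).flip V) (fun u hu => ?_) hU
  refine SJ_map (f := circB i m (str u)) (fun v hv => ?_) hV
  simp only [circB, lift_str]
  -- The composite has the letters 1, …, n + m - 1, so n + m is free to name the slot.
  set ρ' : ℕ → ℕ := fun x => if x < i then x else if x = i then n + m else x + m - 1 with hρ'
  set σ : ℕ → ℕ := fun y => y + i - 1 with hσ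
  have hu' := hasLetters_iff.1 hu
  have hv' := hasLetters_iff.1 hv
  simp only [Finset.mem_Icc] at hu' hv'
  have e := compStr_eq_plugL (i := i) (m := m) (z := n + m) (ρ := id) (ρ' := ρ') (σ := σ)
    (u := u) (v := v) ((hu'.1 _).2 ⟨hi, hin⟩)
    (by rintro rfl; simpa using (hv'.1 1).2 ⟨le_rfl, hm⟩)
    (by intro x _ h; simp [hρ', h])
    (by
      intro x _ h
      simp only [hρ', id]
      rw [if_neg (by omega), if_neg (by omega)])
    (by simp [hρ'])
    (by
      intro x hx h
      have := (hu'.1 x).1 hx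
      simp only [hρ'] at h
      split_ifs at h <;> omega)
    (by intro y _; rfl)
  rw [List.map_id_fun, List.map_id] at e
  rw [e]
  refine strs_mem fun w hw => str_mem_SJ ?_
  have hJ : HasLetters ((Finset.Icc 1 n).image ρ') (u.map ρ') := by
    refine hu.map ?_
    intro x hx y hy hxy
    simp only [Finset.coe_Icc, Set.mem_Icc] at hx hy
    simp only [hρ'] at hxy
    split_ifs at hxy <;> omega
  have hK : HasLetters ((Finset.Icc 1 m).image σ) (v.map σ) := by
    refine hv.map ?_
    intro x hx y hy hxy
    simp only [Finset.coe_Icc, Set.mem_Icc] at hx hy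
    simp only [hσ] at hxy
    omega
  have := hasLetters_plugL (z := n + m) ?_ ?_ hJ hK hw
  · convert this using 1
    ext x
    simp only [Finset.mem_union, Finset.mem_erase, Finset.mem_image, Finset.mem_Icc, hρ', hσ]
    constructor
    · intro hx
      by_cases h1 : x < i
      · exact Or.inl ⟨by omega, x, by omega, by simp [h1]⟩
      · by_cases h2 : x < i + m
        · exact Or.inr ⟨x + 1 - i, by omega, by omega⟩
        · refine Or.inl ⟨by omega, x + 1 - m, by omega, ?_⟩
          rw [if_neg (by omega), if_neg (by omega)]
          omega
    · rintro (⟨hx, y, hy, rfl⟩ | ⟨y, hy, rfl⟩)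
      · split_ifs at hx ⊢ <;> omega
      · omega
  · exact Finset.mem_image.2 ⟨i, by simp [hi, hin], by simp [hρ']⟩
  · rw [Finset.disjoint_left]
    intro x
    simp only [Finset.mem_erase, Finset.mem_image, Finset.mem_Icc, hρ', hσ]
    rintro ⟨hx, y, hy, rfl⟩ ⟨y', hy', h⟩
    split_ifs at hx h <;> omega

/-! ### Composites of several operations -/

/-- The arities in a list of operations with their inputs are correct. -/
def GoodInputs (L : List (Strings × List ℕ)) : Prop :=
  ∀ p ∈ L, p.1 ∈ SJ (Finset.Icc 1 p.2.length) ∧ p.2 ≠ []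

theorem compAll_mem : ∀ {L : List (Strings × List ℕ)} {i : ℕ} {U : Strings}, GoodInputs L →
    U ∈ SJ (Finset.Icc 1 (i + L.length)) →
    compAll U (i + 1) L ∈ SJ (Finset.Icc 1 (i + (L.flatMap Prod.snd).length))
  | [], i, U, _, hU => by simpa [compAll] using hU
  | (V, l) :: L, i, U, hL, hU => by
    have h1 := hL (V, l) (by simp)
    have hpos := List.length_pos_iff.2 h1.2
    have h2 : compAll U (i + 1 + 1) L ∈ SJ (Finset.Icc 1 (i + 1 + (L.flatMap Prod.snd).length)) :=
      compAll_mem (fun p hp => hL p (by simp [hp]))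
        (by rw [List.length_cons] at hU; convert hU using 3; omega)
    rw [compAll]
    have := circ_mem (i := i + 1) (by omega) (by omega) hpos h2 h1.1
    convert this using 3
    simp only [List.flatMap_cons, List.length_append]
    omega

/-- Plug strings into several letters. -/
noncomputable def plugs (T : Strings) : List (ℕ × Strings) → Strings
  | [] => T
  | (z, V) :: r => plug z (plugs T r) V

/-- Both sides fill the later inputs first, so the number of an earlier input is still correct when
its turn comes. The slots zs avoid all letters that are put in. -/
theorem relabel_compAll : ∀ {L : List (Strings × List ℕ)} {zs l₀ : List ℕ} {U : Strings},
    GoodInputs L → U ∈ SJ (Finset.Icc 1 (l₀.length + L.length)) → zs.length = L.length →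
    (l₀ ++ zs).Nodup → zs.Disjoint (L.flatMap Prod.snd) →
    relabel (compAll U (l₀.length + 1) L) (l₀ ++ L.flatMap Prod.snd) =
      plugs (relabel U (l₀ ++ zs)) (zs.zip (L.map fun p => relabel p.1 p.2))
  | [], zs, l₀, U, _, _, hz, _, _ => by
    obtain rfl : zs = [] := List.length_eq_zero_iff.1 hz
    simp [compAll, plugs]
  | (V, l) :: L, [], l₀, U, _, _, hz, _, _ => by simp at hz
  | (V, l) :: L, z :: zs, l₀, U, hL, hU, hz, hn, hd => by
    have h1 := hL (V, l) (by simp)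
    have hL' : GoodInputs L := fun p hp => hL p (by simp [hp])
    have hU' : U ∈ SJ (Finset.Icc 1 (l₀.length + 1 + L.length)) := by
      rw [List.length_cons] at hU; convert hU using 3; omega
    rw [compAll, List.flatMap_cons, ← List.append_assoc]
    simp only [List.flatMap_cons, List.disjoint_cons_left, List.disjoint_append_right] at hd
    rw [relabel_circ (z := z) (compAll_mem hL' hU') h1.1 h1.2]
    · rw [List.map_cons, List.zip_cons_cons, plugs]
      congr 2
      have := relabel_compAll (L := L) (zs := zs) (l₀ := l₀ ++ [z]) (U := U) hL'
        (by simpa using hU') (by simpa using hz) (by simpa using hn) hd.2.2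
      simpa using this
    · intro h
      rw [List.nodup_append] at hn
      exact hn.2.2 z h z (by simp) rfl
    · exact hd.2.1

theorem subst_eq_plugs {L : List (Strings × List ℕ)} {zs : List ℕ} {U : Strings}
    (hL : GoodInputs L) (hU : U ∈ SJ (Finset.Icc 1 L.length)) (hz : zs.length = L.length)
    (hn : zs.Nodup) (hd : zs.Disjoint (L.flatMap Prod.snd)) :
    subst U L = plugs (relabel U zs) (zs.zip (L.map fun p => relabel p.1 p.2)) := by
  have := relabel_compAll (L := L) (zs := zs) (l₀ := []) (U := U) hL (by simpa using hU) hz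
    (by simpa using hn) hd
  simpa [subst] using this

/-- Each slot occurs once, so each substitution has a single term. As V is put in before U, its
letters have to avoid z. -/
theorem plugs_mu {U V : Strings} {J K : Finset ℕ} (hU : U ∈ SJ J) (hV : V ∈ SJ K)
    (hJ : J.Nonempty) (hK : K.Nonempty) {z z' : ℕ} (hz : z ∉ K) (hzz : z ≠ z') :
    plugs (str [z, z']) [(z, U), (z', V)] = cat U V := by
  simp only [plugs]
  refine SJ_ext₂ (f := ((plug z).flip).compl₁₂ LinearMap.id (plug z' (str [z, z'])))
    (g := cat) (fun u hu v hv => ?_) hU hV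
  have hv0 : v ≠ [] := by
    rintro rfl
    obtain ⟨x, hx⟩ := hK
    simpa using ((hasLetters_iff.1 hv).1 x).2 hx
  have hu0 : u ≠ [] := by
    rintro rfl
    obtain ⟨x, hx⟩ := hJ
    simpa using ((hasLetters_iff.1 hu).1 x).2 hx
  simp only [LinearMap.compl₁₂_apply, LinearMap.id_apply, LinearMap.flip_apply, plug_str, cat_str]
  rw [plugL, if_neg hzz, plugL_slot_of_notMem (by simp) hv0]
  simp only [List.append_nil, List.map_cons, List.map_nil, strs_cons, strs_nil, add_zero, plug_str]
  rw [plugL_slot_of_notMem (fun h => hz (((hasLetters_iff.1 hv).1 z).1 h)) hu0]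
  simp

theorem exists_fresh (J : Finset ℕ) : ∃ z : ℕ, z ∉ J := Infinite.exists_notMem_finset J

theorem prodOp_eq_cat {U V : Strings} {l l' : List ℕ} (hU : U ∈ SJ (Finset.Icc 1 l.length))
    (hV : V ∈ SJ (Finset.Icc 1 l'.length)) (hl : l ≠ []) (hl' : l' ≠ []) (hn : l.Nodup)
    (hn' : l'.Nodup) : prodOp U l V l' = cat (relabel U l) (relabel V l') := by
  obtain ⟨z, hz⟩ := exists_fresh (l.toFinset ∪ l'.toFinset)
  obtain ⟨z', hz'⟩ := exists_fresh (l.toFinset ∪ l'.toFinset ∪ {z})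
  simp only [Finset.mem_union, List.mem_toFinset, Finset.mem_singleton, not_or] at hz hz'
  rw [prodOp, subst_eq_plugs (zs := [z, z'])]
  · rw [show relabel mu [z, z'] = str [z, z'] by simp [relabel_eq_rename, mu]]
    exact plugs_mu (relabel_mem hn hU) (relabel_mem hn' hV) (by simpa using hl)
      (by simpa using hl') (by simpa using hz.2) (Ne.symm hz'.2)
  · intro p hp
    simp only [List.mem_cons, List.not_mem_nil, or_false] at hp
    rcases hp with rfl | rfl
    · exact ⟨hU, hl⟩
    · exact ⟨hV, hl'⟩
  · exact mu_mem
  · simp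
  · simpa using Ne.symm hz'.2
  · simp; tauto

theorem cat_mem {U V : Strings} {J K : Finset ℕ} (hU : U ∈ SJ J) (hV : V ∈ SJ K)
    (hd : Disjoint J K) : cat U V ∈ SJ (J ∪ K) := by
  refine SJ_map (f := cat.flip V) (fun u hu => ?_) hU
  refine SJ_map (f := cat (str u)) (fun v hv => ?_) hV
  rw [cat_str]
  refine str_mem_SJ ⟨by rw [List.toFinset_append, hu.1, hv.1], ?_⟩
  rw [List.isChain_append]
  refine ⟨hu.2, hv.2, fun x hx y hy hxy => ?_⟩
  have h1 := List.mem_of_mem_getLast? hx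
  have h2 := List.mem_of_mem_head? hy
  exact Finset.disjoint_left.1 hd (((hasLetters_iff.1 hu).1 x).1 h1)
    (hxy ▸ ((hasLetters_iff.1 hv).1 y).1 h2)

theorem relabel_idOp (a : ℕ) : relabel idOp [a] = str [a] := by simp [relabel_eq_rename, idOp]

/-- The composite has the letters 1, …, n + 1, so every larger z can name the slot that is filled
with i, i + 1. -/
theorem circ_mu_eq_plug {n i z : ℕ} {U : Strings} (hU : U ∈ SJ (Finset.Icc 1 n)) (hi : 1 ≤ i)
    (hin : i ≤ n) (hz : n + 1 < z) :
    circ i 2 U mu =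
      plug z (relabel U (List.range' 1 (i - 1) ++ z :: List.range' (i + 2) (n - i)))
        (str [i, i + 1]) := by
  have h := relabel_circ (U := U) (V := mu) (l₁ := List.range' 1 (i - 1)) (l := [i, i + 1])
    (l₃ := List.range' (i + 2) (n - i)) (z := z)
    (by simp only [List.length_range']; convert hU using 3; omega) mu_mem (by simp)
    (by simp; omega) (by simp; omega)
  rw [show relabel mu [i, i + 1] = str [i, i + 1] by simp [relabel_eq_rename, mu]] at h
  rw [← h, List.length_range', show i - 1 + 1 = i by omega]
  have hr : List.range' 1 (i - 1) ++ [i, i + 1] ++ List.range' (i + 2) (n - i) =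
      List.range' 1 (n + 2 - 1) := by
    have h1 : [i, i + 1] = List.range' (1 + (i - 1)) 2 := by
      rw [show 1 + (i - 1) = i by omega]; rfl
    rw [h1, List.range'_append_1, show i + 2 = 1 + (i - 1 + 2) by omega, List.range'_append_1]
    congr 1
    omega
  rw [hr]
  exact (relabel_range' (circ_mem hi hin (by omega) hU mu_mem)).symm

/-! ### The differential -/

/-- All deletions of one letter. -/
def dels {α : Type*} : List α → List (List α)
  | [] => []
  | a :: u => u :: (dels u).map (a :: ·)

theorem dels_eq {α : Type*} (u : List α) :
    dels u = (List.range u.length).map fun j => u.eraseIdx j := by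
  induction u with
  | nil => rfl
  | cons a u ih => simp [dels, ih, List.range_succ_eq_map, Function.comp_def]

/-- The sum of all deletions of one letter. -/
noncomputable def dd : Strings →ₗ[ZMod 2] Strings := lift fun u => strs (dels u)

@[simp] theorem dd_str (u : List ℕ) : dd (str u) = strs (dels u) := lift_str _ _

theorem dd_pre (a : ℕ) (U : Strings) : dd (pre a U) = U + pre a (dd U) := by
  have : dd ∘ₗ pre a = LinearMap.id + pre a ∘ₗ dd := hom_ext fun u => by
    simp [dels, strs_map_cons]
  exact LinearMap.congr_fun this U

/-- The span of the strings with equal neighbours. -/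
noncomputable def Deg : Submodule (ZMod 2) Strings :=
  Submodule.span (ZMod 2) (str '' {u | ¬ u.IsChain (· ≠ ·)})

theorem pre_mem_Deg (a : ℕ) {U : Strings} (hU : U ∈ Deg) : pre a U ∈ Deg := by
  have : Deg ≤ Deg.comap (pre a) := by
    refine Submodule.span_le.2 ?_
    rintro _ ⟨u, hu, rfl⟩
    refine Submodule.subset_span ⟨a :: u, fun h => hu ?_, (pre_str a u).symm⟩
    exact (List.isChain_cons.1 h).2
  exact this hU

theorem pre_pre_mem_Deg (a : ℕ) (U : Strings) : pre a (pre a U) ∈ Deg := by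
  induction U using Finsupp.induction_linear with
  | zero => simp
  | add U V hU hV => simpa only [map_add] using Deg.add_mem hU hV
  | single u c =>
    rw [← mul_one c, ← smul_eq_mul, ← Finsupp.smul_single, map_smul, map_smul]
    refine Deg.smul_mem _ (Submodule.subset_span ⟨a :: a :: u, by simp, ?_⟩)
    change _ = pre a (pre a (str u))
    simp

/-- The projection to the span of the nondegenerate surjections. -/
noncomputable def surjProj (n : ℕ) : Strings →ₗ[ZMod 2] Strings :=
  lift fun u => if IsSurj n u then str u else 0

theorem bdry_eq_surjProj (n : ℕ) (U : Strings) : bdry n U = surjProj n (dd U) := by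
  have h : surjProj n ∘ₗ dd = lift fun u => ∑ j ∈ Finset.range u.length,
      if IsSurj n (u.eraseIdx j) then str (u.eraseIdx j) else 0 := by
    refine hom_ext fun u => ?_
    simp only [LinearMap.comp_apply, dd_str, surjProj, lift_strs, lift_str, dels_eq,
      List.map_map, Finset.sum_range, Function.comp_def]
    rw [← Finset.sum_range (fun j => if IsSurj n (u.eraseIdx j) then str (u.eraseIdx j) else 0)]
    rfl
  rw [← LinearMap.comp_apply, h, lift_apply, bdry]
  refine Finset.sum_congr rfl fun u _ => ?_
  simp only [Finset.smul_sum, smul_ite, smul_zero]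

theorem surjProj_of_mem {n : ℕ} {U : Strings} (hU : U ∈ SJ (Finset.Icc 1 n)) :
    surjProj n U = U :=
  SJ_ext (g := LinearMap.id) (fun u hu => by simp [surjProj, isSurj_iff.2 hu]) hU

theorem surjProj_of_mem_Deg {n : ℕ} {U : Strings} (hU : U ∈ Deg) : surjProj n U = 0 := by
  have : Deg ≤ LinearMap.ker (surjProj n) := by
    refine Submodule.span_le.2 ?_
    rintro _ ⟨u, hu, rfl⟩
    have : ¬ IsSurj n u := fun h => hu h.2
    simp [surjProj, this]
  exact this hU

/-- This allows all computations to be made with the unrestricted deletion `dd`, which is a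
derivation with respect to `pre`, modulo strings with equal neighbours. -/
theorem bdry_eq_of_mem_Deg {n : ℕ} {U R : Strings} (h : dd U + R ∈ Deg)
    (hR : R ∈ SJ (Finset.Icc 1 n)) : bdry n U = R := by
  rw [bdry_eq_surjProj]
  have := surjProj_of_mem_Deg (n := n) h
  rw [map_add, surjProj_of_mem hR] at this
  exact eq_of_add_eq_zero this

/-! ### The elements `E^k_{p,q}` as sums over walks -/

/-- The continuations of an admissible string that ends in `x, y`, where `x :: X` and `y :: Y` are
the remaining letters of the two groups and the letter before the continuation has been repeated:
either the letter `x` is repeated, which uses up one of `k` changes of rows, or the next letter of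
`X` comes, followed by `y`. -/
def walks : ℕ → List ℕ → List ℕ → List (List ℕ)
  | k, x :: X, y :: Y =>
    -- For k = 0 only the current row and the last row remain. The last row consists of y alone,
    -- which has been written already.
    (if k = 0 ∧ X = [] ∧ Y = [] then [[]] else []) ++
      (match k with
        | 0 => []
        | k + 1 => (walks k (y :: Y) (x :: X)).map (x :: ·)) ++
      -- The default 0 is never used, since there are no walks for an empty X.
      (walks k X (y :: Y)).map fun w => X.headD 0 :: y :: w
  | _, [], _ => []
  | _, _ :: _, [] => []
-- A change of rows exchanges the lists, so k has to come first in the order.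
termination_by k X => (k, X.length)

@[simp] theorem walks_nil_left (k : ℕ) (Y : List ℕ) : walks k [] Y = [] := by rw [walks]

@[simp] theorem walks_nil_right (k : ℕ) (X : List ℕ) : walks k X [] = [] := by
  cases X <;> rw [walks]

theorem walks_zero (x y : ℕ) (X Y : List ℕ) : walks 0 (x :: X) (y :: Y) =
    (if X = [] ∧ Y = [] then [[]] else []) ++
      (walks 0 X (y :: Y)).map fun w => X.headD 0 :: y :: w := by
  rw [walks]; simp

theorem walks_succ (k x y : ℕ) (X Y : List ℕ) : walks (k + 1) (x :: X) (y :: Y) =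
    (walks k (y :: Y) (x :: X)).map (x :: ·) ++
      (walks (k + 1) X (y :: Y)).map fun w => X.headD 0 :: y :: w := by
  rw [walks]; simp

/-- Induction along the definition of `walks`. -/
theorem walks_induction {P : ℕ → List ℕ → List ℕ → Prop} (nil_left : ∀ k Y, P k [] Y)
    (nil_right : ∀ k x X, P k (x :: X) [])
    (zero : ∀ x X y Y, P 0 X (y :: Y) → P 0 (x :: X) (y :: Y))
    (succ : ∀ k x X y Y, P k (y :: Y) (x :: X) → P (k + 1) X (y :: Y) →
      P (k + 1) (x :: X) (y :: Y)) (k : ℕ) (X Y : List ℕ) : P k X Y := by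
  induction k generalizing X Y with
  | zero =>
    induction X with
    | nil => exact nil_left _ _
    | cons x X ih =>
      cases Y with
      | nil => exact nil_right _ _ _
      | cons y Y => exact zero _ _ _ _ ih
  | succ k ihk =>
    induction X with
    | nil => exact nil_left _ _
    | cons x X ih =>
      cases Y with
      | nil => exact nil_right _ _ _
      | cons y Y => exact succ _ _ _ _ _ (ihk _ _) ih

/-- The sum of `walks k X Y`. -/
noncomputable def F (k : ℕ) (X Y : List ℕ) : Strings := strs (walks k X Y)

@[simp] theorem F_nil_left (k : ℕ) (Y : List ℕ) : F k [] Y = 0 := by simp [F]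

@[simp] theorem F_nil_right (k : ℕ) (X : List ℕ) : F k X [] = 0 := by simp [F]

theorem strs_map_cons_cons (a b : ℕ) (l : List (List ℕ)) :
    strs (l.map fun w => a :: b :: w) = pre a (pre b (strs l)) := by
  rw [← strs_map_cons, ← strs_map_cons, List.map_map]; rfl

theorem F_zero (x y : ℕ) (X Y : List ℕ) : F 0 (x :: X) (y :: Y) =
    (if X = [] ∧ Y = [] then str [] else 0) + pre (X.headD 0) (pre y (F 0 X (y :: Y))) := by
  rw [F, walks_zero, strs_append, strs_map_cons_cons, ← F]
  split_ifs <;> simp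

theorem F_succ (k x y : ℕ) (X Y : List ℕ) : F (k + 1) (x :: X) (y :: Y) =
    pre x (F k (y :: Y) (x :: X)) + pre (X.headD 0) (pre y (F (k + 1) X (y :: Y))) := by
  rw [F, walks_succ, strs_append, strs_map_cons_cons, strs_map_cons, ← F, ← F]

theorem rename_F (ρ : ℕ → ℕ) (k : ℕ) (X Y : List ℕ) :
    rename ρ (F k X Y) = F k (X.map ρ) (Y.map ρ) := by
  induction k, X, Y using walks_induction with
  | nil_left k Y => simp
  | nil_right k x X => simp
  | zero x X y Y ih =>
    simp only [List.map_cons] at ih ⊢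
    rw [F_zero, F_zero, map_add, rename_pre, rename_pre, ih]
    congr 1
    · simp only [List.map_eq_nil_iff]
      split_ifs <;> simp
    · cases X <;> simp
  | succ k x X y Y ih1 ih2 =>
    simp only [List.map_cons] at ih1 ih2 ⊢
    rw [F_succ, F_succ, map_add, rename_pre, rename_pre, rename_pre, ih1, ih2]
    congr 1
    cases X <;> simp

/-- The heads of X and Y have been written before the walk starts, which explains the tails and the
4 in the length. A change of rows costs one letter, every other step two. A walk starts in X and the
letter before it is the head of Y, so no equal neighbours arise. -/
theorem walks_props {k : ℕ} {X Y w : List ℕ} (hw : w ∈ walks k X Y) :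
    (∀ a ∈ w, a ∈ X ∨ a ∈ Y) ∧ (∀ a ∈ X.tail, a ∈ w) ∧ (∀ a ∈ Y.tail, a ∈ w) ∧
      w.length + 4 = k + 2 * X.length + 2 * Y.length ∧ (∀ a ∈ w.head?, a ∈ X) ∧
      ((X ++ Y).Nodup → w.IsChain (· ≠ ·)) := by
  induction k, X, Y using walks_induction generalizing w with
  | nil_left k Y => simp at hw
  | nil_right k x X => simp at hw
  | zero x X y Y ih =>
    rw [walks_zero, List.mem_append] at hw
    rcases hw with hw | hw
    · split_ifs at hw with h
      · obtain ⟨rfl, rfl⟩ := h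
        obtain rfl := List.mem_singleton.1 hw
        simp
      · simp at hw
    · obtain ⟨w, hw', rfl⟩ := List.mem_map.1 hw
      cases X with
      | nil => simp at hw'
      | cons x' X =>
        obtain ⟨h1, h2, h3, h4, h5, h6⟩ := ih hw'
        refine ⟨?_, ?_, ?_, ?_, ?_, ?_⟩
        · simp only [List.headD_cons, List.mem_cons] at h1 ⊢
          rintro a (rfl | rfl | h)
          · tauto
          · tauto
          · have := h1 a h; tauto
        · simp only [List.tail_cons, List.headD_cons, List.mem_cons] at h2 ⊢
          rintro a (rfl | h)
          · tauto
          · have := h2 a h; tauto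
        · simp only [List.tail_cons, List.headD_cons, List.mem_cons] at h3 ⊢
          intro a h
          have := h3 a h; tauto
        · simp only [List.length_cons] at h4 ⊢; omega
        · simp
        · intro hn
          have hn' := hn
          simp only [List.cons_append, List.nodup_cons, List.mem_cons, List.mem_append,
            not_or] at hn
          rw [List.headD_cons, List.isChain_cons_cons, List.isChain_cons]
          refine ⟨by tauto, fun a ha hya => ?_, h6 (by rw [List.cons_append] at hn'; exact hn'.of_cons)⟩
          have := h5 a ha
          have hnd := (List.nodup_append.1 (List.Nodup.of_cons hn')).2.2 a this y (by simp)
          exact hnd hya.symm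
  | succ k x X y Y ih1 ih2 =>
    rw [walks_succ, List.mem_append] at hw
    rcases hw with hw | hw
    · obtain ⟨w, hw', rfl⟩ := List.mem_map.1 hw
      obtain ⟨h1, h2, h3, h4, h5, h6⟩ := ih1 hw'
      refine ⟨?_, ?_, ?_, ?_, ?_, ?_⟩
      · simp only [List.mem_cons] at h1 ⊢
        rintro a (rfl | h)
        · tauto
        · have := h1 a h; tauto
      · intro a h
        exact List.mem_cons_of_mem _ (h3 a h)
      · intro a h
        exact List.mem_cons_of_mem _ (h2 a h)
      · simp only [List.length_cons] at h4 ⊢; omega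
      · simp
      · intro hn
        rw [List.isChain_cons]
        refine ⟨fun a ha hxa => ?_, h6 (List.nodup_append_comm.1 hn)⟩
        exact (List.nodup_append.1 hn).2.2 x (by simp) a (h5 a ha) hxa
    · obtain ⟨w, hw', rfl⟩ := List.mem_map.1 hw
      cases X with
      | nil => simp at hw'
      | cons x' X =>
        obtain ⟨h1, h2, h3, h4, h5, h6⟩ := ih2 hw'
        refine ⟨?_, ?_, ?_, ?_, ?_, ?_⟩
        · simp only [List.headD_cons, List.mem_cons] at h1 ⊢
          rintro a (rfl | rfl | h)
          · tauto
          · tauto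
          · have := h1 a h; tauto
        · simp only [List.tail_cons, List.headD_cons, List.mem_cons] at h2 ⊢
          rintro a (rfl | h)
          · tauto
          · have := h2 a h; tauto
        · simp only [List.tail_cons, List.headD_cons, List.mem_cons] at h3 ⊢
          intro a h
          have := h3 a h; tauto
        · simp only [List.length_cons] at h4 ⊢; omega
        · simp
        · intro hn
          have hn' := hn
          simp only [List.cons_append, List.nodup_cons, List.mem_cons, List.mem_append,
            not_or] at hn
          rw [List.headD_cons, List.isChain_cons_cons, List.isChain_cons]
          refine ⟨by tauto, fun a ha hya => ?_, h6 (by rw [List.cons_append] at hn'; exact hn'.of_cons)⟩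
          have := h5 a ha
          have hnd := (List.nodup_append.1 (List.Nodup.of_cons hn')).2.2 a this y (by simp)
          exact hnd hya.symm

/-- The element `E^k` with the lists of letters `A` and `B` as its two groups of inputs. -/
noncomputable def G (k : ℕ) : List ℕ → List ℕ → Strings
  | a :: A, b :: B => pre a (pre b (pre a (F k (b :: B) (a :: A))))
  | [], _ => 0
  | _ :: _, [] => 0

@[simp] theorem G_nil_left (k : ℕ) (B : List ℕ) : G k [] B = 0 := rfl

@[simp] theorem G_nil_right (k : ℕ) (A : List ℕ) : G k A [] = 0 := by cases A <;> rfl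

theorem G_cons (k a b : ℕ) (A B : List ℕ) :
    G k (a :: A) (b :: B) = pre a (pre b (pre a (F k (b :: B) (a :: A)))) := rfl

theorem rename_G (ρ : ℕ → ℕ) (k : ℕ) (A B : List ℕ) :
    rename ρ (G k A B) = G k (A.map ρ) (B.map ρ) := by
  cases A <;> cases B <;> simp [G, rename_pre, rename_F]

theorem G_eq_strs (k a b : ℕ) (A B : List ℕ) : G k (a :: A) (b :: B) =
    strs ((walks k (b :: B) (a :: A)).map fun w => a :: b :: a :: w) := by
  rw [G_cons, F, ← strs_map_cons, ← strs_map_cons, ← strs_map_cons, List.map_map, List.map_map]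
  rfl

theorem hasLetters_walk {k a b : ℕ} {A B w : List ℕ} (hn : (a :: A ++ b :: B).Nodup)
    (hw : w ∈ walks k (b :: B) (a :: A)) :
    HasLetters (a :: A ++ b :: B).toFinset (a :: b :: a :: w) := by
  obtain ⟨h1, h2, h3, h4, h5, h6⟩ := walks_props hw
  rw [hasLetters_iff]
  constructor
  · intro x
    simp only [List.mem_cons, List.mem_toFinset, List.mem_append, List.tail_cons] at *
    have := h1 x
    have := h2 x
    have := h3 x
    tauto
  · have hab : a ≠ b := (List.nodup_append.1 hn).2.2 a (by simp) b (by simp)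
    rw [List.isChain_cons_cons, List.isChain_cons_cons, List.isChain_cons]
    refine ⟨hab, hab.symm, fun c hc hac => ?_, h6 (List.nodup_append_comm.1 hn)⟩
    exact (List.nodup_append.1 hn).2.2 a (by simp) c (h5 c hc) hac

theorem G_mem {k : ℕ} {A B : List ℕ} (hn : (A ++ B).Nodup) :
    G k A B ∈ SJ (A ++ B).toFinset := by
  cases A with
  | nil => simp
  | cons a A =>
    cases B with
    | nil => simp
    | cons b B =>
      rw [G_eq_strs]
      refine strs_mem fun w hw => ?_
      obtain ⟨w, hw', rfl⟩ := List.mem_map.1 hw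
      exact str_mem_SJ (hasLetters_walk hn hw')

/-- The two possible steps write different letters, x and its successor. Without this, strings could
cancel modulo 2 in the list sum and not in the sum over a set. -/
theorem nodup_walks {k : ℕ} {X Y : List ℕ} (hX : X.Nodup) (hY : Y.Nodup) :
    (walks k X Y).Nodup := by
  induction k, X, Y using walks_induction with
  | nil_left k Y => simp
  | nil_right k x X => simp
  | zero x X y Y ih =>
    rw [walks_zero, List.nodup_append]
    refine ⟨by split_ifs <;> simp, (ih hX.of_cons hY).map fun u v h => by simpa using h, ?_⟩
    intro a ha b hb
    split_ifs at ha
    · obtain ⟨w, _, rfl⟩ := List.mem_map.1 hb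
      simp at ha
      simp [ha]
    · simp at ha
  | succ k x X y Y ih1 ih2 =>
    rw [walks_succ, List.nodup_append]
    refine ⟨(ih1 hY hX).map fun u v h => by simpa using h,
      (ih2 hX.of_cons hY).map fun u v h => by simpa using h, ?_⟩
    intro a ha b hb
    obtain ⟨w, _, rfl⟩ := List.mem_map.1 ha
    obtain ⟨w', hw', rfl⟩ := List.mem_map.1 hb
    cases X with
    | nil => simp at hw'
    | cons x' X =>
      simp only [List.nodup_cons, List.mem_cons, not_or] at hX
      simp [hX.1.1]

/-- `w` is read off from rows `rows s i ts` that end correctly. -/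
def IsRows (k s i c d : ℕ) (w : List ℕ) : Prop :=
  ∃ ts : List ℕ, ts.length = k + 2 ∧ ts.getLast? = some 0 ∧ finals s i ts = (c, d) ∧
    w = (rows s i ts).flatten

/-- Decomposition by the number of increments in the first row. If it is zero, the row is one
letter, and either the one-term last row follows or the roles of the two sequences are exchanged.
Otherwise the first two letters are split off. -/
theorem isRows_iff {k s i c d : ℕ} {w : List ℕ} : IsRows k s i c d w ↔
    (k = 0 ∧ c = s ∧ d = i ∧ w = [s, i]) ∨
      (∃ k', k = k' + 1 ∧ ∃ w', IsRows k' i s d c w' ∧ w = s :: w') ∨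
      ∃ w', IsRows k (s + 1) i c d w' ∧ w = s :: i :: w' := by
  constructor
  · rintro ⟨ts, h1, h2, h3, rfl⟩
    obtain ⟨t, ts, rfl⟩ : ∃ t ts', ts = t :: ts' := by
      cases ts with
      | nil => simp at h1
      | cons t ts => exact ⟨t, ts, rfl⟩
    simp only [List.length_cons, Nat.add_right_cancel_iff] at h1
    have h2' : ts.getLast? = some 0 := by
      cases ts with
      | nil => simp at h1
      | cons t' ts => simpa using h2
    cases t with
    | zero =>
      cases k with
      | zero =>
        left
        obtain ⟨t', rfl⟩ := List.length_eq_one_iff.1 h1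
        obtain rfl : t' = 0 := by simpa using h2'
        simp [finals] at h3
        simp [rows, row, h3]
      | succ k =>
        refine Or.inr (Or.inl ⟨k, rfl, _, ⟨ts, h1, h2', ?_, rfl⟩, ?_⟩)
        · simp only [finals, Nat.add_zero] at h3
          rw [← Prod.swap_inj, h3]
          rfl
        · simp [rows, row]
    | succ t =>
      refine Or.inr (Or.inr ⟨_, ⟨t :: ts, by simp [h1], ?_, ?_, rfl⟩, ?_⟩)
      · cases ts with
        | nil => simp at h1
        | cons t' ts => simpa using h2'
      · rw [← h3, finals, finals]
        congr 2
        omega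
      · simp [rows, row, Nat.add_assoc, Nat.add_comm 1 t]
  · rintro (⟨rfl, rfl, rfl, rfl⟩ | ⟨k, rfl, w, ⟨ts, h1, h2, h3, rfl⟩, rfl⟩ |
      ⟨w, ⟨ts, h1, h2, h3, rfl⟩, rfl⟩)
    · exact ⟨[0, 0], by simp [finals, rows, row]⟩
    · refine ⟨0 :: ts, by simp [h1], ?_, ?_, by simp [rows, row]⟩
      · cases ts with
        | nil => simp at h1
        | cons t' ts => simpa using h2
      · simp [finals, h3]
    · obtain ⟨t, ts, rfl⟩ : ∃ t ts', ts = t :: ts' := by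
        cases ts with
        | nil => simp at h1
        | cons t ts => exact ⟨t, ts, rfl⟩
      refine ⟨(t + 1) :: ts, by simpa using h1, ?_, ?_, ?_⟩
      · cases ts with
        | nil => simp at h1
        | cons t' ts => simpa using h2
      · rw [← h3, finals, finals]
        congr 2
        omega
      · simp [rows, row, Nat.add_assoc, Nat.add_comm 1 t]

theorem IsRows.le {k s i c d : ℕ} {w : List ℕ} (h : IsRows k s i c d w) : s ≤ c ∧ i ≤ d := by
  obtain ⟨ts, _, _, h3, _⟩ := h
  have := le_finals ts s i
  rw [h3] at this
  exact ⟨this.1, this.2.1⟩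

/-- The numbers r and r' count the increments that are still to come in the two sequences. The
letters s, i are the last two written ones, so they are not part of the walk. Steps beyond the final
numbers are excluded by `IsRows.le`. -/
theorem isRows_iff_walks (k r r' s i : ℕ) (w : List ℕ) :
    IsRows k s i (s + r) (i + r') w ↔
      ∃ w' ∈ walks k (List.range' s (r + 1)) (List.range' i (r' + 1)), w = s :: i :: w' := by
  induction k generalizing r r' s i w with
  | zero =>
    induction r generalizing s w with
    | zero =>
      rw [isRows_iff]
      simp only [List.range'_succ, walks_zero]
      have h : ∀ w', ¬ IsRows 0 (s + 1) i (s + 0) (i + r') w' := fun w' h => by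
        have := h.le; omega
      simp only [Nat.add_zero] at h
      cases r' with
      | zero => simp only [Nat.add_zero] at h; simp [h]
      | succ => simp [h]
    | succ r ih =>
      have ih' := ih (s + 1)
      rw [show s + 1 + r = s + (r + 1) by omega] at ih'
      rw [isRows_iff]
      simp only [ih']
      rw [List.range'_succ (n := r + 1), List.range'_succ (s := i), walks_zero]
      simp [List.range'_succ]
  | succ k ihk =>
    induction r generalizing s w with
    | zero =>
      rw [isRows_iff]
      have h : ∀ w', ¬ IsRows (k + 1) (s + 1) i (s + 0) (i + r') w' := fun w' h => by
        have := h.le; omega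
      have h2 := ihk r' 0 i s
      simp only [Nat.add_zero] at h2 h
      simp only [h, Nat.add_zero]
      rw [List.range'_succ (s := i), List.range'_succ, walks_succ, ← List.range'_succ, 
        ← List.range'_succ]
      simp [h2]
    | succ r ih =>
      have ih' := ih (s + 1)
      rw [show s + 1 + r = s + (r + 1) by omega] at ih'
      have h2 := ihk r' (r + 1) i s
      rw [isRows_iff]
      simp only [ih']
      rw [List.range'_succ (s := i), List.range'_succ (n := r + 1), walks_succ,
        ← List.range'_succ, ← List.range'_succ]
      simp only [List.range'_succ (n := r), List.mem_append, List.mem_map, List.headD_cons]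
      constructor
      · rintro (h | ⟨k', hk, w', hw', rfl⟩ | ⟨_, ⟨w, hw, rfl⟩, rfl⟩)
        · omega
        · obtain rfl : k = k' := by omega
          obtain ⟨w, hw, rfl⟩ := (h2 _).1 hw'
          exact ⟨_, Or.inl ⟨w, hw, rfl⟩, rfl⟩
        · exact ⟨_, Or.inr ⟨w, hw, rfl⟩, rfl⟩
      · rintro ⟨_, ⟨w, hw, rfl⟩ | ⟨w, hw, rfl⟩, rfl⟩
        · exact Or.inr (Or.inl ⟨k, rfl, _, (h2 _).2 ⟨w, hw, rfl⟩, rfl⟩)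
        · exact Or.inr (Or.inr ⟨_, ⟨w, hw, rfl⟩, rfl⟩)

theorem isAdmissible_iff (k p q : ℕ) (w : List ℕ) : IsAdmissible k (p + 1) (q + 1) w ↔
    w ∈ (walks k (List.range' (p + 2) (q + 1)) (List.range' 1 (p + 1))).map
      fun w => 1 :: (p + 2) :: 1 :: w := by
  have h := isRows_iff_walks k q p (p + 2) 1
  have e : IsAdmissible k (p + 1) (q + 1) w ↔
      ∃ w', IsRows k (p + 2) 1 (p + 2 + q) (1 + p) w' ∧ w = 1 :: w' := by
    constructor
    · rintro ⟨ts, h1, h2, h3, rfl⟩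
      refine ⟨_, ⟨ts, ?_, h2, ?_, rfl⟩, rfl⟩
      · simpa [table, length_rows] using h1
      · rw [show p + 2 = p + 1 + 1 by omega, h3]
        simp only [Prod.mk.injEq]
        omega
    · rintro ⟨w', ⟨ts, h1, h2, h3, rfl⟩, rfl⟩
      refine ⟨ts, by simp [table, length_rows, h1], h2, ?_, rfl⟩
      rw [h3]
      simp only [Prod.mk.injEq]
      omega
  rw [e]
  simp only [h, List.mem_map]
  constructor
  · rintro ⟨_, ⟨w', hw, rfl⟩, rfl⟩
    exact ⟨w', hw, rfl⟩
  · rintro ⟨w', hw, rfl⟩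
    exact ⟨_, ⟨w', hw, rfl⟩, rfl⟩

theorem E_zero_left (k q : ℕ) : E k 0 q = 0 := by
  rw [E, Finset.sum_eq_zero]
  intro w hw
  rw [mem_admissible] at hw
  obtain ⟨ts, _, _, h3, _⟩ := hw
  have := (le_finals ts (0 + 1) 1).2.1
  rw [h3] at this
  simp at this

theorem E_zero_right (k p : ℕ) : E k p 0 = 0 := by
  rw [E, Finset.sum_eq_zero]
  intro w hw
  rw [mem_admissible] at hw
  obtain ⟨ts, _, _, h3, _⟩ := hw
  have := (le_finals ts (p + 1) 1).1
  rw [h3] at this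
  simp at this

/-- The sum over the set of admissible strings is the sum over the list of walks, because the list
has no repetitions. -/
theorem E_eq_G (k p q : ℕ) : E k p q = G k (List.range' 1 p) (List.range' (p + 1) q) := by
  cases p with
  | zero => simp [E_zero_left]
  | succ p =>
    cases q with
    | zero => simp [E_zero_right]
    | succ q =>
      set l := (walks k (List.range' (p + 2) (q + 1)) (List.range' 1 (p + 1))).map
        fun w => 1 :: (p + 2) :: 1 :: w with hl
      have hn : l.Nodup := by
        refine (nodup_walks List.nodup_range' List.nodup_range').map fun u v h => ?_
        simpa using h
      have : admissible k (p + 1) (q + 1) = l.toFinset := by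
        ext w
        rw [mem_admissible, isAdmissible_iff, List.mem_toFinset]
      rw [E, this, List.sum_toFinset _ hn, List.range'_succ, List.range'_succ, G_eq_strs, strs, hl]
      simp only [List.range'_succ]

/-- With default heads the recursion also covers an empty Y, where everything vanishes. This saves
case distinctions below. -/
theorem F_zero' (x : ℕ) (X Y : List ℕ) : F 0 (x :: X) Y =
    (if X = [] ∧ Y.length = 1 then str [] else 0) + pre (X.headD 0) (pre (Y.headD 0) (F 0 X Y)) := by
  cases Y with
  | nil => simp
  | cons y Y => rw [F_zero]; simp

theorem F_succ' (k x : ℕ) (X Y : List ℕ) : F (k + 1) (x :: X) Y =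
    pre x (F k Y (x :: X)) + pre (X.headD 0) (pre (Y.headD 0) (F (k + 1) X Y)) := by
  cases Y with
  | nil => simp
  | cons y Y => rw [F_succ]; simp

theorem G_eq (k : ℕ) (A B : List ℕ) :
    G k A B = pre (A.headD 0) (pre (B.headD 0) (pre (A.headD 0) (F k B A))) := by
  cases A <;> cases B <;> simp [G]

/-! ### Doublings of a letter -/

/-- The sum of `f l a b` over all neighbours `a, b` in a list, where `l` is the list with `z` in
place of `a, b`. -/
noncomputable def sumMergings (z : ℕ) : (List ℕ → ℕ → ℕ → Strings) → List ℕ → Strings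
  | f, x :: x' :: X => f (z :: X) x x' + sumMergings z (fun l => f (x :: l)) (x' :: X)
  | _, [_] => 0
  | _, [] => 0

theorem sumMergings_add (z : ℕ) (f g : List ℕ → ℕ → ℕ → Strings) (X : List ℕ) :
    sumMergings z (fun l a b => f l a b + g l a b) X = sumMergings z f X + sumMergings z g X := by
  induction X generalizing f g with
  | nil => simp [sumMergings]
  | cons x X ih =>
    cases X with
    | nil => simp [sumMergings]
    | cons x' X => simp only [sumMergings, ih]; abel

theorem sumMergings_map (L : Strings →ₗ[ZMod 2] Strings) (z : ℕ) (f : List ℕ → ℕ → ℕ → Strings)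
    (X : List ℕ) : sumMergings z (fun l a b => L (f l a b)) X = L (sumMergings z f X) := by
  induction X generalizing f with
  | nil => simp [sumMergings]
  | cons x X ih =>
    cases X with
    | nil => simp [sumMergings]
    | cons x' X => simp only [sumMergings, ih (fun l => f (x :: l)), map_add]

theorem sumMergings_zero (z : ℕ) (X : List ℕ) :
    sumMergings z (fun _ _ _ => (0 : Strings)) X = 0 :=
  sumMergings_map 0 z (fun _ _ _ => 0) X

/-- The sum of the terms in which one letter `z` of a string is doubled to `a, b`. Earlier
letters `z` become `a` and later ones `b`. -/
noncomputable def dbl (z a b : ℕ) : Strings →ₗ[ZMod 2] Strings := (plug z).flip (str [a, b])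

theorem plugL_singleton (z c : ℕ) (u : List ℕ) :
    plugL z u [c] = [u.map fun a => if a = z then c else a] := by
  induction u with
  | nil => rfl
  | cons a u ih =>
    rw [plugL]
    split_ifs with h <;> simp [plugSlot, ih, h]

theorem dbl_str_nil (z a b : ℕ) : dbl z a b (str []) = 0 := by simp [dbl, plugL]

theorem dbl_pre_of_ne {z c : ℕ} (h : c ≠ z) (a b : ℕ) (U : Strings) :
    dbl z a b (pre c U) = pre c (dbl z a b U) := by
  have : dbl z a b ∘ₗ pre c = pre c ∘ₗ dbl z a b := hom_ext fun u => by
    simp [dbl, plugL, h, strs_map_cons]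
  exact LinearMap.congr_fun this U

/-- Either the doubled occurrence comes later, and this z becomes a, or it is this one, and all
later z become b. -/
theorem dbl_pre_self (z a b : ℕ) (U : Strings) : dbl z a b (pre z U) =
    pre a (dbl z a b U) + pre a (pre b (rename (fun c => if c = z then b else c) U)) := by
  have : dbl z a b ∘ₗ pre z =
      pre a ∘ₗ dbl z a b + pre a ∘ₗ pre b ∘ₗ rename (fun c => if c = z then b else c) :=
    hom_ext fun u => by
      simp [dbl, plugL, plugSlot, plugL_singleton, ← strs_map_cons]
  exact LinearMap.congr_fun this U

theorem dbl_F_of_notMem {z : ℕ} {X Y : List ℕ} (hX : z ∉ X) (hY : z ∉ Y) (a b k : ℕ) :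
    dbl z a b (F k X Y) = 0 := by
  rw [F, dbl, LinearMap.flip_apply, plug, lift_strs]
  have : ∀ w ∈ walks k X Y, (lift fun v => strs (plugL z w v)) = (0 : Strings →ₗ[ZMod 2] Strings)
      ∨ (lift fun v => strs (plugL z w v)) (str [a, b]) = 0 := by
    intro w hw
    right
    have hz : z ∉ w := fun h => ((walks_props hw).1 z h).elim hX hY
    rw [lift_str, plugL_eq_of_notMem hz]
    rfl
  generalize walks k X Y = l at this
  induction l with
  | nil => rfl
  | cons w l ih =>
    rw [List.map_cons, List.sum_cons, LinearMap.add_apply, ih fun w hw => this w (by simp [hw]),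
      add_zero]
    rcases this w (by simp) with h | h
    · rw [h]; rfl
    · exact h

theorem rename_F_fresh {z b k : ℕ} {X Y : List ℕ} (hX : z ∉ X) (hY : z ∉ Y) :
    rename (fun c => if c = z then b else c) (F k X (z :: Y)) = F k X (b :: Y) ∧
      rename (fun c => if c = z then b else c) (F k (z :: X) Y) = F k (b :: X) Y := by
  have h : ∀ l : List ℕ, z ∉ l → l.map (fun c => if c = z then b else c) = l := by
    intro l hl
    conv_rhs => rw [← List.map_id l]
    refine List.map_congr_left fun x hx => ?_
    rw [if_neg fun e : x = z => hl (e ▸ hx)]; rfl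
  simp [rename_F, h X hX, h Y hY]

/-- The sum of all doublings in the first group of letters. -/
noncomputable def dblFst (z k : ℕ) (X Y : List ℕ) : Strings :=
  sumMergings z (fun l a b => dbl z a b (F k l Y)) X

/-- The sum of all doublings in the second group of letters. -/
noncomputable def dblSnd (z k : ℕ) (X Y : List ℕ) : Strings :=
  sumMergings z (fun l a b => dbl z a b (F k X l)) Y

/-- The extra term arises when the first two letters of X are merged and the leading z itself is
doubled. All other doublings take place behind the two letters in front. -/
theorem sumMergings_head {z y k : ℕ} {X Y : List ℕ} (hX : z ∉ X) (hY : z ∉ y :: Y) :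
    sumMergings z (fun l a b => dbl z a b (pre (l.headD 0) (pre y (F k l (y :: Y))))) X =
      pre (X.headD 0) (pre y (dblFst z k X (y :: Y))) +
        pre (X.headD 0) (pre (X.tail.headD 0) (pre y (F k X.tail (y :: Y)))) := by
  have hy : y ≠ z := by simp at hY; tauto
  match X with
  | [] => simp [sumMergings, dblFst]
  | [x'] => simp [sumMergings, dblFst]
  | x' :: x'' :: X =>
    simp only [List.mem_cons, not_or] at hX
    have hx' : x' ≠ z := Ne.symm hX.1
    have hr := (rename_F_fresh (b := x'') (k := k) hX.2.2 hY).2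
    simp only [sumMergings, dblFst, List.headD_cons, List.tail_cons, dbl_pre_self, hr,
      dbl_pre_of_ne hx', dbl_pre_of_ne hy, rename_pre, if_neg hy, map_add, sumMergings_map]
    abel

/-- Two boundary terms are added to the recursion of `F_succ`. In the first, x is merged with its
successor and the repeated letter is doubled at once. In the second, the next two letters are merged
and doubled when they are first written. -/
theorem dblFst_cons {z k x y : ℕ} {X Y : List ℕ} (hX : z ∉ x :: X) (hY : z ∉ y :: Y) :
    dblFst z (k + 1) (x :: X) (y :: Y) =
      pre x (dblSnd z k (y :: Y) (x :: X)) + pre x (pre (X.headD 0) (F k (y :: Y) X)) +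
      pre (X.headD 0) (pre y (dblFst z (k + 1) X (y :: Y))) +
      pre (X.headD 0) (pre (X.tail.headD 0) (pre y (F (k + 1) X.tail (y :: Y)))) := by
  have hy : y ≠ z := by simp at hY; tauto
  have hx : x ≠ z := by simp at hX; tauto
  cases X with
  | nil => simp [dblFst, dblSnd, sumMergings]
  | cons x' X =>
    simp only [List.mem_cons, not_or] at hX
    have hX' : z ∉ x' :: X := by simp; tauto
    have h1 : dblFst z (k + 1) (x :: x' :: X) (y :: Y) =
        dbl z x x' (F (k + 1) (z :: X) (y :: Y)) +
          (pre x (sumMergings z (fun l a b => dbl z a b (F k (y :: Y) (x :: l))) (x' :: X)) +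
          sumMergings z (fun l a b => dbl z a b
            (pre (l.headD 0) (pre y (F (k + 1) l (y :: Y))))) (x' :: X)) := by
      simp only [dblFst, sumMergings, F_succ, map_add, dbl_pre_of_ne hx, sumMergings_add,
        sumMergings_map]
    have h2 : dbl z x x' (F (k + 1) (z :: X) (y :: Y)) =
        pre x (dbl z x x' (F k (y :: Y) (z :: X))) + pre x (pre x' (F k (y :: Y) (x' :: X))) := by
      rw [F_succ, map_add, dbl_pre_self, (rename_F_fresh hY hX.2.2).1]
      have : dbl z x x' (pre (X.headD 0) (pre y (F (k + 1) X (y :: Y)))) = 0 := by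
        cases X with
        | nil => simp
        | cons x'' X =>
          have : x'' ≠ z := by simp at hX; tauto
          rw [List.headD_cons, dbl_pre_of_ne this, dbl_pre_of_ne hy,
            dbl_F_of_notMem hX.2.2 hY]
          simp
      rw [this, add_zero]
    rw [h1, h2, sumMergings_head hX' hY]
    simp only [dblSnd, sumMergings, map_add, List.headD_cons]
    abel

/-- The boundary term comes from the stable letter y: merged with its successor, it can be doubled
directly behind the next letter of X. -/
theorem dblSnd_cons {z k x y : ℕ} {X Y : List ℕ} (hX : z ∉ x :: X) (hY : z ∉ y :: Y) :
    dblSnd z (k + 1) (x :: X) (y :: Y) =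
      pre x (dblFst z k (y :: Y) (x :: X)) +
      pre (X.headD 0) (pre y (dblSnd z (k + 1) X (y :: Y))) +
      pre (X.headD 0) (pre y (pre (Y.headD 0) (F (k + 1) X Y))) := by
  have hy : y ≠ z := by simp at hY; tauto
  have hx : x ≠ z := by simp at hX; tauto
  have hX' : z ∉ X := by simp at hX; tauto
  have hY' : z ∉ Y := by simp at hY; tauto
  cases Y with
  | nil => simp [dblFst, dblSnd, sumMergings]
  | cons y' Y =>
    have hY'' : z ∉ Y := by simp at hY; tauto
    cases X with
    | nil =>
      simp only [dblFst, dblSnd, sumMergings, F_succ, map_add, dbl_pre_of_ne hx,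
        sumMergings_map, F_nil_left, map_zero, add_zero]
      simp [sumMergings_zero]
    | cons x' X =>
      have hx' : x' ≠ z := by simp at hX; tauto
      simp only [dblFst, dblSnd, sumMergings, F_succ k x, map_add, dbl_pre_of_ne hx, sumMergings_add,
        sumMergings_map, List.headD_cons, dbl_pre_of_ne hx', dbl_pre_of_ne hy, dbl_pre_self,
        (rename_F_fresh hX' hY'').1]
      abel

theorem dblFst_cons_zero {z x y : ℕ} {X Y : List ℕ} (hX : z ∉ x :: X) (hY : z ∉ y :: Y) :
    dblFst z 0 (x :: X) (y :: Y) =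
      pre (X.headD 0) (pre y (dblFst z 0 X (y :: Y))) +
      pre (X.headD 0) (pre (X.tail.headD 0) (pre y (F 0 X.tail (y :: Y)))) := by
  have hy : y ≠ z := by simp at hY; tauto
  have hx : x ≠ z := by simp at hX; tauto
  have hnil : ∀ (c : Prop) [Decidable c] (a b : ℕ),
      dbl z a b (if c then str [] else 0) = 0 := by
    intro c _ a b
    split_ifs <;> simp [dbl_str_nil]
  cases X with
  | nil => simp [dblFst, sumMergings]
  | cons x' X =>
    simp only [List.mem_cons, not_or] at hX
    have hX' : z ∉ x' :: X := by simp; tauto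
    have h1 : dblFst z 0 (x :: x' :: X) (y :: Y) =
        dbl z x x' (F 0 (z :: X) (y :: Y)) +
          sumMergings z (fun l a b => dbl z a b
            (pre (l.headD 0) (pre y (F 0 l (y :: Y))))) (x' :: X) := by
      simp only [dblFst, sumMergings, F_zero, map_add, hnil, zero_add]
    have h2 : dbl z x x' (F 0 (z :: X) (y :: Y)) = 0 := by
      rw [F_zero, map_add, hnil, zero_add]
      cases X with
      | nil => simp
      | cons x'' X =>
        have : x'' ≠ z := by simp at hX; tauto
        rw [List.headD_cons, dbl_pre_of_ne this, dbl_pre_of_ne hy, dbl_F_of_notMem hX.2.2 hY]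
        simp
    rw [h1, h2, sumMergings_head hX' hY, zero_add]

theorem dblSnd_cons_zero {z x y : ℕ} {X Y : List ℕ} (hX : z ∉ x :: X) (hY : z ∉ y :: Y) :
    dblSnd z 0 (x :: X) (y :: Y) =
      pre (X.headD 0) (pre y (dblSnd z 0 X (y :: Y))) +
      pre (X.headD 0) (pre y (pre (Y.headD 0) (F 0 X Y))) := by
  have hy : y ≠ z := by simp at hY; tauto
  have hX' : z ∉ X := by simp at hX; tauto
  have hnil : ∀ (c : Prop) [Decidable c] (a b : ℕ),
      dbl z a b (if c then str [] else 0) = 0 := by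
    intro c _ a b
    split_ifs <;> simp [dbl_str_nil]
  cases Y with
  | nil => simp [dblSnd, sumMergings]
  | cons y' Y =>
    have hY'' : z ∉ Y := by simp at hY; tauto
    cases X with
    | nil =>
      simp only [dblSnd, sumMergings, F_zero, map_add, hnil, F_nil_left, map_zero, add_zero]
      simp [sumMergings_zero]
    | cons x' X =>
      have hx' : x' ≠ z := by simp at hX; tauto
      simp only [dblSnd, sumMergings, F_zero _ _ (x' :: X), map_add, hnil, zero_add,
        sumMergings_map, List.headD_cons, dbl_pre_of_ne hx', dbl_pre_of_ne hy, dbl_pre_self,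
        (rename_F_fresh hX' hY'').1]
      abel

/-! ### Products -/

/-- The sum of the products of walks with `i` and `j` changes of rows. -/
noncomputable def prodWalks (i j : ℕ) (X Y : List ℕ) : Strings :=
  ∑ p ∈ Finset.range X.length, ∑ q ∈ Finset.range Y.length,
    cat (F i (X.take (p + 1)) (Y.take (q + 1)))
      (if Even i then G j (Y.drop (q + 1)) (X.drop (p + 1))
        else G j (X.drop (p + 1)) (Y.drop (q + 1)))

/-- The summands with p = 0 vanish, and the shift by one makes the others the products that belong
to X. -/
theorem prodWalks_tail (i j y : ℕ) (X Y : List ℕ) :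
    ∑ p ∈ Finset.range (X.length + 1), ∑ q ∈ Finset.range (Y.length + 1),
      cat (pre ((X.take p).headD 0) (pre y (F i (X.take p) (y :: Y.take q))))
        (if Even i then G j (Y.drop q) (X.drop p) else G j (X.drop p) (Y.drop q)) =
      pre (X.headD 0) (pre y (prodWalks i j X (y :: Y))) := by
  rw [Finset.sum_range_succ']
  simp only [prodWalks, map_sum, List.take_zero, F_nil_left, map_zero, LinearMap.zero_apply,
    Finset.sum_const_zero, add_zero, List.length_cons, List.take_succ_cons, List.drop_succ_cons]
  refine Finset.sum_congr rfl fun p hp => Finset.sum_congr rfl fun q _ => ?_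
  cases X with
  | nil => simp at hp
  | cons x X => simp

/-- The term `G` is the product with the empty walk as first factor, which requires both groups to
be cut directly behind their first letters. -/
theorem prodWalks_zero (j x y : ℕ) (X Y : List ℕ) : prodWalks 0 j (x :: X) (y :: Y) =
    G j Y X + pre (X.headD 0) (pre y (prodWalks 0 j X (y :: Y))) := by
  rw [← prodWalks_tail, prodWalks]
  simp only [List.length_cons, List.take_succ_cons, List.drop_succ_cons, F_zero, map_add,
    LinearMap.add_apply, Finset.sum_add_distrib]
  congr 1
  rw [Finset.sum_eq_single 0, Finset.sum_eq_single 0]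
  · simp
  · intro q hq hq0
    rw [if_neg, map_zero, LinearMap.zero_apply]
    rw [Finset.mem_range] at hq
    simp only [List.take_eq_nil_iff]
    rintro ⟨_, h | rfl⟩
    · exact hq0 h
    · simp at hq; exact hq0 hq
  · simp
  · intro p hp hp0
    refine Finset.sum_eq_zero fun q _ => ?_
    rw [if_neg, map_zero, LinearMap.zero_apply]
    rw [Finset.mem_range] at hp
    simp only [List.take_eq_nil_iff]
    rintro ⟨h | rfl, _⟩
    · exact hp0 h
    · simp at hp; exact hp0 hp
  · simp

/-- A change of rows exchanges the two groups and the parity of i simultaneously, so the order of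
the groups in the second factor is preserved. -/
theorem prodWalks_succ (i j x y : ℕ) (X Y : List ℕ) : prodWalks (i + 1) j (x :: X) (y :: Y) =
    pre x (prodWalks i j (y :: Y) (x :: X)) +
      pre (X.headD 0) (pre y (prodWalks (i + 1) j X (y :: Y))) := by
  rw [← prodWalks_tail, prodWalks, prodWalks]
  simp only [List.length_cons, List.take_succ_cons, List.drop_succ_cons, F_succ, map_add,
    LinearMap.add_apply, Finset.sum_add_distrib, map_sum, cat_pre]
  congr 1
  rw [Finset.sum_comm]
  refine Finset.sum_congr rfl fun p _ => Finset.sum_congr rfl fun q _ => ?_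
  simp only [Nat.even_add_one, ite_not]

/-- The sum of the products of walks with `k` changes of rows in all. -/
noncomputable def prods (k : ℕ) (X Y : List ℕ) : Strings :=
  ∑ i ∈ Finset.range (k + 1), prodWalks i (k - i) X Y

theorem prods_zero (x y : ℕ) (X Y : List ℕ) : prods 0 (x :: X) (y :: Y) =
    G 0 Y X + pre (X.headD 0) (pre y (prods 0 X (y :: Y))) := by
  simp [prods, prodWalks_zero]

theorem prods_succ (k x y : ℕ) (X Y : List ℕ) : prods (k + 1) (x :: X) (y :: Y) =
    G (k + 1) Y X + pre x (prods k (y :: Y) (x :: X)) +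
      pre (X.headD 0) (pre y (prods (k + 1) X (y :: Y))) := by
  simp only [prods]
  rw [Finset.sum_range_succ', Finset.sum_range_succ' _ (k + 1)]
  simp only [prodWalks_succ, prodWalks_zero, Nat.add_sub_add_right, Finset.sum_add_distrib,
    map_add, map_sum, Nat.sub_zero]
  abel

theorem prods_nil_left (k : ℕ) (Y : List ℕ) : prods k [] Y = 0 := by simp [prods, prodWalks]

theorem prods_nil_right (k : ℕ) (X : List ℕ) : prods k X [] = 0 := by simp [prods, prodWalks]

/-! ### Multiplication by the last letters -/

/-- Put the letter `c` at the end. -/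
noncomputable def app (c : ℕ) : Strings →ₗ[ZMod 2] Strings := lift fun u => str (u ++ [c])

theorem app_str (c : ℕ) (u : List ℕ) : app c (str u) = str (u ++ [c]) := lift_str _ _

theorem app_pre (c a : ℕ) (U : Strings) : app c (pre a U) = pre a (app c U) := by
  have : app c ∘ₗ pre a = pre a ∘ₗ app c := hom_ext fun u => by simp [app]
  exact LinearMap.congr_fun this U

/-- The walks without the last letter of one of the groups, followed by this letter. -/
noncomputable def ends (k : ℕ) (X Y : List ℕ) : Strings :=
  app (X.getLastD 0) (F k X.dropLast Y) + app (Y.getLastD 0) (F k X Y.dropLast)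

/-- The heads differ only for a list of one letter, and then `F` vanishes. -/
theorem pre_headD_dropLast (k y : ℕ) (X Y : List ℕ) :
    pre (X.dropLast.headD 0) (pre y (F k X.dropLast Y)) =
      pre (X.headD 0) (pre y (F k X.dropLast Y)) := by
  match X with
  | [] => rfl
  | [x] => simp
  | x :: x' :: X => simp

theorem ends_succ (k x y : ℕ) (X Y : List ℕ) : ends (k + 1) (x :: X) (y :: Y) =
    pre x (ends k (y :: Y) (x :: X)) + pre (X.headD 0) (pre y (ends (k + 1) X (y :: Y))) := by
  have h1 : app ((x :: X).getLastD 0) (F (k + 1) (x :: X).dropLast (y :: Y)) =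
      pre x (app ((x :: X).getLastD 0) (F k (y :: Y) (x :: X).dropLast)) +
        pre (X.headD 0) (pre y (app (X.getLastD 0) (F (k + 1) X.dropLast (y :: Y)))) := by
    cases X with
    | nil => simp
    | cons x' X =>
      rw [List.dropLast_cons_of_ne_nil (by simp), F_succ, map_add, app_pre, pre_headD_dropLast,
        app_pre, app_pre]
      simp
  have h2 : app ((y :: Y).getLastD 0) (F (k + 1) (x :: X) (y :: Y).dropLast) =
      pre x (app ((y :: Y).getLastD 0) (F k (y :: Y).dropLast (x :: X))) +
        pre (X.headD 0) (pre y (app ((y :: Y).getLastD 0) (F (k + 1) X (y :: Y).dropLast))) := by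
    cases Y with
    | nil => simp
    | cons y' Y =>
      rw [List.dropLast_cons_of_ne_nil (by simp), F_succ, map_add, app_pre, app_pre, app_pre]
  rw [ends, ends, ends, h1, h2]
  simp only [map_add]
  abel

/-- The boundary terms are the cases in which the empty walk remains after the last letter of one
group is removed. -/
theorem ends_zero (x y : ℕ) (X Y : List ℕ) : ends 0 (x :: X) (y :: Y) =
    pre (X.headD 0) (if X.length = 1 ∧ Y = [] then str [] else 0) +
    pre (Y.headD 0) (if X = [] ∧ Y.length = 1 then str [] else 0) +
      pre (X.headD 0) (pre y (ends 0 X (y :: Y))) := by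
  have h1 : app ((x :: X).getLastD 0) (F 0 (x :: X).dropLast (y :: Y)) =
      pre (X.headD 0) (if X.length = 1 ∧ Y = [] then str [] else 0) +
        pre (X.headD 0) (pre y (app (X.getLastD 0) (F 0 X.dropLast (y :: Y)))) := by
    match X with
    | [] => simp
    | [x'] => cases Y <;> simp [F_zero, app_str]
    | x' :: x'' :: X =>
      rw [List.dropLast_cons_of_ne_nil (by simp), F_zero, map_add, pre_headD_dropLast,
        app_pre, app_pre]
      simp
  have h2 : app ((y :: Y).getLastD 0) (F 0 (x :: X) (y :: Y).dropLast) =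
      pre (Y.headD 0) (if X = [] ∧ Y.length = 1 then str [] else 0) +
        pre (X.headD 0) (pre y (app ((y :: Y).getLastD 0) (F 0 X (y :: Y).dropLast))) := by
    match Y with
    | [] => simp
    | [y'] => cases X <;> simp [F_zero, app_str, app_pre]
    | y' :: y'' :: Y =>
      rw [List.dropLast_cons_of_ne_nil (by simp), F_zero, map_add, app_pre, app_pre]
      simp
  rw [ends, ends, h1, h2]
  simp only [map_add]
  abel

/-! ### The main identity -/

/-- Walks with one change of rows less. -/
noncomputable def Fpred : ℕ → List ℕ → List ℕ → Strings
  | 0, _, _ => 0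
  | k + 1, X, Y => F k X Y

/-- The sum of all terms of the main identity for walks. -/
noncomputable def total (z k : ℕ) (X Y : List ℕ) : Strings :=
  let x := X.headD 0
  let y := Y.headD 0
  pre x (pre y (dblFst z k X Y)) + pre x (pre y (dblSnd z k X Y)) + pre x (pre y (prods k X Y)) +
    pre x (dd (pre y (F k X Y))) + pre x (pre y (pre (Y.tail.headD 0) (F k X Y.tail))) +
    pre x (pre (X.tail.headD 0) (pre y (F k X.tail Y))) + pre x (pre y (Fpred k X Y)) +
    pre x (pre y (ends k X Y)) +
    pre x (if k = 0 ∧ X.length = 1 ∧ Y.length = 1 then str [] else 0)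

theorem two_zsmul_eq_zero (U : Strings) : (2 : ℤ) • U = 0 := by
  rw [two_zsmul]; exact add_self_eq_zero U

/-- The sum `total` belongs to a string whose last two letters before the walk are x, y. Two of its
terms are the doublings of these two letters, and the deletion of x is left out. Expand every term
by its recursion: repeating x gives `total` for the exchanged groups behind x, and going on gives
`total` for the tail of X behind x, y. What is left over are strings that start with x, x or with x,
y, y. -/
theorem total_mem_Deg {z : ℕ} (k : ℕ) (X Y : List ℕ) (hX : z ∉ X) (hY : z ∉ Y) :
    total z k X Y ∈ Deg := by
  induction k, X, Y using walks_induction with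
  | nil_left k Y =>
    have : Fpred k [] Y = 0 := by cases k <;> simp [Fpred]
    simp [total, dblFst, dblSnd, sumMergings, prods_nil_left, ends, this, sumMergings_zero]
  | nil_right k x X =>
    have : Fpred k (x :: X) [] = 0 := by cases k <;> simp [Fpred]
    simp [total, dblFst, dblSnd, sumMergings, prods_nil_right, ends, this, sumMergings_zero]
  | zero x X y Y ih =>
    have hX' : z ∉ X := by simp at hX; tauto
    have h2 := pre_mem_Deg x (pre_mem_Deg y (ih hX' hY))
    have h3 := pre_mem_Deg x (pre_pre_mem_Deg y (F 0 X (y :: Y)))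
    -- The difference of the two sides expands into terms that all occur twice.
    convert Deg.add_mem h2 h3 using 1
    refine eq_of_add_eq_zero ?_
    simp only [total, List.headD_cons, List.tail_cons, dblFst_cons_zero hX hY,
      dblSnd_cons_zero hX hY, prods_zero, F_zero' x, ends_zero, Fpred, dd_pre, map_add, G_eq,
      List.length_cons, Nat.add_eq_right, List.length_eq_zero_iff, true_and, map_zero]
    have hd : ∀ (c : Prop) [Decidable c], dd (if c then str [] else 0) = 0 := by
      intro c _
      split_ifs <;> simp [dels]
    simp only [hd, map_zero]
    abel_nf
    simp [two_zsmul_eq_zero]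
  | succ k x X y Y ih1 ih2 =>
    have hX' : z ∉ X := by simp at hX; tauto
    have h1 := pre_mem_Deg x (ih1 hY hX)
    have h2 := pre_mem_Deg x (pre_mem_Deg y (ih2 hX' hY))
    have h3 := pre_mem_Deg x (pre_pre_mem_Deg y (F (k + 1) X (y :: Y)))
    have h4 := pre_pre_mem_Deg x (F k (y :: Y) (x :: X))
    -- As for k = 0, with a further state and a further degenerate remainder from the repetition of
    -- x.
    convert Deg.add_mem (Deg.add_mem h1 h2) (Deg.add_mem h3 h4) using 1
    refine eq_of_add_eq_zero ?_
    have hF : F k (x :: X) (y :: Y) = (if k = 0 ∧ X = [] ∧ Y = [] then str [] else 0) +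
        pre x (Fpred k (y :: Y) (x :: X)) + pre (X.headD 0) (pre y (F k X (y :: Y))) := by
      cases k with
      | zero => simp [F_zero, Fpred]
      | succ k => simp [F_succ, Fpred]
    simp only [total, List.headD_cons, List.tail_cons, dblFst_cons hX hY,
      dblSnd_cons hX hY, prods_succ, F_succ', ends_succ, Fpred, hF, dd_pre, map_add, G_eq,
      List.length_cons, Nat.add_eq_right, List.length_eq_zero_iff, map_zero, Nat.succ_ne_zero,
      false_and, if_false, and_comm (a := Y = [])]
    abel_nf
    simp [two_zsmul_eq_zero]

/-- `G` with one change of rows less. -/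
noncomputable def Gpred : ℕ → List ℕ → List ℕ → Strings
  | 0, _, _ => 0
  | k + 1, A, B => G k A B

/-- The three terms correspond to the place of the doubling: behind the initial a, b, a, at its
second a, or at its first a. The last one cancels the multiplication by the first input. -/
theorem dblSnd_G {z k : ℕ} {A B : List ℕ} (hA : z ∉ A) (hB : z ∉ B) :
    sumMergings z (fun l a b => dbl z a b (G k l B)) A =
      pre (A.headD 0) (pre (B.headD 0) (pre (A.headD 0) (dblSnd z k B A))) +
      pre (A.headD 0) (pre (B.headD 0) (pre (A.headD 0) (pre (A.tail.headD 0) (F k B A.tail)))) +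
      pre (A.headD 0) (G k A.tail B) := by
  match A, B with
  | _, [] => simp [dblSnd, sumMergings_zero]
  | [], _ => simp [dblSnd, sumMergings]
  | [a], _ => simp [dblSnd, sumMergings]
  | a :: a' :: A, b :: B =>
    have hb : b ≠ z := by simp at hB; tauto
    have ha : a ≠ z := by simp at hA; tauto
    have hA' : z ∉ A := by simp at hA; tauto
    simp only [sumMergings, G_cons, dblSnd, List.headD_cons, List.tail_cons, dbl_pre_self,
      dbl_pre_of_ne ha, dbl_pre_of_ne hb, sumMergings_map, map_add, rename_pre, if_neg hb,
      (rename_F_fresh hB hA').1, if_true]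
    abel

theorem dblFst_G {z k : ℕ} {A B : List ℕ} (hA : z ∉ A) (hB : z ∉ B) :
    sumMergings z (fun l a b => dbl z a b (G k A l)) B =
      pre (A.headD 0) (pre (B.headD 0) (pre (A.headD 0) (dblFst z k B A))) +
      pre (A.headD 0) (pre (B.headD 0) (pre (B.tail.headD 0) (pre (A.headD 0) (F k B.tail A)))) := by
  match A, B with
  | [], _ => simp [dblFst, sumMergings_zero]
  | _ :: _, [] => simp [dblFst, sumMergings]
  | _ :: _, [b] => simp [dblFst, sumMergings]
  | a :: A, b :: b' :: B =>
    have hb : b ≠ z := by simp at hB; tauto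
    have ha : a ≠ z := by simp at hA; tauto
    have hB' : z ∉ B := by simp at hB; tauto
    simp only [sumMergings, G_cons, dblFst, List.headD_cons, List.tail_cons, dbl_pre_self,
      dbl_pre_of_ne ha, dbl_pre_of_ne hb, sumMergings_map, map_add, rename_pre, if_neg ha,
      (rename_F_fresh hB' hA).2]
    abel

theorem app_G (k c : ℕ) (A B : List ℕ) : app c (G k A B) =
    pre (A.headD 0) (pre (B.headD 0) (pre (A.headD 0) (app c (F k B A)))) := by
  rw [G_eq, app_pre, app_pre, app_pre]

theorem ends_G (k : ℕ) (A B : List ℕ) :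
    app (A.getLastD 0) (G k A.dropLast B) + app (B.getLastD 0) (G k A B.dropLast) =
      pre (A.headD 0) (pre (B.headD 0) (pre (A.headD 0) (ends k B A))) := by
  have hA : app (A.getLastD 0) (G k A.dropLast B) =
      pre (A.headD 0) (pre (B.headD 0) (pre (A.headD 0)
        (app (A.getLastD 0) (F k B A.dropLast)))) := by
    match A with
    | [] => simp
    | [_] => simp
    | _ :: _ :: _ => rw [app_G]; simp
  have hB : app (B.getLastD 0) (G k A B.dropLast) =
      pre (A.headD 0) (pre (B.headD 0) (pre (A.headD 0)
        (app (B.getLastD 0) (F k B.dropLast A)))) := by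
    match B with
    | [] => simp
    | [_] => simp
    | _ :: _ :: _ => rw [app_G]; simp
  rw [hA, hB, ends]
  simp only [map_add]
  abel

theorem prods_G (k : ℕ) (A B : List ℕ) :
    ∑ i ∈ Finset.range (k + 1), ∑ p ∈ Finset.range A.length, ∑ q ∈ Finset.range B.length,
      cat (G i (A.take (p + 1)) (B.take (q + 1)))
        (if Even i then G (k - i) (A.drop (p + 1)) (B.drop (q + 1))
          else G (k - i) (B.drop (q + 1)) (A.drop (p + 1))) =
      pre (A.headD 0) (pre (B.headD 0) (pre (A.headD 0) (prods k B A))) := by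
  simp only [prods, prodWalks, map_sum]
  refine Finset.sum_congr rfl fun i _ => ?_
  rw [Finset.sum_comm]
  refine Finset.sum_congr rfl fun q hq => Finset.sum_congr rfl fun p hp => ?_
  cases A with
  | nil => simp at hp
  | cons a A =>
    cases B with
    | nil => simp at hq
    | cons b B => simp [G_cons]

/-- The left side is what remains of a, b, a, … when the first a is deleted. If the next step
repeats b, this is a string with the groups exchanged and one change of rows less; otherwise it is b
followed by a string for the tail of B. The excluded case contains the empty walk, which leaves the
additional string b, a. -/
theorem pre_pre_F {k : ℕ} {A B : List ℕ} (h : ¬ (k = 0 ∧ A.length = 1 ∧ B.length = 1)) :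
    pre (B.headD 0) (pre (A.headD 0) (F k B A)) =
      Gpred k B A + pre (B.headD 0) (G k A B.tail) := by
  match A, B with
  | _, [] => cases k <;> simp [Gpred]
  | [], _ => cases k <;> simp [Gpred]
  | a :: A, b :: B =>
    cases k with
    | zero =>
      simp only [List.length_cons, Nat.add_eq_right, List.length_eq_zero_iff, true_and] at h
      rw [F_zero, if_neg (by tauto)]
      simp [Gpred, G_eq]
    | succ k =>
      rw [F_succ]
      simp [Gpred, G_eq]

/-- The defining identity of an extended homotopy G-algebra for the operations `G`, up to strings
with equal neighbours. -/
theorem ehga_G {z k : ℕ} {A B : List ℕ} (hA : z ∉ A) (hB : z ∉ B)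
    (h : ¬ (k = 0 ∧ A.length = 1 ∧ B.length = 1)) :
    dd (G k A B) +
      (sumMergings z (fun l a b => dbl z a b (G k l B)) A +
      sumMergings z (fun l a b => dbl z a b (G k A l)) B +
      pre (A.headD 0) (G k A.tail B) +
      app (A.getLastD 0) (G k A.dropLast B) +
      pre (B.headD 0) (G k A B.tail) +
      app (B.getLastD 0) (G k A B.dropLast) +
      ∑ i ∈ Finset.range (k + 1), ∑ p ∈ Finset.range A.length, ∑ q ∈ Finset.range B.length,
        cat (G i (A.take (p + 1)) (B.take (q + 1)))
          (if Even i then G (k - i) (A.drop (p + 1)) (B.drop (q + 1))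
            else G (k - i) (B.drop (q + 1)) (A.drop (p + 1))) +
      (Gpred k A B + Gpred k B A)) ∈ Deg := by
  -- In a, b, a, … the state of the walk is b, a, preceded by a. The second degenerate element below
  -- is the deletion of b.
  have h1 := pre_mem_Deg (A.headD 0) (total_mem_Deg k B A hB hA)
  have h2 := pre_pre_mem_Deg (A.headD 0) (F k B A)
  convert Deg.add_mem h1 h2 using 1
  refine eq_of_add_eq_zero ?_
  rw [prods_G, dblSnd_G hA hB, dblFst_G hA hB]
  have hF := pre_pre_F h
  have hG : Gpred k A B =
      pre (A.headD 0) (pre (B.headD 0) (pre (A.headD 0) (Fpred k B A))) := by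
    cases k with
    | zero => simp [Gpred, Fpred]
    | succ k => rw [Gpred, Fpred, G_eq]
  have hd : dd (G k A B) = pre (B.headD 0) (pre (A.headD 0) (F k B A)) +
      pre (A.headD 0) (pre (A.headD 0) (F k B A)) +
      pre (A.headD 0) (pre (B.headD 0) (dd (pre (A.headD 0) (F k B A)))) := by
    rw [G_eq, dd_pre, dd_pre]
    simp only [map_add]
    abel
  have he := ends_G k A B
  have hk : ¬ (k = 0 ∧ B.length = 1 ∧ A.length = 1) := by tauto
  simp only [total, map_add, if_neg hk, map_zero] at he ⊢
  rw [hd, hF, hG, ← he]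
  abel_nf
  simp [two_zsmul_eq_zero]

/-! ### Renumbering -/

theorem E_mem (k p q : ℕ) : E k p q ∈ SJ (Finset.Icc 1 (p + q)) := by
  rw [E_eq_G]
  have hr : List.range' 1 p ++ List.range' (p + 1) q = List.range' 1 (p + q) := by
    rw [Nat.add_comm p 1, List.range'_append_1]
  have := G_mem (k := k) (A := List.range' 1 p) (B := List.range' (p + 1) q)
    (by rw [hr]; exact List.nodup_range')
  rw [hr] at this
  convert this using 2
  ext x
  simp
  omega

theorem relabel_E (k : ℕ) (A B : List ℕ) :
    relabel (E k A.length B.length) (A ++ B) = G k A B := by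
  rw [E_eq_G, relabel_eq_rename, rename_G]
  congr 1
  · refine List.ext_getElem (by simp) fun i h1 h2 => ?_
    simp [List.getD_eq_getElem?_getD, List.getElem?_append_left h2, h2]
  · refine List.ext_getElem (by simp) fun i h1 h2 => ?_
    simp [List.getD_eq_getElem?_getD, h2]

theorem sumMergings_range' (z : ℕ) (f : List ℕ → ℕ → ℕ → Strings) (s n : ℕ) :
    sumMergings z f (List.range' s n) = ∑ i ∈ Finset.Ico s (s + n - 1),
      f (List.range' s (i - s) ++ z :: List.range' (i + 2) (s + n - 2 - i)) i (i + 1) := by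
  induction n generalizing s f with
  | zero =>
    rw [Finset.Ico_eq_empty (by omega)]; simp [sumMergings]
  | succ n ih =>
    cases n with
    | zero => simp [sumMergings]
    | succ n =>
      have h := ih (fun l => f (s :: l)) (s + 1)
      rw [List.range'_succ] at h
      have hb : Finset.Ico s (s + (n + 1 + 1) - 1) =
          insert s (Finset.Ico (s + 1) (s + 1 + (n + 1) - 1)) := by
        ext; simp; omega
      rw [List.range'_succ, List.range'_succ, sumMergings, h, hb, Finset.sum_insert (by simp)]
      congr 1
      · simp only [Nat.sub_self, List.range'_zero, List.nil_append]
        rw [show s + (n + 1 + 1) - 2 - s = n by omega]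
      · refine Finset.sum_congr rfl fun i hi => ?_
        rw [Finset.mem_Ico] at hi
        rw [show i - s = (i - (s + 1)) + 1 by omega, List.range'_succ, List.cons_append,
          show s + 1 + (n + 1) - 2 - i = s + (n + 1 + 1) - 2 - i by omega]

theorem prodOp_mem {U V : Strings} {l l' : List ℕ} (hU : U ∈ SJ (Finset.Icc 1 l.length))
    (hV : V ∈ SJ (Finset.Icc 1 l'.length)) (hl : l ≠ []) (hl' : l' ≠ []) (hn : (l ++ l').Nodup) :
    prodOp U l V l' ∈ SJ (l ++ l').toFinset := by
  rw [List.nodup_append] at hn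
  rw [prodOp_eq_cat hU hV hl hl' hn.1 hn.2.1, List.toFinset_append]
  refine cat_mem (relabel_mem hn.1 hU) (relabel_mem hn.2.1 hV) ?_
  rw [Finset.disjoint_left]
  intro x hx hx'
  simp only [List.mem_toFinset] at hx hx'
  exact hn.2.2 x hx x hx' rfl

theorem prodOp_E_E {k k' : ℕ} {A B A' B' : List ℕ} (hl : A ++ B ≠ []) (hl' : A' ++ B' ≠ [])
    (hn : ((A ++ B) ++ (A' ++ B')).Nodup) :
    prodOp (E k A.length B.length) (A ++ B) (E k' A'.length B'.length) (A' ++ B') =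
      cat (G k A B) (G k' A' B') ∧
    prodOp (E k A.length B.length) (A ++ B) (E k' A'.length B'.length) (A' ++ B') ∈
      SJ ((A ++ B) ++ (A' ++ B')).toFinset := by
  have h1 : E k A.length B.length ∈ SJ (Finset.Icc 1 (A ++ B).length) := by
    rw [List.length_append]; exact E_mem _ _ _
  have h2 : E k' A'.length B'.length ∈ SJ (Finset.Icc 1 (A' ++ B').length) := by
    rw [List.length_append]; exact E_mem _ _ _
  have hn' := List.nodup_append.1 hn
  refine ⟨?_, prodOp_mem h1 h2 hl hl' hn⟩
  rw [prodOp_eq_cat h1 h2 hl hl' hn'.1 hn'.2.1, relabel_E, relabel_E]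

theorem prodOp_id_E {k a : ℕ} {A B : List ℕ} (hl : A ++ B ≠ []) (hn : ([a] ++ (A ++ B)).Nodup) :
    prodOp idOp [a] (E k A.length B.length) (A ++ B) = pre a (G k A B) ∧
    prodOp idOp [a] (E k A.length B.length) (A ++ B) ∈ SJ ([a] ++ (A ++ B)).toFinset := by
  have h2 : E k A.length B.length ∈ SJ (Finset.Icc 1 (A ++ B).length) := by
    rw [List.length_append]; exact E_mem _ _ _
  have h1 : idOp ∈ SJ (Finset.Icc 1 [a].length) := by
    rw [List.length_singleton]; exact idOp_mem
  refine ⟨?_, prodOp_mem h1 h2 (by simp) hl hn⟩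
  rw [prodOp_eq_cat h1 h2 (by simp) hl (by simp) (List.nodup_append.1 hn).2.1, relabel_idOp, relabel_E,
    ← pre_str, cat_pre, cat_nil]

theorem cat_str_singleton (U : Strings) (c : ℕ) : cat U (str [c]) = app c U := by
  have : cat.flip (str [c]) = app c := hom_ext fun u => by simp [app]
  exact LinearMap.congr_fun this U

theorem prodOp_E_id {k a : ℕ} {A B : List ℕ} (hl : A ++ B ≠ []) (hn : ((A ++ B) ++ [a]).Nodup) :
    prodOp (E k A.length B.length) (A ++ B) idOp [a] = app a (G k A B) ∧
    prodOp (E k A.length B.length) (A ++ B) idOp [a] ∈ SJ ((A ++ B) ++ [a]).toFinset := by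
  have h2 : E k A.length B.length ∈ SJ (Finset.Icc 1 (A ++ B).length) := by
    rw [List.length_append]; exact E_mem _ _ _
  have h1 : idOp ∈ SJ (Finset.Icc 1 [a].length) := by
    rw [List.length_singleton]; exact idOp_mem
  refine ⟨?_, prodOp_mem h2 h1 hl (by simp) hn⟩
  rw [prodOp_eq_cat h2 h1 hl (by simp) (List.nodup_append.1 hn).1 (by simp), relabel_idOp,
    relabel_E, cat_str_singleton]

/-- `E` with one change of rows less. -/
noncomputable def Epred : ℕ → ℕ → ℕ → Strings
  | 0, _, _ => 0
  | k + 1, p, q => E k p q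

/-- The composite has the letters 1, …, m + n, so m + n + 1 can serve as the merged letter in
`sumMergings`. -/
theorem circ_E_fst {k m n i : ℕ} (hi : 1 ≤ i) (him : i < m) :
    circ i 2 (E k (m - 1) n) mu =
      dbl (m + n + 1) i (i + 1)
        (G k (List.range' 1 (i - 1) ++ (m + n + 1) :: List.range' (i + 2) (1 + m - 2 - i))
          (List.range' (m + 1) n)) := by
  rw [circ_mu_eq_plug (z := m + n + 1) (E_mem k (m - 1) n) hi (by omega) (by omega), dbl,
    LinearMap.flip_apply]
  congr 2
  have h := relabel_E k
    (List.range' 1 (i - 1) ++ (m + n + 1) :: List.range' (i + 2) (1 + m - 2 - i))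
    (List.range' (m + 1) n)
  rw [← h]
  congr 1
  · congr 1
    · simp; omega
    · simp
  · rw [List.append_assoc, List.cons_append]
    congr 2
    rw [show m + 1 = i + 2 + (1 + m - 2 - i) by omega, List.range'_append_1]
    congr 1
    omega

theorem circ_E_snd {k m n i : ℕ} (hi : m + 1 ≤ i) (him : i < m + n) :
    circ i 2 (E k m (n - 1)) mu =
      dbl (m + n + 1) i (i + 1)
        (G k (List.range' 1 m) (List.range' (m + 1) (i - (m + 1)) ++
          (m + n + 1) :: List.range' (i + 2) (m + 1 + n - 2 - i))) := by
  rw [circ_mu_eq_plug (z := m + n + 1) (E_mem k m (n - 1)) (by omega) (by omega) (by omega), dbl,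
    LinearMap.flip_apply]
  congr 2
  have h := relabel_E k (List.range' 1 m) (List.range' (m + 1) (i - (m + 1)) ++
    (m + n + 1) :: List.range' (i + 2) (m + 1 + n - 2 - i))
  rw [← h]
  congr 1
  · congr 1
    · simp
    · simp; omega
  · rw [← List.append_assoc]
    congr 1
    · rw [show m + 1 = 1 + m by omega, List.range'_append_1]
      congr 1
      omega
    · congr 2
      omega

theorem take_range'_one {s n k : ℕ} (h : k ≤ n) :
    (List.range' s n).take k = List.range' s k := List.take_range'_of_length_ge h

theorem drop_range'_one (s n k : ℕ) : (List.range' s n).drop k = List.range' (s + k) (n - k) := by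
  rw [List.drop_range', Nat.mul_one]

/-- In `ehga_G` the first factor may take a whole group. Such products vanish because their second
factor has an empty group, and this is the condition f m = 0. -/
theorem sum_range_eq_Ico {M : Type*} [AddCommMonoid M] (f : ℕ → M) {m : ℕ} (hm : 1 ≤ m)
    (h : f m = 0) : ∑ p ∈ Finset.range m, f (p + 1) = ∑ p ∈ Finset.Ico 1 m, f p := by
  obtain ⟨m, rfl⟩ : ∃ m', m = m' + 1 := ⟨m - 1, by omega⟩
  rw [Finset.sum_range_succ, h, add_zero, Finset.sum_Ico_eq_sum_range]
  simp [Nat.add_comm]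

/-- The products in the defining identity of an extended homotopy G-algebra. -/
noncomputable def ehgaProd (i k m n p q : ℕ) : Strings :=
  if Even i then
    prodOp (E i p q) (List.range' 1 p ++ List.range' (m + 1) q)
      (E (k - i) (m - p) (n - q))
      (List.range' (p + 1) (m - p) ++ List.range' (m + (q + 1)) (n - q))
  else
    prodOp (E i p q) (List.range' 1 p ++ List.range' (m + 1) q)
      (E (k - i) (n - q) (m - p))
      (List.range' (m + (q + 1)) (n - q) ++ List.range' (p + 1) (m - p))

theorem nodup_four {m n p q : ℕ} (hp : p ≤ m) : ((List.range' 1 p ++ List.range' (m + 1) q) ++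
    (List.range' (p + 1) (m - p) ++ List.range' (m + (q + 1)) (n - q))).Nodup := by
  simp only [List.nodup_append, List.mem_append, List.mem_range'_1]
  refine ⟨⟨List.nodup_range', List.nodup_range', ?_⟩, ⟨List.nodup_range', List.nodup_range', ?_⟩, ?_⟩
  all_goals
    intros
    omega

theorem toFinset_four {m n p q : ℕ} (hp : p ≤ m) (hq : q ≤ n) :
    ((List.range' 1 p ++ List.range' (m + 1) q) ++
    (List.range' (p + 1) (m - p) ++ List.range' (m + (q + 1)) (n - q))).toFinset =
      Finset.Icc 1 (m + n) := by
  ext x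
  simp only [List.mem_toFinset, List.mem_append, List.mem_range'_1, Finset.mem_Icc]
  omega

theorem ehgaProd_eq {i k m n p q : ℕ} (hp : 1 ≤ p) (hpm : p < m) (hqn : q < n) :
    ehgaProd i k m n p q = cat (G i ((List.range' 1 m).take p) ((List.range' (m + 1) n).take q))
        (if Even i then G (k - i) ((List.range' 1 m).drop p) ((List.range' (m + 1) n).drop q)
          else G (k - i) ((List.range' (m + 1) n).drop q) ((List.range' 1 m).drop p)) ∧
    ehgaProd i k m n p q ∈ SJ (Finset.Icc 1 (m + n)) := by
  rw [take_range'_one hpm.le, take_range'_one hqn.le, drop_range'_one, drop_range'_one, ehgaProd,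
    ← toFinset_four hpm.le hqn.le]
  have h1 : List.range' 1 p ++ List.range' (m + 1) q ≠ [] := by simp; omega
  have h2 : List.range' (p + 1) (m - p) ++ List.range' (m + (q + 1)) (n - q) ≠ [] := by
    simp; omega
  have h3 := nodup_four (m := m) (n := n) (p := p) (q := q) hpm.le
  rw [show 1 + p = p + 1 by omega, show m + 1 + q = m + (q + 1) by omega]
  split_ifs with hi
  · have := prodOp_E_E (k := i) (k' := k - i) h1 h2 h3
    simpa only [List.length_range'] using this
  · have hperm : ((List.range' 1 p ++ List.range' (m + 1) q) ++
        (List.range' (p + 1) (m - p) ++ List.range' (m + (q + 1)) (n - q))).Perm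
        ((List.range' 1 p ++ List.range' (m + 1) q) ++
        (List.range' (m + (q + 1)) (n - q) ++ List.range' (p + 1) (m - p))) :=
      List.perm_append_comm.append_left _
    have := prodOp_E_E (k := i) (k' := k - i) h1
      (A' := List.range' (m + (q + 1)) (n - q)) (B' := List.range' (p + 1) (m - p))
      (by simp; omega) (hperm.nodup_iff.1 h3)
    rw [List.toFinset_eq_of_perm _ _ hperm]
    simpa only [List.length_range'] using this

/-- The defining identity of an extended homotopy G-algebra. It holds for `k = 0` as well, except
when `m = n = 1`. -/
theorem ehgaLeft_E {k m n : ℕ} (hm : 1 ≤ m) (hn : 1 ≤ n) (h : ¬ (k = 0 ∧ m = 1 ∧ n = 1)) :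
    ehgaLeft E k m n =
      Epred k m n + relabel (Epred k n m) (List.range' (m + 1) n ++ List.range' 1 m) := by
  set z := m + n + 1 with hz
  have hA : z ∉ List.range' 1 m := by simp; omega
  have hB : z ∉ List.range' (m + 1) n := by simp; omega
  have key := ehga_G (k := k) hA hB (by simpa using h)
  have hAh : (List.range' 1 m).headD 0 = 1 := by
    obtain ⟨m, rfl⟩ : ∃ m', m = m' + 1 := ⟨m - 1, by omega⟩
    rfl
  have hBh : (List.range' (m + 1) n).headD 0 = m + 1 := by
    obtain ⟨n, rfl⟩ : ∃ n', n = n' + 1 := ⟨n - 1, by omega⟩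
    rfl
  have hdl : ∀ s r, 1 ≤ r → (List.range' s r).dropLast = List.range' s (r - 1) ∧
      (List.range' s r).getLastD 0 = s + r - 1 := by
    intro s r hr
    obtain ⟨r, rfl⟩ : ∃ r', r = r' + 1 := ⟨r - 1, by omega⟩
    rw [List.range'_1_concat]
    simp
  have t1 : sumMergings z (fun l a b => dbl z a b (G k l (List.range' (m + 1) n)))
      (List.range' 1 m) = ∑ i ∈ Finset.Ico 1 m, circ i 2 (E k (m - 1) n) mu := by
    rw [sumMergings_range', Nat.add_sub_cancel_left]
    refine Finset.sum_congr rfl fun i hi => ?_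
    rw [Finset.mem_Ico] at hi
    exact (circ_E_fst hi.1 hi.2).symm
  have t2 : sumMergings z (fun l a b => dbl z a b (G k (List.range' 1 m) l))
      (List.range' (m + 1) n) = ∑ j ∈ Finset.Ico 1 n, circ (m + j) 2 (E k m (n - 1)) mu := by
    rw [sumMergings_range', Finset.sum_Ico_add (fun i => circ i 2 (E k m (n - 1)) mu)]
    refine Finset.sum_congr (by congr 1 <;> omega) fun i hi => ?_
    rw [Finset.mem_Ico] at hi
    exact (circ_E_snd (by omega) (by omega)).symm
  have t3 := prodOp_id_E (k := k) (a := 1) (A := List.range' 2 (m - 1))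
    (B := List.range' (m + 1) n) (by simp; omega) (by
      simp only [List.nodup_append, List.mem_append, List.mem_range'_1, List.mem_singleton]
      refine ⟨by simp, ⟨List.nodup_range', List.nodup_range', ?_⟩, ?_⟩ <;> (intros; omega))
  have t4 := prodOp_E_id (k := k) (a := m) (A := List.range' 1 (m - 1))
    (B := List.range' (m + 1) n) (by simp; omega) (by
      simp only [List.nodup_append, List.mem_append, List.mem_range'_1, List.mem_singleton]
      refine ⟨⟨List.nodup_range', List.nodup_range', ?_⟩, by simp, ?_⟩ <;> (intros; omega))
  have t5 := prodOp_id_E (k := k) (a := m + 1) (A := List.range' 1 m)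
    (B := List.range' (m + 2) (n - 1)) (by simp; omega) (by
      simp only [List.nodup_append, List.mem_append, List.mem_range'_1, List.mem_singleton]
      refine ⟨by simp, ⟨List.nodup_range', List.nodup_range', ?_⟩, ?_⟩ <;> (intros; omega))
  have t6 := prodOp_E_id (k := k) (a := m + n) (A := List.range' 1 m)
    (B := List.range' (m + 1) (n - 1)) (by simp; omega) (by
      simp only [List.nodup_append, List.mem_append, List.mem_range'_1, List.mem_singleton]
      refine ⟨⟨List.nodup_range', List.nodup_range', ?_⟩, by simp, ?_⟩ <;> (intros; omega))
  simp only [List.length_range'] at t3 t4 t5 t6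
  have t7 : ∑ i ∈ Finset.range (k + 1), ∑ p ∈ Finset.range (List.range' 1 m).length,
      ∑ q ∈ Finset.range (List.range' (m + 1) n).length,
        cat (G i ((List.range' 1 m).take (p + 1)) ((List.range' (m + 1) n).take (q + 1)))
          (if Even i then
            G (k - i) ((List.range' 1 m).drop (p + 1)) ((List.range' (m + 1) n).drop (q + 1))
          else G (k - i) ((List.range' (m + 1) n).drop (q + 1)) ((List.range' 1 m).drop (p + 1))) =
      ∑ i ∈ Finset.range (k + 1), ∑ p ∈ Finset.Ico 1 m, ∑ q ∈ Finset.Ico 1 n,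
        ehgaProd i k m n p q := by
    refine Finset.sum_congr rfl fun i _ => ?_
    rw [List.length_range', List.length_range', sum_range_eq_Ico (fun p => ∑ q ∈ Finset.range n,
      cat (G i ((List.range' 1 m).take p) ((List.range' (m + 1) n).take (q + 1)))
          (if Even i then
            G (k - i) ((List.range' 1 m).drop p) ((List.range' (m + 1) n).drop (q + 1))
          else G (k - i) ((List.range' (m + 1) n).drop (q + 1)) ((List.range' 1 m).drop p))) hm]
    · refine Finset.sum_congr rfl fun p hp => ?_
      rw [Finset.mem_Ico] at hp
      rw [sum_range_eq_Ico (fun q =>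
      cat (G i ((List.range' 1 m).take p) ((List.range' (m + 1) n).take q))
          (if Even i then
            G (k - i) ((List.range' 1 m).drop p) ((List.range' (m + 1) n).drop q)
          else G (k - i) ((List.range' (m + 1) n).drop q) ((List.range' 1 m).drop p))) hn]
      · refine Finset.sum_congr rfl fun q hq => ?_
        rw [Finset.mem_Ico] at hq
        exact (ehgaProd_eq hp.1 hp.2 hq.2).1.symm
      · simp
    · simp
  have t8 : Gpred k (List.range' 1 m) (List.range' (m + 1) n) = Epred k m n := by
    cases k with
    | zero => rfl
    | succ k => rw [Gpred, Epred, E_eq_G]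
  have t9 : Gpred k (List.range' (m + 1) n) (List.range' 1 m) =
      relabel (Epred k n m) (List.range' (m + 1) n ++ List.range' 1 m) := by
    cases k with
    | zero => simp [Gpred, Epred, relabel_eq_rename]
    | succ k =>
      have := relabel_E k (List.range' (m + 1) n) (List.range' 1 m)
      simp only [List.length_range'] at this
      rw [Gpred, Epred, this]
  rw [t1, t2, t7, t8, t9, hAh, hBh, (hdl _ _ hm).1, (hdl _ _ hm).2, (hdl _ _ hn).1, (hdl _ _ hn).2,
    List.tail_range', List.tail_range', show 1 + m - 1 = m by omega,
    show m + 1 + n - 1 = m + n by omega, show (1 + 1 : ℕ) = 2 from rfl,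
    show m + 1 + 1 = m + 2 by omega, ← t3.1, ← t4.1, ← t5.1, ← t6.1, ← E_eq_G] at key
  have e3 : ∀ l : List ℕ, (∀ x, x ∈ l ↔ 1 ≤ x ∧ x ≤ m + n) → l.toFinset = Finset.Icc 1 (m + n) := by
    intro l hl
    ext x
    simp [hl]
  rw [e3 _ (by simp; omega)] at t3 t4 t5 t6
  -- It remains to see that all other terms consist of nondegenerate surjections, so that the
  -- projection in `bdry` leaves them unchanged.
  have hR := bdry_eq_of_mem_Deg (n := m + n) key ?_
  · rw [ehgaLeft]
    simp only [ehgaProd] at hR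
    simp only [hR]
    simp only [List.range'_one]
    abel_nf
    simp [two_zsmul_eq_zero]
  · refine Submodule.add_mem _ (Submodule.add_mem _ (Submodule.add_mem _ (Submodule.add_mem _
      (Submodule.add_mem _ (Submodule.add_mem _ (Submodule.add_mem _ ?_ ?_) t3.2) t4.2) t5.2) t6.2)
      ?_) ?_
    · refine Submodule.sum_mem _ fun i hi => ?_
      rw [Finset.mem_Ico] at hi
      have := circ_mem (i := i) hi.1 (by omega) (by omega) (E_mem k (m - 1) n) mu_mem
      rwa [show m - 1 + n + 2 - 1 = m + n by omega] at this
    · refine Submodule.sum_mem _ fun i hi => ?_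
      rw [Finset.mem_Ico] at hi
      have := circ_mem (i := m + i) (by omega) (by omega) (by omega) (E_mem k m (n - 1)) mu_mem
      rwa [show m + (n - 1) + 2 - 1 = m + n by omega] at this
    · refine Submodule.sum_mem _ fun i _ => Submodule.sum_mem _ fun p hp =>
        Submodule.sum_mem _ fun q hq => ?_
      rw [Finset.mem_Ico] at hp hq
      exact (ehgaProd_eq hp.1 hp.2 hq.2).2
    · rw [← t8, ← t9]
      refine Submodule.add_mem _ ?_ ?_
      · cases k with
        | zero => exact Submodule.zero_mem _
        | succ k =>
          rw [Gpred, ← E_eq_G]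
          exact E_mem _ _ _
      · cases k with
        | zero => exact Submodule.zero_mem _
        | succ k =>
          rw [Gpred, ← e3 (List.range' (m + 1) n ++ List.range' 1 m) (by simp; omega)]
          refine G_mem ?_
          simp only [List.nodup_append, List.mem_range'_1]
          exact ⟨List.nodup_range', List.nodup_range', by intros; omega⟩

/-! ### The operations of a homotopy G-algebra -/

theorem E_mem_chi {k p q : ℕ} (hp : 1 ≤ p) (hq : 1 ≤ q) : E k p q ∈ chi (p + q) (k + p + q - 1) := by
  obtain ⟨p, rfl⟩ : ∃ p', p = p' + 1 := ⟨p - 1, by omega⟩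
  obtain ⟨q, rfl⟩ : ∃ q', q = q' + 1 := ⟨q - 1, by omega⟩
  have hn : (List.range' 1 (p + 1) ++ List.range' (p + 1 + 1) (q + 1)).Nodup := by
    simp only [List.nodup_append, List.mem_range'_1]
    exact ⟨List.nodup_range', List.nodup_range', by intros; omega⟩
  have hs : (List.range' 1 (p + 1) ++ List.range' (p + 1 + 1) (q + 1)).toFinset =
      Finset.Icc 1 (p + 1 + (q + 1)) := by
    ext x
    simp only [List.mem_toFinset, List.mem_append, List.mem_range'_1, Finset.mem_Icc]
    omega
  rw [E_eq_G]
  simp only [List.range'_succ (n := p), List.range'_succ (n := q)] at hn hs ⊢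
  rw [G_eq_strs]
  refine strs_mem fun w hw => ?_
  obtain ⟨w, hw', rfl⟩ := List.mem_map.1 hw
  refine Submodule.subset_span ⟨_, ⟨isSurj_iff.2 ?_, ?_⟩, rfl⟩
  · rw [← hs]; exact hasLetters_walk hn hw'
  · have := (walks_props hw').2.2.2.1
    simp only [List.length_cons, List.length_range'] at this ⊢
    omega

/-- The string `a, c₁, a, c₂, a, …, a`. -/
def brace (a : ℕ) (cs : List ℕ) : List ℕ := a :: cs.flatMap fun c => [c, a]

theorem brace_cons (a c : ℕ) (cs : List ℕ) : brace a (c :: cs) = a :: c :: brace a cs := rfl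

/-- Without a change of rows the second group never advances, so it must consist of one letter. -/
theorem F_zero_of_length {X Y : List ℕ} (hY : Y.length ≠ 1) : F 0 X Y = 0 := by
  induction X with
  | nil => simp
  | cons x X ih => rw [F_zero', ih, if_neg (by tauto)]; simp

theorem F_zero_singleton (x a : ℕ) (X : List ℕ) :
    F 0 (x :: X) [a] = str (X.flatMap fun c => [c, a]) := by
  induction X generalizing x with
  | nil => simp [F_zero]
  | cons x' X ih => rw [F_zero, ih]; simp

theorem E_zero_one (q : ℕ) (hq : 1 ≤ q) : E 0 1 q = str (braceStr q) := by
  obtain ⟨q, rfl⟩ : ∃ q', q = q' + 1 := ⟨q - 1, by omega⟩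
  rw [E_eq_G, List.range'_one, List.range'_succ, G_cons, F_zero_singleton]
  simp only [pre_str, braceStr, List.range_succ_eq_map, List.flatMap_cons, List.flatMap_map,
    List.range'_eq_map_range]
  simp [Nat.add_comm]

theorem E_zero_of_one_lt {p q : ℕ} (hp : 1 < p) : E 0 p q = 0 := by
  rw [E_eq_G, G_eq, F_zero_of_length (by simp; omega)]
  simp

/-- The operations of a homotopy G-algebra in the surjection operad. -/
noncomputable def braceOp (q : ℕ) : Strings := if q = 0 then idOp else E 0 1 q

theorem braceOp_eq (q : ℕ) : braceOp q = str (braceStr q) := by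
  rw [braceOp]
  split_ifs with h
  · subst h; rfl
  · exact E_zero_one q (by omega)

theorem braceOp_mem (q : ℕ) : braceOp q ∈ SJ (Finset.Icc 1 (1 + q)) := by
  rw [braceOp]
  split_ifs with h
  · subst h; exact idOp_mem
  · exact E_mem 0 1 q

theorem prodOp_zero_left (l l' : List ℕ) (V : Strings) : prodOp 0 l V l' = 0 := by
  simp [prodOp, subst, compAll, circ_eq_circB, relabel_eq_rename]

theorem prodOp_zero_right (l l' : List ℕ) (U : Strings) : prodOp U l 0 l' = 0 := by
  simp [prodOp, subst, compAll, circ_eq_circB, relabel_eq_rename]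

/-- For q ≥ 2 this is the identity for k = 0 and m = 1. For q = 1 that identity is not available:
its terms contain E_{1,0}, which counts as zero there but is the operad unit here. -/
theorem braceOp_diff (q : ℕ) (hq : 1 ≤ q) : bdry (1 + q) (braceOp q) =
    prodOp idOp [2] (braceOp (q - 1)) (1 :: List.range' 3 (q - 1)) +
    ∑ j ∈ Finset.Ico 1 q, circ (1 + j) 2 (braceOp (q - 1)) mu +
    prodOp (braceOp (q - 1)) (List.range' 1 q) idOp [q + 1] := by
  rcases Nat.eq_or_lt_of_le hq with rfl | hq1
  · have h1 : idOp ∈ SJ (Finset.Icc 1 [1].length) := idOp_mem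
    have h2 : idOp ∈ SJ (Finset.Icc 1 [2].length) := idOp_mem
    have e1 : prodOp idOp [2] idOp [1] = str [2, 1] := by
      rw [prodOp_eq_cat h2 h1 (by simp) (by simp) (by simp) (by simp), relabel_idOp, relabel_idOp,
        cat_str]
      rfl
    have e2 : prodOp idOp [1] idOp [2] = str [1, 2] := by
      rw [prodOp_eq_cat h1 h2 (by simp) (by simp) (by simp) (by simp), relabel_idOp, relabel_idOp,
        cat_str]
      rfl
    have e3 : braceOp 1 = str [1, 2, 1] := braceOp_eq 1
    have e4 : braceOp 0 = idOp := rfl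
    simp only [Nat.sub_self, e4, e3, List.range'_zero, Finset.Ico_self, Finset.sum_empty, add_zero,
      List.range'_one, Nat.reduceAdd, e1, e2]
    refine bdry_eq_of_mem_Deg ?_ ?_
    · have : str [1, 1] ∈ Deg := Submodule.subset_span ⟨[1, 1], by simp, rfl⟩
      convert this using 1
      refine eq_of_add_eq_zero ?_
      simp only [dd_str, dels, List.map_cons, List.map_nil, strs_cons, strs_nil]
      abel_nf
      simp [two_zsmul_eq_zero]
    · refine Submodule.add_mem _ (str_mem_SJ ?_) (str_mem_SJ ?_) <;>
        exact isSurj_iff.1 (by decide)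
  · have h := ehgaLeft_E (k := 0) (m := 1) (n := q) le_rfl hq (by omega)
    have hq0 : q ≠ 0 := by omega
    have hq1' : q - 1 ≠ 0 := by omega
    simp only [ehgaLeft, Epred, Nat.sub_self, E_zero_left, prodOp_zero_right, prodOp_zero_left,
      Finset.Ico_self, Finset.sum_empty, Finset.sum_const_zero, add_zero, relabel_eq_rename,
      map_zero, List.range'_one, List.singleton_append, Nat.reduceAdd] at h
    rw [braceOp, braceOp, if_neg hq0, if_neg hq1']
    have e : List.range' 1 q = 1 :: List.range' 2 (q - 1) := by
      obtain ⟨q, rfl⟩ : ∃ q', q = q' + 1 := ⟨q - 1, by omega⟩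
      simp [List.range'_succ]
    rw [e, Nat.add_comm q 1]
    refine eq_of_add_eq_zero ?_
    rw [← h]
    abel

/-- The identity for k = 0 and m = 2, in which all terms with E^0_{2,*} vanish and only the merging
of a₁, a₂ and the products survive. -/
theorem braceOp_hirsch (q : ℕ) (hq : 1 ≤ q) :
    prodOp idOp [1] (braceOp q) (2 :: List.range' 3 q) + circ 1 2 (braceOp q) mu +
        prodOp (braceOp q) (1 :: List.range' 3 q) idOp [2] =
      ∑ p ∈ Finset.Ico 1 q,
        prodOp (braceOp p) (1 :: List.range' 3 p)
          (braceOp (q - p)) (2 :: List.range' (3 + p) (q - p)) := by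
  have h := ehgaLeft_E (k := 0) (m := 2) (n := q) (by omega) hq (by omega)
  have hq0 : q ≠ 0 := by omega
  have hb : bdry (2 + q) (0 : Strings) = 0 := by rw [bdry_eq_surjProj]; simp
  have hc : ∀ i, circ i 2 (0 : Strings) mu = 0 := fun i => by rw [circ_eq_circB]; simp
  simp only [ehgaLeft, Epred, E_zero_of_one_lt (show 1 < 2 by omega), prodOp_zero_right,
    prodOp_zero_left, hb, hc, Finset.sum_const_zero, add_zero, zero_add, relabel_eq_rename,
    map_zero, List.range'_one, List.singleton_append, Nat.reduceAdd, Nat.Ico_succ_singleton,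
    Finset.sum_singleton, Finset.range_one, Nat.reduceSub, Nat.sub_self, Even.zero,
    if_true] at h
  have hs : ∑ p ∈ Finset.Ico 1 q, prodOp (braceOp p) (1 :: List.range' 3 p)
          (braceOp (q - p)) (2 :: List.range' (3 + p) (q - p)) =
      ∑ p ∈ Finset.Ico 1 q, prodOp (E 0 1 p) (1 :: List.range' 3 p)
          (E 0 1 (q - p)) (2 :: List.range' (2 + (p + 1)) (q - p)) := by
    refine Finset.sum_congr rfl fun p hp => ?_
    rw [Finset.mem_Ico] at hp
    rw [braceOp, if_neg (by omega), braceOp, if_neg (by omega),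
      show 3 + p = 2 + (p + 1) by omega]
  rw [hs, braceOp, if_neg hq0]
  refine eq_of_add_eq_zero ?_
  rw [← h]
  abel

/-! ### Composition of braces -/

theorem plugL_single {z : ℕ} {u v w : List ℕ} (hu : z ∉ u) (hv : z ∉ v) (hw : w ≠ []) :
    plugL z (u ++ z :: v) w = [u ++ w ++ v] := by
  induction u with
  | nil => simpa using plugL_slot_of_notMem hv hw
  | cons a u ih =>
    simp only [List.mem_cons, not_or] at hu
    rw [List.cons_append, plugL, if_neg (Ne.symm hu.1), ih hu.2]
    simp

/-- The string `a, w₁, a, w₂, a, …, a`. -/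
def braceWords (a : ℕ) (ws : List (List ℕ)) : List ℕ := a :: ws.flatMap fun w => w ++ [a]

/-- The prefix u contains the slots that are still unfilled, since the later ones are filled first.
Each slot occurs once, so there is a single term. -/
theorem plugs_flatMap {z₀ : ℕ} : ∀ {zs : List ℕ} {ws : List (List ℕ)} {u : List ℕ},
    zs.length = ws.length → zs.Nodup ∧ u.Disjoint zs → z₀ ∉ zs →
    zs.Disjoint ws.flatten → [] ∉ ws →
    plugs (str (u ++ zs.flatMap fun z => [z, z₀])) (zs.zip (ws.map str)) =
      str (u ++ ws.flatMap fun w => w ++ [z₀])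
  | [], [], u, _, _, _, _, _ => by simp [plugs]
  | [], _ :: _, u, h, _, _, _, _ => by simp at h
  | _ :: _, [], u, h, _, _, _, _ => by simp at h
  | z :: zs, w :: ws, u, hl, hn', h0, hd, hw => by
    simp only [List.mem_cons, not_or] at h0 hw
    simp only [List.flatten_cons, List.disjoint_append_right, List.disjoint_cons_left] at hd
    have hnd := List.nodup_cons.1 hn'.1
    have hud := List.disjoint_cons_right.1 hn'.2
    rw [List.map_cons, List.zip_cons_cons, plugs]
    have ih := plugs_flatMap (z₀ := z₀) (zs := zs) (ws := ws) (u := u ++ [z, z₀])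
      (by simpa using hl) ⟨hnd.2, by
        rw [List.disjoint_append_left]
        refine ⟨hud.2, ?_⟩
        simp only [List.disjoint_cons_left]
        exact ⟨hnd.1, h0.2, List.disjoint_nil_left _⟩⟩ h0.2 hd.2.2 hw.2
    rw [List.flatMap_cons, ← List.append_assoc, ih, plug_str,
      show u ++ [z, z₀] ++ (ws.flatMap fun w => w ++ [z₀]) =
        u ++ z :: (z₀ :: ws.flatMap fun w => w ++ [z₀]) by simp,
      plugL_single hud.1 ?_ (Ne.symm hw.1)]
    · simp
    · simp only [List.mem_cons, List.mem_flatMap, List.mem_append, List.not_mem_nil, or_false,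
        not_or, not_exists, not_and]
      refine ⟨Ne.symm h0.1, fun w' hw' => ⟨fun hz => ?_, Ne.symm h0.1⟩⟩
      exact hd.2.1 (List.mem_flatten.2 ⟨w', hw', hz⟩)

/-- The brace operation applied to the letter `a` and to other operations. -/
theorem subst_braceOp {L : List (Strings × List ℕ)} {ws : List (List ℕ)} (hL : GoodInputs L)
    (hws : L.map (fun p => relabel p.1 p.2) = ws.map str) (hw : [] ∉ ws) (a : ℕ) :
    subst (braceOp L.length) ((idOp, [a]) :: L) = str (braceWords a ws) := by
  -- All letters in use are smaller than Z. The slot for a is Z, and Z + 1, Z + 2, … are the slots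
  -- for the other inputs.
  obtain ⟨Z, hZ⟩ : ∃ Z, ∀ x ∈ (L.flatMap Prod.snd) ++ ws.flatten ++ [a], x < Z := by
    refine ⟨((L.flatMap Prod.snd) ++ ws.flatten ++ [a]).sum + 1, fun x hx => ?_⟩
    exact Nat.lt_succ_of_le (List.le_sum_of_mem hx)
  have hlen : L.length = ws.length := by simpa using congrArg List.length hws
  set zs := List.range' (Z + 1) L.length with hzs
  have hzL : ∀ x ∈ Z :: zs, Z ≤ x := by
    intro x hx
    simp only [hzs, List.mem_cons, List.mem_range'_1] at hx
    omega
  have h := subst_eq_plugs (L := (idOp, [a]) :: L) (zs := Z :: zs) (U := braceOp L.length)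
    (by
      intro p hp
      rcases List.mem_cons.1 hp with rfl | hp
      · exact ⟨idOp_mem, by simp⟩
      · exact hL p hp)
    (by rw [List.length_cons, Nat.add_comm]; exact braceOp_mem _)
    (by simp [hzs]) (by
      rw [hzs, ← List.range'_succ]; exact List.nodup_range') (by
      intro x hx hx'
      have h1 := hzL x hx
      have h2 := hZ x (by
        simp only [List.flatMap_cons, List.singleton_append, List.mem_cons] at hx'
        simp only [List.mem_append, List.mem_singleton]
        tauto)
      omega)
  rw [h, List.map_cons, List.zip_cons_cons, plugs, hws, relabel_idOp]
  have hr : relabel (braceOp L.length) (Z :: zs) = str ([Z] ++ zs.flatMap fun z => [z, Z]) := by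
    rw [braceOp_eq, relabel_eq_rename, rename_str]
    congr 1
    simp only [braceStr, List.map_cons, List.map_flatMap, List.singleton_append]
    congr 1
    rw [hzs, List.range'_eq_map_range, List.flatMap_map]
    refine List.flatMap_congr fun j hj => ?_
    rw [List.mem_range] at hj
    simp [List.getD_eq_getElem?_getD, hj]
  rw [hr, plugs_flatMap]
  · rw [plug_str, plugL_singleton]
    simp only [List.singleton_append, List.map_cons, if_true, strs_cons, strs_nil, add_zero,
      List.map_flatMap, List.map_append, List.map_nil, braceWords]
    congr 2
    refine List.flatMap_congr fun w hw' => ?_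
    congr 1
    conv_rhs => rw [← List.map_id w]
    refine List.map_congr_left fun x hx => ?_
    have := hZ x (by
      simp only [List.mem_append, List.mem_flatten]
      exact Or.inl (Or.inr ⟨w, hw', hx⟩))
    rw [if_neg (by omega)]; rfl
  · simp [hzs, hlen]
  · exact ⟨List.nodup_range', by simp [hzs]⟩
  · simp [hzs]
  · intro x hx hx'
    have h1 := hzL x (by simp [hx])
    have h2 := hZ x (by simp [hx'])
    omega
  · exact hw

/-- The sum of `g` over all `m` consecutive blocks `(k, l)` between `s` and `n`. -/
noncomputable def sumBlocks (n : ℕ) : ℕ → ℕ → (List (ℕ × ℕ) → Strings) → Strings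
  | 0, _, g => g []
  | m + 1, s, g => ∑ k ∈ Finset.range (n + 1), ∑ l ∈ Finset.range (n + 1),
      if s ≤ k ∧ k + l ≤ n then sumBlocks n m (k + l) fun L => g ((k, l) :: L) else 0

/-- After the first block (k, l) is split off, its end k + l is the lower bound for all others. -/
theorem sumBlocks_eq (n m s : ℕ) (g : List (ℕ × ℕ) → Strings) :
    (∑ f : Fin m → Fin (n + 1) × Fin (n + 1),
      if (∀ j, s ≤ ((f j).1 : ℕ) ∧ ((f j).1 : ℕ) + (f j).2 ≤ n) ∧
        ∀ i j, i < j → ((f i).1 : ℕ) + (f i).2 ≤ (f j).1 then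
      g (List.ofFn fun j => (((f j).1 : ℕ), ((f j).2 : ℕ))) else 0) = sumBlocks n m s g := by
  induction m generalizing s g with
  | zero => simp [sumBlocks]
  | succ m ih =>
    rw [← (Fin.consEquiv fun _ : Fin (m + 1) => Fin (n + 1) × Fin (n + 1)).sum_comp,
      Fintype.sum_prod_type, Fintype.sum_prod_type, sumBlocks, Finset.sum_range]
    refine Finset.sum_congr rfl fun k _ => ?_
    rw [Finset.sum_range]
    refine Finset.sum_congr rfl fun l _ => ?_
    split_ifs with h
    · rw [← ih]
      refine Finset.sum_congr rfl fun f _ => ?_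
      simp only [Fin.consEquiv_apply, List.ofFn_succ, Fin.cons_zero, Fin.cons_succ]
      refine if_congr ?_ rfl rfl
      simp only [Fin.forall_fin_succ, Fin.cons_zero, Fin.cons_succ, Fin.succ_pos, Fin.not_lt_zero, Fin.succ_lt_succ_iff, IsEmpty.forall_iff, forall_const,
        true_and]
      constructor
      · rintro ⟨⟨-, h1⟩, h2, h3⟩
        exact ⟨fun j => ⟨h2 j, (h1 j).2⟩, h3⟩
      · rintro ⟨h1, h3⟩
        exact ⟨⟨h, fun j => ⟨by have := (h1 j).1; omega, (h1 j).2⟩⟩, fun j => (h1 j).1, h3⟩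
    · refine Finset.sum_eq_zero fun f _ => if_neg fun hf => h ?_
      simpa [Fin.consEquiv_apply] using hf.1 0

theorem sum_blocks (m n : ℕ) (g : List (ℕ × ℕ) → Strings) :
    ∑ f ∈ blocks m n, g (List.ofFn fun j => (((f j).1 : ℕ), ((f j).2 : ℕ))) =
      sumBlocks n m 0 g := by
  rw [← sumBlocks_eq, blocks, Finset.sum_filter]
  simp

theorem sumBlocks_map (T : Strings →ₗ[ZMod 2] Strings) (n m s : ℕ) (g : List (ℕ × ℕ) → Strings) :
    sumBlocks n m s (fun L => T (g L)) = T (sumBlocks n m s g) := by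
  induction m generalizing s g with
  | zero => rfl
  | succ m ih =>
    simp only [sumBlocks, map_sum]
    refine Finset.sum_congr rfl fun k _ => Finset.sum_congr rfl fun l _ => ?_
    split_ifs
    · exact ih _ _
    · simp

theorem sumBlocks_congr {n m s : ℕ} {g g' : List (ℕ × ℕ) → Strings}
    (h : ∀ L : List (ℕ × ℕ), L.length = m → (∀ p ∈ L, s ≤ p.1) → g L = g' L) :
    sumBlocks n m s g = sumBlocks n m s g' := by
  induction m generalizing s g g' with
  | zero => exact h [] rfl (by simp)
  | succ m ih =>
    simp only [sumBlocks]
    refine Finset.sum_congr rfl fun k _ => Finset.sum_congr rfl fun l _ => ?_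
    split_ifs with hk
    · refine ih fun L hL hs => h _ (by simp [hL]) ?_
      simp only [List.mem_cons]
      rintro p (rfl | hp)
      · exact hk.1
      · have := hs p hp; omega
    · rfl

/-- The first block starts either behind s or at s, and in the second case one sums over its length.
The condition s < n is harmless, because no block starts behind n. -/
theorem sumBlocks_split {n m s : ℕ} (hs : s ≤ n) (g : List (ℕ × ℕ) → Strings) :
    sumBlocks n (m + 1) s g =
      (if s < n then sumBlocks n (m + 1) (s + 1) g else 0) +
      ∑ l ∈ Finset.range (n - s + 1), sumBlocks n m (s + l) fun L => g ((s, l) :: L) := by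
  have h1 : ∑ l ∈ Finset.range (n - s + 1), sumBlocks n m (s + l) (fun L => g ((s, l) :: L)) =
      ∑ l ∈ Finset.range (n + 1), if s ≤ s ∧ s + l ≤ n then
        sumBlocks n m (s + l) fun L => g ((s, l) :: L) else 0 := by
    rw [← Finset.sum_filter]
    refine Finset.sum_congr ?_ fun _ _ => rfl
    ext l
    simp
    omega
  have h2 : (if s < n then sumBlocks n (m + 1) (s + 1) g else 0) =
      ∑ k ∈ (Finset.range (n + 1)).erase s, ∑ l ∈ Finset.range (n + 1),
        if s ≤ k ∧ k + l ≤ n then sumBlocks n m (k + l) fun L => g ((k, l) :: L) else 0 := by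
    have h3 : (if s < n then sumBlocks n (m + 1) (s + 1) g else 0) =
        sumBlocks n (m + 1) (s + 1) g := by
      split_ifs with h
      · rfl
      · symm
        refine Finset.sum_eq_zero fun k _ => Finset.sum_eq_zero fun l _ => if_neg ?_
        omega
    rw [h3, sumBlocks, ← Finset.add_sum_erase _ _ (show s ∈ Finset.range (n + 1) by simp; omega)]
    rw [Finset.sum_eq_zero fun l _ => if_neg (by omega), zero_add]
    refine Finset.sum_congr rfl fun k hk => Finset.sum_congr rfl fun l _ => if_congr ?_ rfl rfl
    have := Finset.ne_of_mem_erase hk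
    omega
  rw [h1, h2, sumBlocks, ← Finset.add_sum_erase _ _ (show s ∈ Finset.range (n + 1) by simp; omega),
    add_comm]

/-- The words that are the inputs in the composition of two braces. -/
def braceInputs (C : ℕ → ℕ) (n s : ℕ) (bs : List ℕ) (L : List (ℕ × ℕ)) : List (List ℕ) :=
  interleave (fun j => [C j]) n s
    (List.zipWith (fun b p => (p.1, p.2, brace b ((List.range' p.1 p.2).map C))) bs L)

/-- The first piece contains ℓ. Either it ends there and c follows, or it continues into v. -/
theorem plugL_brace_cons {z c : ℕ} (h : c ≠ z) (ℓ : ℕ) (cs v : List ℕ) :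
    strs (plugL z (brace z (c :: cs)) (ℓ :: v)) =
      pre ℓ (pre c (strs (plugL z (brace z cs) (ℓ :: v)))) +
        pre ℓ (strs (plugL z (brace z (c :: cs)) v)) := by
  rw [brace_cons, plugL, if_pos rfl, plugSlot, strs_map_cons, strs_append, map_add, plugL,
    if_neg h, strs_map_cons, plugL, if_pos rfl]

/-- Both sides satisfy the same recursion in the letters c that remain and in `bs`. A letter c that
is put in while the current letter is a stays at top level; one put in at b belongs to the block of
b. -/
theorem plugL_brace {z a n : ℕ} {C : ℕ → ℕ} (hC : ∀ j < n, C j ≠ z) (bs : List ℕ) {s : ℕ}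
    (hs : s ≤ n) :
    strs (plugL z (brace z ((List.range' s (n - s)).map C)) (brace a bs)) =
      sumBlocks n bs.length s fun L => str (braceWords a (braceInputs C n s bs L)) := by
  have hrec : ∀ s, s < n → (List.range' s (n - s)).map C =
      C s :: (List.range' (s + 1) (n - (s + 1))).map C := by
    intro s hs
    rw [show n - s = (n - (s + 1)) + 1 by omega, List.range'_succ, List.map_cons]
  have hplug : ∀ s, s < n → ∀ ℓ v,
      strs (plugL z (brace z ((List.range' s (n - s)).map C)) (ℓ :: v)) =
      pre ℓ (pre (C s)
        (strs (plugL z (brace z ((List.range' (s + 1) (n - (s + 1))).map C)) (ℓ :: v)))) +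
      pre ℓ (strs (plugL z (brace z ((List.range' s (n - s)).map C)) v)) := by
    intro s hs ℓ v
    rw [hrec s hs]
    exact plugL_brace_cons (hC s hs) ℓ _ v
  have hnil : ∀ v, v ≠ [] →
      strs (plugL z (brace z ((List.range' n (n - n)).map C)) v) = str v := by
    intro v hv
    have : brace z ((List.range' n (n - n)).map C) = [z] := by simp [brace]
    rw [this, plugL_slot_of_notMem (by simp) hv]
    simp
  have hslot : ∀ u, strs (plugL z (brace z u) []) = 0 := by
    intro u
    rw [brace, plugL, if_pos rfl, plugSlot, strs_nil]
  induction bs generalizing s with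
  | nil =>
    simp only [List.length_nil, sumBlocks, braceInputs, List.zipWith_nil_left, interleave]
    obtain ⟨r, hr⟩ : ∃ r, n = s + r := ⟨n - s, by omega⟩
    induction r generalizing s with
    | zero =>
      obtain rfl : n = s := hr
      rw [hnil _ (by simp [brace])]
      simp [brace, braceWords]
    | succ r ih =>
      have := ih (s := s + 1) (by omega) (by omega)
      rw [show brace a [] = a :: [] from rfl] at this ⊢
      rw [hplug s (by omega), this, hslot, show n - s = (n - (s + 1)) + 1 by omega,
        List.range'_succ]
      simp [braceWords]
  | cons b bs ihb =>
    -- The number l counts the letters c that are put in while the current letter is b. Together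
    -- with b they form the block b, c, b, …, b.
    have hH2 : ∀ r s, n = s + r →
        strs (plugL z (brace z ((List.range' s (n - s)).map C)) (b :: brace a bs)) =
        ∑ l ∈ Finset.range (n - s + 1), cat (str (brace b ((List.range' s l).map C)))
          (strs (plugL z (brace z ((List.range' (s + l) (n - (s + l))).map C)) (brace a bs))) := by
      intro r
      induction r with
      | zero =>
        intro s hr
        obtain rfl : n = s := hr
        rw [hnil _ (by simp)]
        simp only [Nat.sub_self, zero_add, Finset.range_one, Finset.sum_singleton, Nat.add_zero]
        have := hnil (brace a bs) (by simp [brace])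
        rw [Nat.sub_self] at this
        rw [this, cat_str]
        rfl
      | succ r ih =>
        intro s hr
        rw [hplug s (by omega), ih (s + 1) (by omega), show n - s + 1 = (n - (s + 1) + 1) + 1 by omega,
          Finset.sum_range_succ' _ (n - (s + 1) + 1)]
        congr 1
        · rw [map_sum, map_sum]
          refine Finset.sum_congr rfl fun l _ => ?_
          rw [List.range'_succ, List.map_cons, brace_cons, ← pre_str, ← pre_str, cat_pre, cat_pre,
            show s + 1 + l = s + (l + 1) by omega]
        · rw [List.range'_zero, List.map_nil, show brace b [] = b :: [] from rfl, ← pre_str,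
            cat_pre, cat_nil, Nat.add_zero]
    obtain ⟨r, hr⟩ : ∃ r, n = s + r := ⟨n - s, by omega⟩
    -- A block that starts at s: the current piece passes from a to b without a cut at a.
    have hblock : ∀ s, s ≤ n → ∑ l ∈ Finset.range (n - s + 1), sumBlocks n bs.length (s + l)
        (fun L => str (braceWords a (braceInputs C n s (b :: bs) ((s, l) :: L)))) =
        pre a (strs (plugL z (brace z ((List.range' s (n - s)).map C)) (b :: brace a bs))) := by
      intro s hs
      rw [hH2 (n - s) s (by omega), map_sum]
      refine Finset.sum_congr rfl fun l hl => ?_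
      rw [Finset.mem_range] at hl
      rw [ihb (by omega), ← sumBlocks_map, ← sumBlocks_map]
      refine sumBlocks_congr fun L _ _ => ?_
      rw [cat_str, pre_str]
      simp [braceInputs, interleave, braceWords]
    induction r generalizing s with
    | zero =>
      obtain rfl : n = s := hr
      rw [List.length_cons, sumBlocks_split le_rfl, if_neg (lt_irrefl _), zero_add, hblock n le_rfl,
        hnil _ (by simp [brace]), hnil _ (by simp), pre_str]
      rfl
    | succ r ih =>
      rw [List.length_cons, sumBlocks_split hs, if_pos (by omega), hblock s hs, brace_cons,
        hplug s (by omega), ← brace_cons, ih (by omega) (by omega), List.length_cons]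
      congr 1
      rw [← sumBlocks_map, ← sumBlocks_map]
      refine sumBlocks_congr fun L hL hs' => ?_
      obtain ⟨p, L, rfl⟩ : ∃ p L', L = p :: L' := by
        cases L with
        | nil => simp at hL
        | cons p L => exact ⟨p, L, rfl⟩
      have hp := hs' p (by simp)
      simp only [braceInputs, List.zipWith_cons_cons, interleave, pre_str]
      rw [show p.1 - s = (p.1 - (s + 1)) + 1 by omega, List.range'_succ]
      simp [braceWords]

theorem interleave_map {M N : Type*} (g : M → N) (C : ℕ → M) (n : ℕ) :
    ∀ (s : ℕ) (L : List (ℕ × ℕ × M)), (interleave C n s L).map g =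
      interleave (fun j => g (C j)) n s (L.map fun p => (p.1, p.2.1, g p.2.2))
  | s, [] => by simp [interleave]
  | s, (k, l, B) :: L => by simp [interleave, interleave_map g C n (k + l) L]

theorem mem_interleave {M : Type*} {C : ℕ → M} {n : ℕ} {x : M} :
    ∀ {s : ℕ} {L : List (ℕ × ℕ × M)}, x ∈ interleave C n s L →
      (∃ j, x = C j) ∨ ∃ p ∈ L, x = p.2.2
  | s, [], h => by
    simp only [interleave, List.mem_map] at h
    obtain ⟨j, _, rfl⟩ := h
    exact Or.inl ⟨j, rfl⟩
  | s, (k, l, B) :: L, h => by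
    simp only [interleave, List.mem_append, List.mem_map, List.mem_cons] at h
    rcases h with ⟨j, _, rfl⟩ | rfl | h
    · exact Or.inl ⟨j, rfl⟩
    · exact Or.inr ⟨(k, l, x), by simp, rfl⟩
    · rcases mem_interleave h with h | ⟨p, hp, rfl⟩
      · exact Or.inl h
      · exact Or.inr ⟨p, by simp [hp], rfl⟩

theorem relabel_braceOp (a : ℕ) (cs : List ℕ) :
    relabel (braceOp cs.length) (a :: cs) = str (brace a cs) := by
  rw [braceOp_eq, relabel_eq_rename, rename_str, braceStr]
  congr 1
  simp only [List.map_cons, List.map_flatMap, brace]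
  congr 1
  have : cs = (List.range cs.length).map fun j => cs.getD j 0 := by
    refine List.ext_getElem (by simp) fun i h1 h2 => ?_
    simp [List.getD_eq_getElem?_getD, h1]
  conv_rhs => rw [this, List.flatMap_map]
  refine List.flatMap_congr fun j hj => ?_
  simp

/-- The inputs in the composition of two braces, as operations with their letters. -/
noncomputable def assocInputs (m n : ℕ) (f : Fin m → Fin (n + 1) × Fin (n + 1)) :
    List (Strings × List ℕ) :=
  interleave (fun j => (idOp, [m + 2 + j])) n 0
    (List.ofFn fun j : Fin m =>
      (((f j).1 : ℕ), ((f j).2 : ℕ),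
        (braceOp (f j).2, (2 + (j : ℕ)) :: List.range' (m + 2 + (f j).1) (f j).2)))

theorem goodInputs_assocInputs (m n : ℕ) (f : Fin m → Fin (n + 1) × Fin (n + 1)) :
    GoodInputs (assocInputs m n f) := by
  intro p hp
  rcases mem_interleave hp with ⟨j, rfl⟩ | ⟨q, hq, rfl⟩
  · exact ⟨idOp_mem, by simp⟩
  · obtain ⟨j, rfl⟩ := (List.mem_ofFn' _ _).1 hq
    refine ⟨?_, by simp⟩
    rw [List.length_cons, List.length_range', Nat.add_comm]
    exact braceOp_mem _

theorem braceOp_assoc {m n : ℕ} :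
    circ 1 (1 + m) (braceOp n) (braceOp m) =
      ∑ f ∈ blocks m n,
        subst (braceOp (assocInputs m n f).length) ((idOp, [1]) :: assocInputs m n f) := by
  have hterm : ∀ f : Fin m → Fin (n + 1) × Fin (n + 1),
      subst (braceOp (assocInputs m n f).length) ((idOp, [1]) :: assocInputs m n f) =
      str (braceWords 1 (braceInputs (fun j => m + 2 + j) n 0 (List.range' 2 m)
        (List.ofFn fun j => (((f j).1 : ℕ), ((f j).2 : ℕ))))) := by
    intro f
    have hz : List.zipWith
        (fun b (p : ℕ × ℕ) =>
          (p.1, p.2, brace b ((List.range' p.1 p.2).map fun j => m + 2 + j)))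
        (List.range' 2 m) (List.ofFn fun j => (((f j).1 : ℕ), ((f j).2 : ℕ))) =
        List.ofFn fun j : Fin m => (((f j).1 : ℕ), ((f j).2 : ℕ),
          brace (2 + (j : ℕ)) (List.range' (m + 2 + (f j).1) (f j).2)) := by
      refine List.ext_getElem (by simp) fun i h1 h2 => ?_
      simp [List.map_add_range']
    refine subst_braceOp (goodInputs_assocInputs m n f) ?_ ?_ 1
    · rw [braceInputs, hz, assocInputs, interleave_map, interleave_map]
      simp only [relabel_idOp, List.map_ofFn, Function.comp_def]
      congr 2
      funext j
      have := relabel_braceOp (2 + (j : ℕ)) (List.range' (m + 2 + (f j).1) (f j).2)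
      rw [List.length_range'] at this
      rw [this]
    · rw [braceInputs, hz]
      intro h
      rcases mem_interleave h with ⟨j, hj⟩ | ⟨q, hq, hj⟩
      · simp at hj
      · obtain ⟨j, rfl⟩ := (List.mem_ofFn' _ _).1 hq
        simp [brace] at hj
  rw [Finset.sum_congr rfl fun f _ => hterm f,
    sum_blocks m n fun L => str (braceWords 1 (braceInputs (fun j => m + 2 + j) n 0
      (List.range' 2 m) L))]
  have hmem := circ_mem (i := 1) le_rfl (by omega) (by omega) (braceOp_mem n) (braceOp_mem m)
  -- All letters of the composite are at most 1 + m + n, so m + n + 2 can name the slot.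
  have hc := relabel_circ (U := braceOp n) (V := braceOp m) (l₁ := []) (l := List.range' 1 (1 + m))
    (l₃ := List.range' (m + 2) n) (z := m + n + 2) (by simpa using braceOp_mem n)
    (by simpa using braceOp_mem m) (by simp) (by simp) (by simp; omega)
  rw [List.nil_append, List.nil_append, List.length_nil, List.length_range', zero_add,
    show m + 2 = 1 + (1 + m) by omega, List.range'_append_1,
    relabel_range' (by rwa [show 1 + n + (1 + m) - 1 = 1 + m + n by omega] at hmem)] at hc
  have h1 : relabel (braceOp n) ((m + n + 2) :: List.range' (1 + (1 + m)) n) =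
      str (brace (m + n + 2) ((List.range' 0 (n - 0)).map fun j => m + 2 + j)) := by
    have := relabel_braceOp (m + n + 2) (List.range' (1 + (1 + m)) n)
    rw [List.length_range'] at this
    rw [this, List.map_add_range', Nat.sub_zero, Nat.add_zero, show m + 2 = 1 + (1 + m) by omega]
  have h2 : relabel (braceOp m) (List.range' 1 (1 + m)) = str (brace 1 (List.range' 2 m)) := by
    have := relabel_braceOp 1 (List.range' 2 m)
    rw [List.length_range'] at this
    rw [← this, Nat.add_comm 1 m, List.range'_succ]
  rw [hc, h1, h2, plug_str, plugL_brace (fun j hj => by omega) _ (Nat.zero_le n), List.length_range']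

theorem E_isExtendedHomotopyGInChi : IsExtendedHomotopyGInChi E where
  mem_chi k p q hp hq := E_mem_chi hp hq
  zero_left := E_zero_left
  zero_right := E_zero_right
  E_zero p q hp := E_zero_of_one_lt hp
  homotopyG :=
    { e_zero := rfl
      mem_chi := fun q => by
        split_ifs with h
        · subst h
          exact Submodule.subset_span ⟨[1], by decide, rfl⟩
        · have := E_mem_chi (k := 0) le_rfl (Nat.pos_of_ne_zero h)
          rwa [show 0 + 1 + q - 1 = q by omega] at this
      diff := fun q hq => braceOp_diff q hq
      hirsch := fun q hq => braceOp_hirsch q hq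
      assoc := fun m n _ _ => braceOp_assoc }
  ehga k m n hk hm hn := by
    obtain ⟨k, rfl⟩ : ∃ k', k = k' + 1 := ⟨k - 1, by omega⟩
    exact ehgaLeft_E hm hn (by omega)

/-! ### Lattice paths -/

section LatticePaths

variable {α β M : Type*}

/-- The lattice paths in the rectangle with columns `u` and rows `vs`, from the lower left to the
upper right corner. By convention, a single column without rows has one (empty) path. -/
def latticePaths : List α → List β → List (List (α × β))
  | [], _ => []
  | _ :: u, [] => if u = [] then [[]] else []
  | a :: u, b :: vs => (latticePaths u (b :: vs) ++ latticePaths (a :: u) vs).map ((a, b) :: ·)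
termination_by u vs => u.length + vs.length

/-- The sum of a function over all lattice paths. -/
def pathSum [AddCommMonoid M] (u : List α) (vs : List β) (g : List (α × β) → M) : M :=
  ((latticePaths u vs).map g).sum

section

variable [AddCommMonoid M]

@[simp] theorem pathSum_nil (vs : List β) (g : List (α × β) → M) : pathSum [] vs g = 0 := by
  simp [pathSum, latticePaths]

theorem pathSum_cons_nil (a : α) (u : List α) (g : List (α × β) → M) :
    pathSum (a :: u) [] g = if u = [] then g [] else 0 := by
  rw [pathSum, latticePaths]
  split_ifs <;> simp

theorem pathSum_cons_cons (a : α) (u : List α) (b : β) (vs : List β) (g : List (α × β) → M) :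
    pathSum (a :: u) (b :: vs) g = pathSum u (b :: vs) (fun p => g ((a, b) :: p)) +
      pathSum (a :: u) vs fun p => g ((a, b) :: p) := by
  rw [pathSum, latticePaths]
  simp [pathSum, Function.comp_def]

theorem pathSum_congr {u : List α} {vs : List β} {g g' : List (α × β) → M}
    (h : ∀ p ∈ latticePaths u vs, g p = g' p) : pathSum u vs g = pathSum u vs g' := by
  rw [pathSum, pathSum, List.map_congr_left h]

theorem pathSum_add (u : List α) (vs : List β) (g g' : List (α × β) → M) :
    pathSum u vs (fun p => g p + g' p) = pathSum u vs g + pathSum u vs g' := by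
  simp [pathSum, List.sum_map_add]

theorem pathSum_zero (u : List α) (vs : List β) :
    pathSum u vs (fun _ => (0 : M)) = 0 := by
  simp [pathSum]

theorem pathSum_sum {ι : Type*} (s : Finset ι) (u : List α) (vs : List β)
    (g : ι → List (α × β) → M) :
    pathSum u vs (fun p => ∑ i ∈ s, g i p) = ∑ i ∈ s, pathSum u vs (g i) := by
  classical
  induction s using Finset.induction_on with
  | empty => simp [pathSum_zero]
  | insert a s ha ih => simp [Finset.sum_insert ha, pathSum_add, ih]

end

theorem latticePaths_map {α' β' : Type*} (f : α → α') (g : β → β') (u : List α) (vs : List β) :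
    latticePaths (u.map f) (vs.map g) =
      (latticePaths u vs).map (List.map (Prod.map f g)) := by
  induction u generalizing vs with
  | nil => simp [latticePaths]
  | cons a u ih =>
    induction vs with
    | nil => 
      simp only [List.map_cons, List.map_nil, latticePaths, List.map_eq_nil_iff]
      split_ifs <;> simp
    | cons b vs ihv =>
      have h := ih (b :: vs)
      rw [List.map_cons] at h ihv
      simp only [List.map_cons, latticePaths, h, ihv]
      simp [Function.comp_def]

theorem pathSum_map [AddCommMonoid M] {α' β' : Type*} (f : α → α') (g : β → β') (u : List α)
    (vs : List β) (h : List (α' × β') → M) :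
    pathSum (u.map f) (vs.map g) h = pathSum u vs fun p => h (p.map (Prod.map f g)) := by
  rw [pathSum, latticePaths_map, pathSum, List.map_map]
  rfl

/-- The Leibniz rule for the deletion of points of a lattice path: deleting an inner corner is
cancelled, and the other deletions are those of a whole column or row. -/
theorem pathSum_dels [AddCommGroup M] [Module (ZMod 2) M] (u : List α) (vs : List β)
    (g : List (α × β) → M) :
    pathSum u vs (fun p => ((dels p).map g).sum) =
      ((dels u).map fun u' => pathSum u' vs g).sum +
        ((dels vs).map fun vs' => pathSum u vs' g).sum := by
  induction u generalizing vs g with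
  | nil => simp [dels]
  | cons a u ih =>
    induction vs generalizing g with
    | nil =>
      simp only [dels, List.map_cons, List.map_map, List.sum_cons, Function.comp_def,
        pathSum_cons_nil, List.map_nil, List.sum_nil, add_zero, ite_self]
      rcases u with _ | ⟨b, _ | ⟨c, u⟩⟩
      · simp [dels]
      -- Two columns without rows: deleting either one leaves a single column with its empty path,
      -- and the two contributions cancel.
      · simp [dels, pathSum_cons_nil, add_self_eq_zero]
      · have h : ∀ x ∈ dels (b :: c :: u), x ≠ [] := by
          simp only [dels, List.map_cons, List.mem_cons]
          rintro x (rfl | rfl | h) <;> try simp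
          simp only [List.mem_map] at h
          obtain ⟨y, -, rfl⟩ := h
          simp
        rw [pathSum_cons_nil, if_neg (by simp), zero_add, eq_comm]
        refine List.sum_eq_zero fun y hy => ?_
        obtain ⟨x, hx, rfl⟩ := List.mem_map.1 hy
        rw [if_neg (h x hx)]
    | cons b vs ihv =>
      rw [pathSum_cons_cons]
      simp only [dels, List.map_cons, List.map_map, List.sum_cons, Function.comp_def,
        pathSum_add, pathSum_cons_cons, List.sum_map_add]
      have h1 := ih (b :: vs) fun p => g ((a, b) :: p)
      have h2 := ihv fun p => g ((a, b) :: p)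
      simp only [dels, List.map_cons, List.map_map, List.sum_cons, Function.comp_def] at h1 h2
      rw [h1, h2]
      -- The term that remains twice comes from the paths with a corner directly behind (a, b):
      -- deleting the corner gives the same points on both sides of it.
      rw [← sub_eq_zero]
      abel_nf
      simp [two_zsmul, add_self_eq_zero]

end LatticePaths

/-- The rows that a path visits in the column `z`. -/
def slots {β : Type*} (z : ℕ) (p : List (ℕ × β)) : List β :=
  (p.filter fun e => e.1 = z).map Prod.snd

/-- The points of a path outside the column `z`. -/
def others {β : Type*} (z : ℕ) (p : List (ℕ × β)) : List (ℕ × β) := p.filter fun e => e.1 ≠ z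

theorem sum_map_plugSlot {M : Type*} [AddCommMonoid M] (f : List ℕ → List (List ℕ)) (c : ℕ)
    (v : List ℕ) (h : List ℕ → M) :
    ((plugSlot f (c :: v)).map h).sum = ((f (c :: v)).map fun w => h (c :: w)).sum +
      ((plugSlot f v).map fun w => h (c :: w)).sum := by
  simp [plugSlot, Function.comp_def]

theorem nil_notMem_plugSlot (f : List ℕ → List (List ℕ)) (v : List ℕ) : [] ∉ plugSlot f v := by
  cases v <;> simp [plugSlot]

theorem nil_notMem_plugL {z : ℕ} {u : List ℕ} (hu : u ≠ []) (v : List ℕ) : [] ∉ plugL z u v := by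
  cases u with
  | nil => exact absurd rfl hu
  | cons a u =>
    rw [plugL]
    split_ifs
    · exact nil_notMem_plugSlot _ _
    · simp

/-- The lattice paths over the strings in a composition: put lattice paths over the rows of the
slot into that slot. -/
theorem pathSum_plugL {β M : Type*} [AddCommMonoid M] (z : ℕ) (u v : List ℕ) (vs : List β)
    (g : Multiset (ℕ × β) → M) :
    ((plugL z u v).map fun w => pathSum w vs fun p => g p).sum =
      pathSum u vs fun q => pathSum v (slots z q) fun r => g (others z q + r) := by
  induction u generalizing v vs g with
  | nil =>
    rw [plugL_eq_of_notMem (by simp)]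
    split_ifs <;> simp
  | cons a u ih =>
    by_cases ha : a = z
    · subst ha
      induction v generalizing vs g with
      | nil =>
        simp [plugL, plugSlot, pathSum_zero]
      | cons c v ihw =>
        induction vs generalizing g with
        | nil =>
          rw [plugL, if_pos rfl, sum_map_plugSlot, pathSum_cons_nil]
          simp only [pathSum_cons_nil]
          rw [List.sum_eq_zero (l := (plugSlot _ v).map _) (by
            intro x hx
            obtain ⟨w, hw, rfl⟩ := List.mem_map.1 hx
            exact if_neg fun h => nil_notMem_plugSlot _ _ (h ▸ hw)), add_zero]
          split_ifs with h
          · subst h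
            rw [plugL_eq_of_notMem (by simp)]
            cases v <;> simp [slots, others, pathSum_cons_nil]
          · refine List.sum_eq_zero fun x hx => ?_
            obtain ⟨w, hw, rfl⟩ := List.mem_map.1 hx
            exact if_neg fun h' => nil_notMem_plugL h _ (h' ▸ hw)
        | cons b vs ihv =>
          -- From the point (c, b) in the slot the path goes to the next letter of u (`h1`), up to
          -- the next row (`h2`) or to the next letter of v (`h3`).
          have h1 := ih (c :: v) (b :: vs) fun p => g ((c, b) ::ₘ p)
          have h2 := ihv fun p => g ((c, b) ::ₘ p)
          have h3 := ihw (b :: vs) fun p => g ((c, b) ::ₘ p)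
          rw [plugL, if_pos rfl] at h2 h3 ⊢
          simp only [sum_map_plugSlot, pathSum_cons_cons, List.sum_map_add] at h2 h3 ⊢
          simp only [slots, others, decide_false, decide_true,
            List.filter_cons, ← Multiset.cons_coe, ne_eq, if_true,
            Bool.false_eq_true, if_false, not_true_eq_false, List.map_cons, pathSum_cons_cons,
            Multiset.add_cons, pathSum_add] at h1 h2 h3 ⊢
          rw [h1, h3, ← h2]
          abel
    · induction vs generalizing g with
      | nil =>
        rw [plugL, if_neg ha]
        simp only [List.map_map, Function.comp_def, pathSum_cons_nil]
        split_ifs with h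
        · subst h
          rw [plugL_eq_of_notMem (by simp)]
          rcases v with _ | ⟨c, _ | ⟨c', v⟩⟩ <;> simp [slots, others, pathSum_cons_nil]
        · refine List.sum_eq_zero fun x hx => ?_
          obtain ⟨w, hw, rfl⟩ := List.mem_map.1 hx
          exact if_neg fun h' => nil_notMem_plugL h _ (h' ▸ hw)
      | cons b vs ihv =>
        have h1 := ih v (b :: vs) fun p => g ((a, b) ::ₘ p)
        have h2 := ihv fun p => g ((a, b) ::ₘ p)
        rw [plugL, if_neg ha] at h2 ⊢
        simp only [List.map_map, Function.comp_def, pathSum_cons_cons, List.sum_map_add] at h2 ⊢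
        simp only [slots, others, ha, decide_false, not_false_eq_true, decide_true, List.filter_cons,
          ← Multiset.cons_coe, Multiset.cons_add, ne_eq, if_true, Bool.false_eq_true, if_false] at h1 h2 ⊢
        rw [h1, h2]

/-! ### Points and steps of lattice paths -/

section LatticePaths

variable {α β M : Type*}

theorem mem_of_mem_latticePaths {u : List α} {vs : List β} {p : List (α × β)}
    (hp : p ∈ latticePaths u vs) {e : α × β} (he : e ∈ p) : e.1 ∈ u ∧ e.2 ∈ vs := by
  induction u generalizing vs p with
  | nil => simp [latticePaths] at hp
  | cons a u ih =>
    induction vs generalizing p with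
    | nil =>
      rw [latticePaths] at hp
      split_ifs at hp <;> simp at hp
      simp [hp] at he
    | cons b vs ihv =>
      simp only [latticePaths, List.mem_map, List.mem_append] at hp
      obtain ⟨p, hp, rfl⟩ := hp
      rcases List.mem_cons.1 he with rfl | he
      · simp
      · rcases hp with hp | hp
        · have := ih hp he
          exact ⟨List.mem_cons_of_mem _ this.1, this.2⟩
        · have := ihv hp he
          exact ⟨this.1, List.mem_cons_of_mem _ this.2⟩

theorem length_of_mem_latticePaths {u : List α} {vs : List β} {p : List (α × β)}
    (hp : p ∈ latticePaths u vs) : p.length + 1 = u.length + vs.length := by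
  induction u generalizing vs p with
  | nil => simp [latticePaths] at hp
  | cons a u ih =>
    induction vs generalizing p with
    | nil =>
      rw [latticePaths] at hp
      split_ifs at hp with h <;> simp at hp
      simp [hp, h]
    | cons b vs ihv =>
      simp only [latticePaths, List.mem_map, List.mem_append] at hp
      obtain ⟨p, hp, rfl⟩ := hp
      rcases hp with hp | hp
      · have := ih hp
        simp only [List.length_cons] at this ⊢
        omega
      · have := ihv hp
        simp only [List.length_cons] at this ⊢
        omega

theorem pairwise_of_mem_latticePaths [Preorder β] {u : List α} {vs : List β} {p : List (α × β)}
    (hv : vs.Pairwise (· ≤ ·)) (hp : p ∈ latticePaths u vs) :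
    (p.map Prod.snd).Pairwise (· ≤ ·) := by
  induction u generalizing vs p with
  | nil => simp [latticePaths] at hp
  | cons a u ih =>
    induction vs generalizing p with
    | nil =>
      rw [latticePaths] at hp
      split_ifs at hp <;> simp at hp
      simp [hp]
    | cons b vs ihv =>
      simp only [latticePaths, List.mem_map, List.mem_append] at hp
      obtain ⟨p, hp, rfl⟩ := hp
      have hv' := List.pairwise_cons.1 hv
      rw [List.map_cons, List.pairwise_cons]
      have hb : ∀ y ∈ b :: vs, b ≤ y := by
        simpa using hv'.1
      constructor
      · intro y hy
        obtain ⟨e, he, rfl⟩ := List.mem_map.1 hy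
        rcases hp with hp | hp
        · exact hb _ (mem_of_mem_latticePaths hp he).2
        · exact hb _ (List.mem_cons_of_mem _ (mem_of_mem_latticePaths hp he).2)
      · rcases hp with hp | hp
        · exact ih hv hp
        · exact ihv hv'.2 hp

/-- The step of a lattice path between two neighbouring rows lies in one column. -/
theorem exists_sublist_of_mem_latticePaths {u : List α} {vs₁ vs₂ : List β} {b b' : β}
    {p : List (α × β)} (hp : p ∈ latticePaths u (vs₁ ++ b :: b' :: vs₂)) :
    ∃ c, [(c, b), (c, b')].Sublist p := by
  induction u generalizing vs₁ p with
  | nil => simp [latticePaths] at hp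
  | cons a u ih =>
    induction vs₁ generalizing p with
    | nil =>
      simp only [List.nil_append] at hp ih
      rw [latticePaths] at hp
      obtain ⟨p, hp', rfl⟩ := List.mem_map.1 hp
      rcases List.mem_append.1 hp' with hp | hp
      · obtain ⟨c, hc⟩ := ih (vs₁ := []) hp
        exact ⟨c, hc.cons _⟩
      · rw [latticePaths] at hp
        obtain ⟨p, -, rfl⟩ := List.mem_map.1 hp
        exact ⟨a, by simp⟩
    | cons d vs₁ ihv =>
      rw [List.cons_append, latticePaths] at hp
      obtain ⟨p, hp', rfl⟩ := List.mem_map.1 hp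
      rcases List.mem_append.1 hp' with hp | hp
      · obtain ⟨c, hc⟩ := ih (vs₁ := d :: vs₁) hp
        exact ⟨c, hc.cons _⟩
      · obtain ⟨c, hc⟩ := ihv hp
        exact ⟨c, hc.cons _⟩

/-- Two equal neighbouring rows are joined by a step within one column, and its two ends would be
the same point. -/
theorem pairwise_lt_of_nodup_path [PartialOrder β] {u : List α} {vs : List β}
    (hv : vs.Pairwise (· ≤ ·)) {p : List (α × β)} (hp : p ∈ latticePaths u vs) (hn : p.Nodup) :
    vs.Pairwise (· < ·) := by
  rw [← List.isChain_iff_pairwise, List.isChain_iff_forall_rel_of_append_cons_cons]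
  intro b b' vs₁ vs₂ h
  subst h
  refine lt_of_le_of_ne ?_ ?_
  · exact List.isChain_iff_forall_rel_of_append_cons_cons.1 (List.isChain_iff_pairwise.2 hv) rfl
  · rintro rfl
    obtain ⟨c, hc⟩ := exists_sublist_of_mem_latticePaths hp
    have := hn.sublist hc
    simp at this

end LatticePaths

/-! ### Cuts as lattice paths -/

section Cuts

variable {N : ℕ} {M : Type*} [AddCommMonoid M]

/-- The points of the lattice path that belongs to a sequence of cutting points. -/
def cutPoints (u : List ℕ) (t : Fin (u.length + 1) → Fin (N + 1)) : Multiset (ℕ × Fin (N + 1)) :=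
  ∑ r : Fin u.length, (Finset.Icc (t r.castSucc) (t r.succ)).val.map (u.get r, ·)

/-- The sum over the lattice paths that start in row `s`, where the path over no columns is the
empty one, if `s` is the last row. -/
def pathSumFrom (u : List ℕ) (s : Fin (N + 1)) (g : Multiset (ℕ × Fin (N + 1)) → M) : M :=
  if u = [] then if s = Fin.last N then g 0 else 0
  else pathSum u ((List.finRange (N + 1)).drop s) fun p => g p

/-- The summation index t is the row in which the path leaves its first column. The induction goes
down from the last row, according to whether the first step is upwards. -/
theorem pathSumFrom_cons (a : ℕ) (u : List ℕ) (s : Fin (N + 1))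
    (g : Multiset (ℕ × Fin (N + 1)) → M) :
    pathSumFrom (a :: u) s g = ∑ t, if s ≤ t then
      pathSumFrom u t fun m => g ((Finset.Icc s t).val.map (a, ·) + m) else 0 := by
  rw [pathSumFrom, if_neg (by simp)]
  induction s using Fin.reverseInduction generalizing g with
  | last =>
    have h : (List.finRange (N + 1)).drop (Fin.last N : Fin (N + 1)) = [Fin.last N] := by
      rw [List.drop_eq_getElem_cons (by simp)]
      simp
      rfl
    rw [h, pathSum_cons_cons, Finset.sum_eq_single (Fin.last N), if_pos le_rfl, pathSumFrom, h,
      pathSum_cons_nil, Finset.Icc_self]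
    · by_cases hu : u = []
      · subst hu; simp
      · simp [hu]
    · intro t _ ht
      exact if_neg fun h => ht (Fin.last_le_iff.1 h)
    · simp
  | cast i ih =>
    have h : (List.finRange (N + 1)).drop (i.castSucc : Fin (N + 1)) =
        i.castSucc :: (List.finRange (N + 1)).drop (i.succ : Fin (N + 1)) := by
      rw [List.drop_eq_getElem_cons (by simp)]
      simp
      rfl
    rw [h, pathSum_cons_cons, ← Finset.add_sum_erase _ _ (Finset.mem_univ i.castSucc), if_pos le_rfl]
    congr 1
    · rw [pathSumFrom, h, Finset.Icc_self]
      by_cases hu : u = []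
      · simp [hu, (Fin.castSucc_lt_last i).ne]
      · simp [hu]
    · have := ih fun m => g ((a, i.castSucc) ::ₘ m)
      simp only [Multiset.cons_coe] at this
      rw [this, ← Finset.add_sum_erase _ _ (Finset.mem_univ i.castSucc), if_neg (by simp), zero_add]
      refine Finset.sum_congr rfl fun t ht => ?_
      have hne := Finset.ne_of_mem_erase ht
      have hle : i.succ ≤ t ↔ i.castSucc ≤ t := by
        rw [← Fin.castSucc_lt_iff_succ_le]
        exact ⟨fun h => h.le, fun h => lt_of_le_of_ne h hne.symm⟩
      refine if_ctx_congr hle (fun h => ?_) fun _ => rfl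
      have hI : Finset.Icc i.castSucc t = insert i.castSucc (Finset.Icc i.succ t) := by
        ext v
        simp only [Finset.mem_Icc, Finset.mem_insert, ← Fin.castSucc_lt_iff_succ_le]
        constructor
        · rintro ⟨h1, h2⟩
          rcases h1.eq_or_lt with h1 | h1
          · exact Or.inl h1.symm
          · exact Or.inr ⟨h1, h2⟩
        · rintro (rfl | ⟨h1, h2⟩)
          · exact ⟨le_rfl, h⟩
          · exact ⟨h1.le, h2⟩
      rw [hI, Finset.insert_val_of_notMem (by simp)]
      simp

/-- The cutting points are the rows in which the path changes columns. -/
theorem pathSumFrom_eq_sum (u : List ℕ) (s : Fin (N + 1)) (g : Multiset (ℕ × Fin (N + 1)) → M)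
    [DecidablePred fun t : Fin (u.length + 1) → Fin (N + 1) =>
      Monotone t ∧ t 0 = s ∧ t (Fin.last _) = Fin.last N] :
    pathSumFrom u s g = ∑ t : Fin (u.length + 1) → Fin (N + 1),
      if Monotone t ∧ t 0 = s ∧ t (Fin.last _) = Fin.last N then g (cutPoints u t) else 0 := by
  classical
  induction u generalizing s g with
  | nil =>
    rw [pathSumFrom, if_pos rfl]
    have hc : ∀ t : Fin ([] : List ℕ).length.succ → Fin (N + 1), t = fun _ => t 0 := by
      intro t
      funext i
      exact congrArg t (Subsingleton.elim (α := Fin 1) _ _)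
    by_cases hs : s = Fin.last N
    · subst hs
      rw [if_pos rfl, Finset.sum_eq_single (fun _ => Fin.last N),
        if_pos ⟨monotone_const, rfl, rfl⟩]
      · simp [cutPoints]
      · intro t _ ht
        rw [if_neg]
        rintro ⟨-, h, -⟩
        rw [hc t, h] at ht
        exact ht rfl
      · simp
    · rw [if_neg hs, eq_comm]
      refine Finset.sum_eq_zero fun t _ => if_neg ?_
      rintro ⟨-, h1, h2⟩
      rw [hc t] at h1 h2
      exact hs (h1.symm.trans h2)
  | cons a u ih =>
    have hl : pathSumFrom (a :: u) s g = ∑ t' : Fin (u.length + 1) → Fin (N + 1),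
        if s ≤ t' 0 ∧ Monotone t' ∧ t' (Fin.last _) = Fin.last N then
          g ((Finset.Icc s (t' 0)).val.map (a, ·) + cutPoints u t') else 0 := by
      rw [pathSumFrom_cons]
      have : ∀ t, (if s ≤ t then
          pathSumFrom u t fun m => g ((Finset.Icc s t).val.map (a, ·) + m) else 0) =
          ∑ t' : Fin (u.length + 1) → Fin (N + 1),
            if s ≤ t ∧ Monotone t' ∧ t' 0 = t ∧ t' (Fin.last _) = Fin.last N then
              g ((Finset.Icc s t).val.map (a, ·) + cutPoints u t') else 0 := by
        intro t
        split_ifs with h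
        · rw [ih]
          simp [h]
        · simp [h]
      rw [Finset.sum_congr rfl fun t _ => this t, Finset.sum_comm]
      refine Finset.sum_congr rfl fun t' _ => ?_
      rw [Finset.sum_eq_single (t' 0)]
      · simp
      · intro t _ ht
        exact if_neg fun h => ht h.2.2.1.symm
      · simp
    have hr : ∀ t' : Fin (u.length + 1) → Fin (N + 1),
        cutPoints (a :: u) (Fin.cons s t' : Fin ((u.length + 1) + 1) → Fin (N + 1)) =
          (Finset.Icc s (t' 0)).val.map (a, ·) + cutPoints u t' := by
      intro t'
      rw [cutPoints]
      change ∑ r : Fin (u.length + 1), _ = _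
      rw [Fin.sum_univ_succ]
      rfl
    change _ = ∑ t : Fin ((u.length + 1) + 1) → Fin (N + 1), _
    rw [hl, ← (Fin.consEquiv fun _ : Fin ((u.length + 1) + 1) => Fin (N + 1)).sum_comp,
      Fintype.sum_prod_type, Finset.sum_eq_single s]
    · refine Finset.sum_congr rfl fun t' _ => ?_
      refine if_congr ?_ (congrArg g (hr t').symm) rfl
      change _ ↔ Monotone (Fin.cons s t' : Fin ((u.length + 1) + 1) → Fin (N + 1)) ∧ s = s ∧
        t' (Fin.last _) = Fin.last N
      rw [Fin.monotone_iff_le_succ, Fin.monotone_iff_le_succ, Fin.forall_fin_succ]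
      simp [and_assoc]
    · intro t _ ht
      refine Finset.sum_eq_zero fun t' _ => if_neg ?_
      rintro ⟨-, h, -⟩
      exact ht h
    · simp

end Cuts

end SurjOperad

/-! ### Faces of simplices and collapsed vertices -/

namespace SSetCochains

open Simplicial in
/-- The face of a simplex given by an order embedding of the vertices. -/
abbrev pull {S : SSet.{u}} {k N : ℕ} (e : Fin (k + 1) ↪o Fin (N + 1)) (σ : Simp S N) : Simp S k :=
  S.map (SimplexCategory.mkHom e.toOrderHom).op σ

section Faces

variable {S : SSet.{u}} {N : ℕ}

/-- The enumeration in the definition may be replaced by any order embedding with image s, as there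
is only one. -/
theorem evalFace_eq (x : (Σ n : ℕ, Simp S n) → ZMod 2) (σ : Simp S N) {k : ℕ}
    (e : Fin (k + 1) ↪o Fin (N + 1)) {s : Finset (Fin (N + 1))}
    (hs : s = Finset.univ.map e.toEmbedding) : evalFace x σ s = x ⟨k, pull e σ⟩ := by
  have hk : s.card - 1 = k := by rw [hs]; simp
  subst hk
  have hne : s.Nonempty := by rw [hs]; simp
  rw [evalFace, dif_pos hne]
  have he := Finset.orderEmbOfFin_unique' (s := s) (Nat.sub_add_cancel hne.card_pos).symm (f := e)
    (fun i => hs.ge (Finset.mem_map_of_mem e.toEmbedding (Finset.mem_univ i)))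
  rw [he]

theorem exists_eq_map {s : Finset (Fin (N + 1))} (hs : s.Nonempty) :
    ∃ (k : ℕ) (e : Fin (k + 1) ↪o Fin (N + 1)), s = Finset.univ.map e.toEmbedding := by
  refine ⟨s.card - 1, s.orderEmbOfFin (Nat.sub_add_cancel hs.card_pos).symm, ?_⟩
  simp

@[simp] theorem evalFace_empty (x : (Σ n : ℕ, Simp S n) → ZMod 2) (σ : Simp S N) :
    evalFace x σ ∅ = 0 := by
  simp [evalFace]

theorem pull_pull {k m : ℕ} (e : Fin (m + 1) ↪o Fin (N + 1)) (f : Fin (k + 1) ↪o Fin (m + 1))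
    (σ : Simp S N) : pull f (pull e σ) = pull (f.trans e) σ := by
  rw [pull, pull, pull, ← CategoryTheory.comp_apply, ← S.map_comp]
  rfl

theorem evalFace_map (x : (Σ n : ℕ, Simp S n) → ZMod 2) (σ : Simp S N) {k : ℕ}
    (e : Fin (k + 1) ↪o Fin (N + 1)) (s : Finset (Fin (k + 1))) :
    evalFace x σ (s.map e.toEmbedding) = evalFace x (pull e σ) s := by
  rcases s.eq_empty_or_nonempty with rfl | hs
  · simp
  · obtain ⟨m, f, hf⟩ := exists_eq_map hs
    rw [evalFace_eq x _ f hf, evalFace_eq x σ (f.trans e), pull_pull]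
    rw [hf, Finset.map_map]
    rfl

theorem evalFace_univ (x : (Σ n : ℕ, Simp S n) → ZMod 2) (σ : Simp S N) :
    evalFace x σ Finset.univ = x ⟨N, σ⟩ := by
  rw [evalFace_eq x σ (RelEmbedding.refl _) (by ext; simp)]
  congr 2
  change S.map (CategoryTheory.CategoryStruct.id _) σ = σ
  rw [S.map_id, CategoryTheory.id_apply]

/-- The vertices of a face are omitted one at a time. For a single vertex the coboundary is zero,
which agrees with the value 0 on the empty set. -/
theorem evalFace_dFun (x : (Σ n : ℕ, Simp S n) → ZMod 2) (σ : Simp S N)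
    (s : Finset (Fin (N + 1))) :
    evalFace (dFun x) σ s = ∑ v ∈ s, evalFace x σ (s.erase v) := by
  rcases s.eq_empty_or_nonempty with rfl | hs
  · simp
  · obtain ⟨m, f, rfl⟩ := exists_eq_map hs
    rw [evalFace_eq _ _ f rfl, Finset.sum_map]
    cases m with
    | zero =>
      simp [dFun]
    | succ m =>
      rw [dFun]
      refine Finset.sum_congr rfl fun i _ => ?_
      rw [evalFace_eq _ _ ((Fin.succAboveOrderEmb i).trans f)]
      · rw [← pull_pull]
        rfl
      · ext v
        simp only [Finset.mem_erase, Finset.mem_map, Finset.mem_univ, true_and]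
        constructor
        · rintro ⟨h, j, rfl⟩
          obtain ⟨k, rfl⟩ := Fin.exists_succAbove_eq (x := j) (y := i) (by rintro rfl; exact h rfl)
          exact ⟨k, rfl⟩
        · rintro ⟨k, rfl⟩
          refine ⟨fun h => ?_, _, rfl⟩
          exact Fin.succAbove_ne i k (f.injective h)

open Simplicial in
/-- The simplex `σ` does not distinguish the vertices `i` and `i + 1`. -/
def Collapses {n : ℕ} (σ : Simp S (n + 1)) (i : Fin (n + 1)) : Prop :=
  ∃ τ : Simp S n, S.map (SimplexCategory.σ i).op τ = σ

theorem exists_collapses (σ : Simp S N) (h : σ ∈ S.degenerate N) :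
    ∃ (n : ℕ) (hn : N = n + 1) (i : Fin (n + 1)), Collapses (hn ▸ σ : Simp S (n + 1)) i := by
  cases N with
  | zero => simp at h
  | succ n =>
    rw [SSet.degenerate_eq_iUnion_range_σ] at h
    obtain ⟨i, τ, h⟩ := Set.mem_iUnion.1 h
    exact ⟨n, rfl, i, τ, h⟩

open CategoryTheory in
-- The inclusion of the face followed by the collapse of i and i + 1 is not injective, so it factors
-- through a degeneracy.
theorem evalFace_of_collapses {n : ℕ} {x : (Σ n : ℕ, Simp S n) → ZMod 2}
    (hx : ∀ (n : ℕ) (σ : Simp S n), σ ∈ S.degenerate n → x ⟨n, σ⟩ = 0) {σ : Simp S (n + 1)}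
    {i : Fin (n + 1)} (h : Collapses σ i) {s : Finset (Fin (n + 2))} (h1 : i.castSucc ∈ s)
    (h2 : i.succ ∈ s) : evalFace x σ s = 0 := by
  obtain ⟨m, e, rfl⟩ := exists_eq_map ⟨_, h1⟩
  rw [evalFace_eq _ _ e rfl]
  refine hx _ _ ?_
  obtain ⟨τ, rfl⟩ := h
  obtain ⟨j, hj⟩ : ∃ j, e j = i.castSucc := by simpa using h1
  obtain ⟨j', hj'⟩ : ∃ j, e j = i.succ := by simpa using h2
  have hne : j ≠ j' := by
    rintro rfl
    exact (Fin.castSucc_lt_succ (i := i)).ne (hj.symm.trans hj')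
  rw [pull, ← CategoryTheory.comp_apply, ← S.map_comp, ← CategoryTheory.op_comp]
  cases m with
  | zero => exact absurd (Subsingleton.elim (α := Fin 1) j j') hne
  | succ m =>
    obtain ⟨k, θ, hθ⟩ := SimplexCategory.eq_σ_comp_of_not_injective
      (SimplexCategory.mkHom e.toOrderHom ≫
        SimplexCategory.σ i) (by
        intro hinj
        refine hne (hinj ?_)
        change (Fin.predAbove i (e j)) = Fin.predAbove i (e j')
        rw [hj, hj']
        simp)
    rw [hθ, CategoryTheory.op_comp, S.map_comp, CategoryTheory.comp_apply]
    exact S.σ_mem_degenerate _ _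

end Faces

end SSetCochains

namespace SurjOperad

theorem SJ_induction {J : Finset ℕ} {p : Strings → Prop} (h0 : p 0)
    (hadd : ∀ U V, p U → p V → p (U + V)) (hstr : ∀ u, HasLetters J u → p (str u)) {U : Strings}
    (hU : U ∈ SJ J) : p U := by
  refine Submodule.span_induction ?_ h0 (fun U V _ _ hU hV => hadd U V hU hV) ?_ hU
  · rintro _ ⟨u, hu, rfl⟩
    exact hstr u hu
  · intro c U _ hU
    obtain rfl | rfl : c = 0 ∨ c = 1 := by revert c; decide
    · rwa [zero_smul]
    · rwa [one_smul]

theorem sum_map_dels {α M : Type*} [DecidableEq α] [AddCommMonoid M] (p : List α)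
    (g : Multiset α → M) :
    ((dels p).map fun p' : List α => g (p' : Multiset α)).sum =
      ((p : Multiset α).map fun e => g ((p : Multiset α).erase e)).sum := by
  induction p generalizing g with
  | nil => simp [dels]
  | cons a p ih =>
    have h := ih fun s => g (a ::ₘ s)
    simp only [dels, List.map_cons, List.sum_cons, List.map_map, Function.comp_def,
      ← Multiset.cons_coe, Multiset.map_cons, Multiset.sum_cons, Multiset.erase_cons_head] at h ⊢
    rw [h]
    congr 2
    refine Multiset.map_congr rfl fun e he => ?_
    by_cases hea : e = a
    · subst hea
      rw [Multiset.erase_cons_head, Multiset.cons_erase he]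
    · rw [Multiset.erase_cons_tail _ (Ne.symm hea)]

end SurjOperad

/-! ### Evaluation of cochains on sets of lattice points -/

namespace SSetCochains

open SurjOperad

/-- Functions on the simplices of all dimensions. -/
abbrev RawCochains (S : SSet.{u}) : Type u := (Σ n : ℕ, Simp S n) → ZMod 2

section

variable {N : ℕ}

/-- The rows of the points in the column `j`. -/
def verts (s : Multiset (ℕ × Fin (N + 1))) (j : ℕ) : Finset (Fin (N + 1)) :=
  Finset.univ.filter fun v => (j, v) ∈ s

@[simp] theorem mem_verts {s : Multiset (ℕ × Fin (N + 1))} {j : ℕ} {v : Fin (N + 1)} :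
    v ∈ verts s j ↔ (j, v) ∈ s := by
  simp [verts]

variable {S : SSet.{u}}

/-- The product of the values of the cochains `x j` on the faces spanned by the columns of a set of
points, and `0` for a multiset of points that has a repetition. -/
noncomputable def evalVerts (J : Finset ℕ) (x : ℕ → RawCochains S) (σ : Simp S N)
    (s : Multiset (ℕ × Fin (N + 1))) : ZMod 2 :=
  if s.Nodup then ∏ j ∈ J, evalFace (x j) σ (verts s j) else 0

theorem evalVerts_of_nodup {J : Finset ℕ} (x : ℕ → RawCochains S) (σ : Simp S N)
    {s : Multiset (ℕ × Fin (N + 1))} (hs : s.Nodup) :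
    evalVerts J x σ s = ∏ j ∈ J, evalFace (x j) σ (verts s j) := if_pos hs

theorem evalVerts_of_not_nodup {J : Finset ℕ} (x : ℕ → RawCochains S) (σ : Simp S N)
    {s : Multiset (ℕ × Fin (N + 1))} (hs : ¬ s.Nodup) : evalVerts J x σ s = 0 := if_neg hs

theorem evalVerts_eq_zero {J : Finset ℕ} (x : ℕ → RawCochains S) (σ : Simp S N)
    {s : Multiset (ℕ × Fin (N + 1))} {j : ℕ} (hj : j ∈ J) (h : ∀ e ∈ s, e.1 ≠ j) :
    evalVerts J x σ s = 0 := by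
  unfold evalVerts
  split_ifs
  · refine Finset.prod_eq_zero hj ?_
    rw [show verts s j = ∅ by ext v; simpa using fun hv => h _ hv rfl, evalFace_empty]
  · rfl

theorem evalVerts_congr {J : Finset ℕ} {x y : ℕ → RawCochains S} (h : ∀ j ∈ J, x j = y j)
    (σ : Simp S N) (s : Multiset (ℕ × Fin (N + 1))) :
    evalVerts J x σ s = evalVerts J y σ s := by
  unfold evalVerts
  rw [Finset.prod_congr rfl fun j hj => by rw [h j hj]]

theorem evalVerts_update {J : Finset ℕ} (x : ℕ → RawCochains S) (σ : Simp S N)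
    {s : Multiset (ℕ × Fin (N + 1))} (hs : s.Nodup) {z : ℕ} (hz : z ∈ J) (y : RawCochains S) :
    evalVerts J (Function.update x z y) σ s =
      evalFace y σ (verts s z) * ∏ j ∈ J.erase z, evalFace (x j) σ (verts s j) := by
  rw [evalVerts_of_nodup _ _ hs, ← Finset.mul_prod_erase _ _ hz, Function.update_self]
  congr 1
  refine Finset.prod_congr rfl fun j hj => ?_
  rw [Function.update_of_ne (Finset.ne_of_mem_erase hj)]

theorem evalVerts_map (J : Finset ℕ) (x : ℕ → RawCochains S) (σ : Simp S N) {k : ℕ}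
    (e : Fin (k + 1) ↪o Fin (N + 1)) (s : Multiset (ℕ × Fin (k + 1))) :
    evalVerts J x σ (s.map (Prod.map id e)) = evalVerts J x (pull e σ) s := by
  have hi : Function.Injective (Prod.map (id : ℕ → ℕ) e) := Function.injective_id.prodMap e.injective
  unfold evalVerts
  refine if_congr (Multiset.nodup_map_iff_of_injective hi) (Finset.prod_congr rfl fun j _ => ?_) rfl
  rw [← evalFace_map]
  congr 1
  ext v
  simp only [mem_verts, Multiset.mem_map, Prod.exists, Prod.map_apply, id_eq, Prod.mk.injEq,
    Finset.mem_map]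
  constructor
  · rintro ⟨i, w, h, rfl, rfl⟩
    exact ⟨w, h, rfl⟩
  · rintro ⟨w, h, rfl⟩
    exact ⟨j, w, h, rfl, rfl⟩

theorem evalVerts_rename {J : Finset ℕ} {ρ : ℕ → ℕ} (hρ : Set.InjOn ρ J) (x : ℕ → RawCochains S)
    (σ : Simp S N) {s : Multiset (ℕ × Fin (N + 1))} (hs : ∀ e ∈ s, e.1 ∈ J) :
    evalVerts (J.image ρ) x σ (s.map (Prod.map ρ id)) = evalVerts J (fun j => x (ρ j)) σ s := by
  have hi : ∀ e ∈ s, ∀ e' ∈ s, Prod.map ρ id e = Prod.map ρ id e' → e = e' := by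
    rintro ⟨i, v⟩ he ⟨i', v'⟩ he' h
    simp only [Prod.map_apply, id_eq, Prod.mk.injEq] at h
    exact Prod.ext (hρ (hs _ he) (hs _ he') h.1) h.2
  unfold evalVerts
  rw [Finset.prod_image hρ]
  refine if_congr ⟨fun h => h.of_map, fun h => h.map_on hi⟩ (Finset.prod_congr rfl fun j hj => ?_) rfl
  congr 1
  ext v
  simp only [mem_verts, Multiset.mem_map, Prod.exists, Prod.map_apply, id_eq, Prod.mk.injEq]
  constructor
  · rintro ⟨i, w, h, h1, rfl⟩
    rwa [← hρ (hs _ h) hj h1]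
  · intro h
    exact ⟨j, v, h, rfl, rfl⟩

theorem evalVerts_add {J K : Finset ℕ} (hd : Disjoint J K) (x : ℕ → RawCochains S) (σ : Simp S N)
    {s s' : Multiset (ℕ × Fin (N + 1))} (hs : ∀ e ∈ s, e.1 ∈ J) (hs' : ∀ e ∈ s', e.1 ∈ K) :
    evalVerts (J ∪ K) x σ (s + s') = evalVerts J x σ s * evalVerts K x σ s' := by
  have hdis : Disjoint s s' := by
    rw [Multiset.disjoint_left]
    intro e he he'
    exact Finset.disjoint_left.1 hd (hs e he) (hs' e he')
  unfold evalVerts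
  rw [Finset.prod_union hd]
  have h1 : ∀ j ∈ J, verts (s + s') j = verts s j := by
    intro j hj
    ext v
    simp only [mem_verts, Multiset.mem_add, or_iff_left_iff_imp]
    exact fun h => absurd (hs' _ h) (Finset.disjoint_left.1 hd hj)
  have h2 : ∀ j ∈ K, verts (s + s') j = verts s' j := by
    intro j hj
    ext v
    simp only [mem_verts, Multiset.mem_add, or_iff_right_iff_imp]
    exact fun h => absurd hj (Finset.disjoint_left.1 hd (hs _ h))
  rw [Finset.prod_congr rfl fun j hj => by rw [h1 j hj],
    Finset.prod_congr (s₁ := K) rfl fun j hj => by rw [h2 j hj]]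
  by_cases hn : s.Nodup <;> by_cases hn' : s'.Nodup <;> simp [Multiset.nodup_add, hn, hn', hdis]

/-- Without repetitions, erasing the points of column j omits the vertices of the face of x j one at
a time. With a repeated point, erasing one or the other copy gives equal terms, which cancel, and
every other erasure leaves the repetition in place. -/
theorem sum_erase_evalVerts {J : Finset ℕ} (x : ℕ → RawCochains S) (σ : Simp S N)
    {s : Multiset (ℕ × Fin (N + 1))} (hs : ∀ e ∈ s, e.1 ∈ J) :
    (s.map fun e => evalVerts J x σ (s.erase e)).sum =
      ∑ j ∈ J, evalVerts J (Function.update x j (dFun (x j))) σ s := by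
  by_cases hn : s.Nodup
  · have h : ∀ e ∈ s.toFinset, evalVerts J x σ (s.erase e) =
        evalFace (x e.1) σ ((verts s e.1).erase e.2) *
          ∏ j ∈ J.erase e.1, evalFace (x j) σ (verts s j) := by
      rintro ⟨j, v⟩ he
      rw [evalVerts_of_nodup _ _ (hn.erase _),
        ← Finset.mul_prod_erase _ _ (hs _ (Multiset.mem_toFinset.1 he))]
      congr 1
      · congr 1
        ext w
        simp [hn.mem_erase_iff]
      · refine Finset.prod_congr rfl fun i hi => ?_
        congr 1
        ext w
        simp [hn.mem_erase_iff, Finset.ne_of_mem_erase hi]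
    have h' : (s.map fun e => evalVerts J x σ (s.erase e)).sum =
        ∑ e ∈ s.toFinset, evalVerts J x σ (s.erase e) := by
      rw [Finset.sum, Multiset.toFinset_val, hn.dedup]
    rw [h', Finset.sum_congr rfl h, Finset.sum_finset_product _ J (verts s)]
    · refine Finset.sum_congr rfl fun j hj => ?_
      rw [evalVerts_update _ _ hn hj, evalFace_dFun, Finset.sum_mul]
    · rintro ⟨j, v⟩
      simpa using fun h => hs _ h
  · simp only [evalVerts_of_not_nodup _ _ hn, Finset.sum_const_zero]
    obtain ⟨e, he⟩ : ∃ e, 2 ≤ s.count e := by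
      rw [Multiset.nodup_iff_count_le_one] at hn
      push Not at hn
      exact hn
    obtain ⟨t, rfl⟩ : ∃ t, s = e ::ₘ e ::ₘ t := by
      obtain ⟨t, rfl⟩ := Multiset.exists_cons_of_mem (Multiset.count_pos.1 (by omega : 0 < s.count e))
      obtain ⟨t, rfl⟩ := Multiset.exists_cons_of_mem
        (Multiset.count_pos.1 (by simp at he; omega : 0 < t.count e))
      exact ⟨t, rfl⟩
    rw [Multiset.map_cons, Multiset.map_cons, Multiset.sum_cons, Multiset.sum_cons, ← add_assoc,
      SurjOperad.add_self_eq_zero, zero_add]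
    refine Multiset.sum_eq_zero fun y hy => ?_
    obtain ⟨f, hf, rfl⟩ := Multiset.mem_map.1 hy
    refine evalVerts_of_not_nodup _ _ fun h => ?_
    by_cases hfe : f = e
    · subst hfe
      rw [Multiset.erase_cons_head] at h
      exact (Multiset.nodup_cons.1 h).1 hf
    · rw [Multiset.erase_cons_tail _ (Ne.symm hfe), Multiset.erase_cons_tail _ (Ne.symm hfe)] at h
      simp at h

end

/-- The action of the strings with letters in `J` on functions, where a letter stands for the input
with that index: a sum over lattice paths. -/
noncomputable def rawAct {S : SSet.{u}} (J : Finset ℕ) (U : Strings) (x : ℕ → RawCochains S) :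
    RawCochains S :=
  lift (fun u σ => pathSum u (List.finRange (σ.1 + 1)) fun p => evalVerts J x σ.2 p) U

/-! ### The action by lattice paths is a chain map -/

section

variable {S : SSet.{u}} {J : Finset ℕ}

theorem rawAct_str (u : List ℕ) (x : ℕ → RawCochains S) {N : ℕ} (σ : Simp S N) :
    rawAct J (str u) x ⟨N, σ⟩ =
      pathSum u (List.finRange (N + 1)) fun p => evalVerts J x σ p := by
  rw [rawAct, lift_str]

@[simp] theorem rawAct_zero (x : ℕ → RawCochains S) : rawAct J 0 x = 0 := map_zero _

theorem rawAct_add (U V : Strings) (x : ℕ → RawCochains S) :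
    rawAct J (U + V) x = rawAct J U x + rawAct J V x := map_add _ _ _

theorem rawAct_sum {ι : Type*} (s : Finset ι) (U : ι → Strings) (x : ℕ → RawCochains S) :
    rawAct J (∑ i ∈ s, U i) x = ∑ i ∈ s, rawAct J (U i) x := map_sum _ _ _

theorem rawAct_congr {x y : ℕ → RawCochains S} (h : ∀ j ∈ J, x j = y j) (U : Strings) :
    rawAct J U x = rawAct J U y := by
  unfold rawAct
  congr 2
  funext u σ
  exact pathSum_congr fun p _ => evalVerts_congr h _ _

theorem rawAct_rename {ρ : ℕ → ℕ} (hρ : Set.InjOn ρ J) {U : Strings} (hU : U ∈ SJ J)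
    (x : ℕ → RawCochains S) :
    rawAct (J.image ρ) (rename ρ U) x = rawAct J U fun j => x (ρ j) := by
  unfold rawAct
  rw [← LinearMap.comp_apply]
  refine SJ_ext (fun u hu => ?_) hU
  rw [LinearMap.comp_apply, rename_str, lift_str, lift_str]
  funext σ
  have := pathSum_map ρ id u (List.finRange (σ.1 + 1)) fun p =>
    evalVerts (J.image ρ) x σ.2 (p : Multiset (ℕ × Fin (σ.1 + 1)))
  rw [List.map_id] at this
  rw [this]
  refine pathSum_congr fun p hp => ?_
  rw [← Multiset.map_coe]
  refine evalVerts_rename hρ x _ fun e he => ?_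
  exact ((hasLetters_iff.1 hu).1 _).1 (mem_of_mem_latticePaths hp he).1

theorem rawAct_relabel {l : List ℕ} (hl : l.Nodup) {U : Strings}
    (hU : U ∈ SJ (Finset.Icc 1 l.length)) (x : ℕ → RawCochains S) :
    rawAct l.toFinset (relabel U l) x =
      rawAct (Finset.Icc 1 l.length) U fun j => x (l.getD (j - 1) 0) := by
  rw [relabel_eq_rename, ← image_getD, rawAct_rename (getD_injOn hl) hU]

theorem dFun_zero : dFun (0 : RawCochains S) = 0 := by
  funext ⟨n, σ⟩
  cases n <;> simp [dFun]

theorem dFun_add (x y : RawCochains S) : dFun (x + y) = dFun x + dFun y := by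
  funext ⟨n, σ⟩
  cases n <;> simp [dFun, Finset.sum_add_distrib]

theorem eraseIdx_finRange (n : ℕ) (i : Fin (n + 2)) :
    (List.finRange (n + 2)).eraseIdx i = (List.finRange (n + 1)).map (Fin.succAboveOrderEmb i) := by
  refine List.ext_getElem (by simp [List.length_eraseIdx]) fun k h1 h2 => ?_
  simp [List.getElem_eraseIdx, Fin.succAbove, Fin.lt_def]
  split_ifs <;> rfl

theorem pathSum_evalVerts_map (x : ℕ → RawCochains S) {N k : ℕ} (σ : Simp S N) (u : List ℕ)
    (e : Fin (k + 1) ↪o Fin (N + 1)) :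
    (pathSum u ((List.finRange (k + 1)).map e) fun p => evalVerts J x σ p) =
      rawAct J (str u) x ⟨k, pull e σ⟩ := by
  have := pathSum_map id e u (List.finRange (k + 1)) fun p =>
    evalVerts J x σ (p : Multiset (ℕ × Fin (N + 1)))
  rw [List.map_id] at this
  rw [this, rawAct_str]
  refine pathSum_congr fun p _ => ?_
  rw [← Multiset.map_coe, evalVerts_map]

/-- To delete a row is to pass to a face of σ. In dimension 0 no row is left, and then some input
has no vertices and contributes the factor 0; this needs J to be nonempty. -/
theorem dFun_rawAct_str (hJ : J.Nonempty) (u : List ℕ) (x : ℕ → RawCochains S) {N : ℕ}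
    (σ : Simp S N) : dFun (rawAct J (str u) x) ⟨N, σ⟩ =
      ((dels (List.finRange (N + 1))).map fun vs =>
        pathSum u vs fun p => evalVerts J x σ p).sum := by
  cases N with
  | zero =>
    obtain ⟨j, hj⟩ := hJ
    have : pathSum u [] (fun p : List (ℕ × Fin (0 + 1)) => evalVerts J x σ p) = 0 := by
      cases u with
      | nil => simp
      | cons a u =>
        rw [pathSum_cons_nil, evalVerts_eq_zero x σ hj (by simp), ite_self]
    simp [dFun, dels, List.finRange_succ, this]
  | succ n =>
    rw [dels_eq, List.map_map, List.length_finRange, dFun]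
    change _ = ∑ i ∈ Finset.range (n + 2), _
    rw [Finset.sum_range]
    refine Finset.sum_congr rfl fun i _ => ?_
    rw [Function.comp_apply, eraseIdx_finRange, pathSum_evalVerts_map]
    rfl

/-- The action is a chain map. -/
theorem dFun_rawAct (hJ : J.Nonempty) {U : Strings} (hU : U ∈ SJ J) (x : ℕ → RawCochains S) :
    dFun (rawAct J U x) + ∑ j ∈ J, rawAct J U (Function.update x j (dFun (x j))) =
      rawAct J (dd U) x := by
  refine SJ_induction (p := fun U => dFun (rawAct J U x) +
    ∑ j ∈ J, rawAct J U (Function.update x j (dFun (x j))) = rawAct J (dd U) x) ?_ ?_ ?_ hU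
  · simp [dFun_zero]
  · intro U V hU hV
    simp only [rawAct_add, dFun_add, map_add, Finset.sum_add_distrib, ← hU, ← hV]
    abel
  · intro u hu
    funext ⟨N, σ⟩
    -- The deletions of points are the coboundaries of the inputs, those of columns the operad
    -- differential, those of rows the coboundary of the value.
    have h := pathSum_dels u (List.finRange (N + 1)) fun p => evalVerts J x σ p
    have h1 : pathSum u (List.finRange (N + 1)) (fun p => ((dels p).map fun p' : List _ =>
        evalVerts J x σ (p' : Multiset (ℕ × Fin (N + 1)))).sum) =
        ∑ j ∈ J, rawAct J (str u) (Function.update x j (dFun (x j))) ⟨N, σ⟩ := by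
      simp only [rawAct_str, ← pathSum_sum]
      refine pathSum_congr fun p hp => ?_
      rw [sum_map_dels, sum_erase_evalVerts]
      intro e he
      exact ((hasLetters_iff.1 hu).1 _).1 (mem_of_mem_latticePaths hp he).1
    have h2 : rawAct J (dd (str u)) x ⟨N, σ⟩ = ((dels u).map fun u' =>
        pathSum u' (List.finRange (N + 1)) fun p => evalVerts J x σ p).sum := by
      rw [dd_str, rawAct, lift_strs]
      change Pi.evalAddMonoidHom _ _ (List.sum _) = _
      rw [map_list_sum, List.map_map]
      rfl
    rw [h1, ← h2, ← dFun_rawAct_str hJ] at h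
    rw [Pi.add_apply, Finset.sum_apply, h, ← add_assoc, add_comm, ← add_assoc,
      SurjOperad.add_self_eq_zero, zero_add]

end

open SurjOperad

/-! ### Compatibility of the action with composition -/

section

variable {S : SSet.{u}}

theorem finRange_pairwise_le (n : ℕ) : (List.finRange n).Pairwise (· ≤ ·) :=
  (List.pairwise_lt_finRange n).imp le_of_lt

theorem mem_slots {β : Type*} {z : ℕ} {q : List (ℕ × β)} {v : β} :
    v ∈ slots z q ↔ (z, v) ∈ q := by
  simp [slots]

theorem pairwise_slots {β : Type*} [Preorder β] {z : ℕ} {q : List (ℕ × β)}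
    (hq : (q.map Prod.snd).Pairwise (· ≤ ·)) : (slots z q).Pairwise (· ≤ ·) :=
  hq.sublist (List.filter_sublist.map _)

theorem nodup_slots {β : Type*} {z : ℕ} {q : List (ℕ × β)} (hq : q.Nodup) : (slots z q).Nodup := by
  refine (hq.filter _).map_on ?_
  rintro ⟨i, v⟩ h ⟨i', v'⟩ h' hv
  simp only [List.mem_filter, decide_eq_true_eq] at h h'
  exact Prod.ext (h.2.trans h'.2.symm) hv

theorem nodup_of_slots {β : Type*} {z : ℕ} {q : List (ℕ × β)} (h1 : (slots z q).Nodup)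
    (h2 : (others z q).Nodup) : q.Nodup := by
  have hp := List.filter_append_perm (fun e : ℕ × β => decide (e.1 = z)) q
  rw [← hp.nodup_iff, List.nodup_append]
  refine ⟨h1.of_map, ?_, ?_⟩
  · simpa [others] using h2
  · rintro a ha b hb rfl
    simp at ha hb
    exact hb.2 ha.2

/-- The part of a path outside one column and a path in the rows of that column give the value of
the cochain that belongs to the second path. -/
theorem pathSum_slots {J K : Finset ℕ} {z : ℕ} (hz : z ∈ J) (hd : Disjoint (J.erase z) K)
    (hK : K.Nonempty) {u v : List ℕ} (hu : HasLetters J u) (hv : HasLetters K v)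
    (x : ℕ → RawCochains S) {N : ℕ} (σ : Simp S N) {q : List (ℕ × Fin (N + 1))}
    (hq : q ∈ latticePaths u (List.finRange (N + 1))) :
    (pathSum v (slots z q) fun r => evalVerts (J.erase z ∪ K) x σ (others z q + r)) =
      evalVerts J (Function.update x z (rawAct K (str v) x)) σ q := by
  have hsort : (slots z q).Pairwise (· ≤ ·) :=
    pairwise_slots (pairwise_of_mem_latticePaths (finRange_pairwise_le _) hq)
  have ho : ∀ e ∈ (others z q : Multiset (ℕ × Fin (N + 1))), e.1 ∈ J.erase z := by
    intro e he
    simp only [others, Multiset.mem_coe, List.mem_filter, decide_eq_true_eq] at he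
    exact Finset.mem_erase.2 ⟨he.2, ((hasLetters_iff.1 hu).1 _).1
      (mem_of_mem_latticePaths hq he.1).1⟩
  have hr : ∀ r ∈ latticePaths v (slots z q), ∀ e ∈ (r : Multiset (ℕ × Fin (N + 1))), e.1 ∈ K :=
    fun r hr e he => ((hasLetters_iff.1 hv).1 _).1 (mem_of_mem_latticePaths hr he).1
  rw [pathSum_congr fun r h => evalVerts_add hd x σ ho (hr r h)]
  -- Without repetitions the rows of column z are the vertices of a face, on which v acts. If a
  -- point is repeated, both sides vanish: a repetition outside z persists, and one in z gives equal
  -- neighbouring rows, over which every path r repeats a point.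
  by_cases hn : q.Nodup
  · have hon : (others z q : Multiset (ℕ × Fin (N + 1))).Nodup :=
      Multiset.coe_nodup.2 (hn.filter _)
    have hC : evalVerts (J.erase z) x σ (others z q : Multiset (ℕ × Fin (N + 1))) =
        ∏ j ∈ J.erase z, evalFace (x j) σ (verts (q : Multiset (ℕ × Fin (N + 1))) j) := by
      rw [evalVerts_of_nodup _ _ hon]
      refine Finset.prod_congr rfl fun j hj => ?_
      congr 1
      ext w
      simp [others, Finset.ne_of_mem_erase hj]
    rw [evalVerts_update _ _ (Multiset.coe_nodup.2 hn) hz, ← hC]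
    generalize evalVerts (J.erase z) x σ (others z q : Multiset (ℕ × Fin (N + 1))) = C
    have hmul : (pathSum v (slots z q) fun r => C * evalVerts K x σ r) =
        (pathSum v (slots z q) fun r => evalVerts K x σ r) * C := by
      rw [pathSum, pathSum, List.sum_map_mul_left, mul_comm]
    rw [hmul]
    congr 1
    have hT : verts (q : Multiset (ℕ × Fin (N + 1))) z = (slots z q).toFinset := by
      ext w
      simp [mem_slots]
    rw [hT]
    by_cases h0 : slots z q = []
    · rw [h0, List.toFinset_nil, evalFace_empty]
      cases v with
      | nil => simp
      | cons c v =>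
        obtain ⟨j, hj⟩ := hK
        rw [pathSum_cons_nil, evalVerts_eq_zero x σ hj (by simp), ite_self]
    · obtain ⟨k, e, he⟩ := exists_eq_map (s := (slots z q).toFinset) (by simpa using h0)
      have hs : slots z q = (List.finRange (k + 1)).map e := by
        refine List.Perm.eq_of_pairwise' hsort ?_ ?_
        · exact (List.pairwise_map.2 ((finRange_pairwise_le (k + 1)).imp fun h => e.monotone h))
        · rw [List.perm_ext_iff_of_nodup (nodup_slots hn)
            ((List.nodup_finRange _).map e.injective)]
          intro w
          rw [← List.mem_toFinset, he]
          simp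
      rw [evalFace_eq _ _ e he, hs, pathSum_evalVerts_map]
  · rw [evalVerts_of_not_nodup (s := (q : Multiset (ℕ × Fin (N + 1)))) _ _ (by simpa using hn)]
    refine (pathSum_congr fun r hr' => ?_).trans (pathSum_zero v (slots z q))
    by_cases hon : (others z q : Multiset (ℕ × Fin (N + 1))).Nodup
    · rw [evalVerts_of_not_nodup (s := (r : Multiset (ℕ × Fin (N + 1)))), mul_zero]
      intro h
      refine hn (nodup_of_slots ?_ hon)
      exact (pairwise_lt_of_nodup_path hsort hr' h).imp fun h => h.ne
    · rw [evalVerts_of_not_nodup _ _ hon, zero_mul]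

theorem rawAct_update_add {J : Finset ℕ} {z : ℕ} (hz : z ∈ J) (U : Strings)
    (x : ℕ → RawCochains S) (y y' : RawCochains S) :
    rawAct J U (Function.update x z (y + y')) =
      rawAct J U (Function.update x z y) + rawAct J U (Function.update x z y') := by
  unfold rawAct
  rw [← LinearMap.add_apply]
  congr 1
  refine hom_ext fun u => ?_
  rw [LinearMap.add_apply, lift_str, lift_str, lift_str]
  funext σ
  rw [Pi.add_apply, ← pathSum_add]
  refine pathSum_congr fun p _ => ?_
  by_cases hp : (p : Multiset (ℕ × Fin (σ.1 + 1))).Nodup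
  · rw [evalVerts_update _ _ hp hz, evalVerts_update _ _ hp hz, evalVerts_update _ _ hp hz,
      evalFace_add, add_mul]
  · simp only [evalVerts_of_not_nodup _ _ hp, add_zero]

/-- The action is compatible with the composition. -/
theorem rawAct_plug {J K : Finset ℕ} {z : ℕ} (hz : z ∈ J) (hd : Disjoint (J.erase z) K)
    (hK : K.Nonempty) {U V : Strings} (hU : U ∈ SJ J) (hV : V ∈ SJ K) (x : ℕ → RawCochains S) :
    rawAct (J.erase z ∪ K) (plug z U V) x =
      rawAct J U (Function.update x z (rawAct K V x)) := by
  refine SJ_induction (p := fun U => rawAct (J.erase z ∪ K) (plug z U V) x =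
      rawAct J U (Function.update x z (rawAct K V x))) ?_ ?_ ?_ hU
  · simp
  · intro U U' h h'
    rw [map_add, LinearMap.add_apply, rawAct_add, rawAct_add, h, h']
  intro u hu
  refine SJ_induction (p := fun V => rawAct (J.erase z ∪ K) (plug z (str u) V) x =
      rawAct J (str u) (Function.update x z (rawAct K V x))) ?_ ?_ ?_ hV
  · have := rawAct_update_add hz (str u) x 0 0
    rw [add_zero] at this
    rw [map_zero, rawAct_zero, rawAct_zero]
    exact (left_eq_add.1 this).symm
  · intro V V' h h'
    rw [map_add, rawAct_add, rawAct_add, rawAct_update_add hz, h, h']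
  intro v hv
  funext ⟨N, σ⟩
  rw [plug_str, rawAct, lift_strs, rawAct_str]
  change Pi.evalAddMonoidHom _ _ (List.sum _) = _
  rw [map_list_sum, List.map_map]
  refine (pathSum_plugL z u v (List.finRange (N + 1)) fun p =>
    evalVerts (J.erase z ∪ K) x σ p).trans ?_
  exact pathSum_congr fun q hq => pathSum_slots hz hd hK hu hv x σ hq

end

open SurjOperad

/-! ### Interval cuts and the lattice path action -/

section

variable {S : SSet.{u}} {N : ℕ}

theorem mem_cutPoints {u : List ℕ} {t : Fin (u.length + 1) → Fin (N + 1)} {e : ℕ × Fin (N + 1)} :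
    e ∈ cutPoints u t ↔
      ∃ r : Fin u.length, u.get r = e.1 ∧ t r.castSucc ≤ e.2 ∧ e.2 ≤ t r.succ := by
  simp only [cutPoints, Multiset.mem_sum, Finset.mem_univ, true_and, Multiset.mem_map,
    Finset.mem_val, Finset.mem_Icc]
  refine exists_congr fun r => ?_
  constructor
  · rintro ⟨v, hv, rfl⟩
    exact ⟨rfl, hv⟩
  · rintro ⟨h, hv⟩
    exact ⟨e.2, hv, by rw [h]⟩

theorem verts_cutPoints (u : List ℕ) (t : Fin (u.length + 1) → Fin (N + 1)) (j : ℕ) :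
    verts (cutPoints u t) j = letterVerts u t j := by
  ext v
  simp [mem_cutPoints, letterVerts]

theorem count_cutPoints (u : List ℕ) (t : Fin (u.length + 1) → Fin (N + 1))
    (e : ℕ × Fin (N + 1)) : (cutPoints u t).count e =
      (Finset.univ.filter fun r : Fin u.length =>
        u.get r = e.1 ∧ t r.castSucc ≤ e.2 ∧ e.2 ≤ t r.succ).card := by
  rw [cutPoints, Multiset.count_sum', Finset.card_filter]
  refine Finset.sum_congr rfl fun r _ => ?_
  have hn : ((Finset.Icc (t r.castSucc) (t r.succ)).val.map (u.get r, ·)).Nodup :=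
    (Finset.nodup _).map fun v w h => (Prod.mk.inj h).2
  rw [Multiset.count_eq_of_nodup hn]
  refine if_congr ?_ rfl rfl
  simp only [Multiset.mem_map, Finset.mem_val, Finset.mem_Icc]
  constructor
  · rintro ⟨v, hv, rfl⟩
    exact ⟨rfl, hv⟩
  · rintro ⟨h, hv⟩
    exact ⟨e.2, hv, by rw [h]⟩

/-- A repeated point is a vertex common to two intervals of one letter. As t is monotone, only the
end of the earlier interval and the start of the later one have to be compared. -/
theorem nodup_cutPoints {u : List ℕ} {t : Fin (u.length + 1) → Fin (N + 1)} (ht : Monotone t) :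
    (cutPoints u t).Nodup ↔
      ∀ r r' : Fin u.length, r < r' → u.get r = u.get r' → t r.succ < t r'.castSucc := by
  rw [Multiset.nodup_iff_count_le_one]
  simp only [count_cutPoints, Finset.card_le_one, Finset.mem_filter, Finset.mem_univ, true_and]
  constructor
  · intro h r r' hr hu
    by_contra hlt
    have hle : t r.succ ≤ t r'.castSucc := ht (by
      rw [Fin.le_def]; simp only [Fin.val_succ, Fin.val_castSucc]; exact hr)
    have h1 := ht (Fin.castSucc_lt_succ (i := r)).le
    have h2 := ht (Fin.castSucc_lt_succ (i := r')).le
    refine hr.ne (h (u.get r, t r.succ) r ⟨rfl, h1, le_rfl⟩ r' ⟨hu.symm, ?_, hle.trans h2⟩)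
    exact not_lt.1 hlt
  · rintro h e r ⟨h1, h2, h3⟩ r' ⟨h1', h2', h3'⟩
    rcases lt_trichotomy r r' with hr | hr | hr
    · exact absurd (h r r' hr (h1.trans h1'.symm)) (not_lt.2 (h2'.trans h3))
    · exact hr
    · exact absurd (h r' r hr (h1'.trans h1.symm)) (not_lt.2 (h2.trans h3'))

/-- Monotone cuts are lattice paths, and the disjointness in `IsCut` is the absence of repetitions
that `evalVerts` tests. -/
theorem actStr_val {n : ℕ} (hn : 1 ≤ n) {u : List ℕ} (hu : IsSurj n u) (x : Fin n → Cochains S)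
    {y : ℕ → RawCochains S} (hy : ∀ j : Fin n, y (j + 1) = (x j).1) (σ : Simp S N) :
    (actStr n u x).1 ⟨N, σ⟩ =
      pathSum u (List.finRange (N + 1)) fun p => evalVerts (Finset.Icc 1 n) y σ p := by
  classical
  have hne : u ≠ [] := by
    rintro rfl
    simpa using (hu.1 1).2 ⟨le_rfl, hn⟩
  have h := pathSumFrom_eq_sum u (0 : Fin (N + 1)) (evalVerts (Finset.Icc 1 n) y σ)
  rw [pathSumFrom, if_neg hne, Fin.val_zero, List.drop_zero] at h
  rw [h, actStr]
  dsimp only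
  rw [if_pos hu]
  refine Finset.sum_congr rfl fun t _ => ?_
  unfold IsCut
  by_cases ht : Monotone t ∧ t 0 = 0 ∧ t (Fin.last _) = Fin.last N
  · refine Eq.trans ?_ (if_pos ht).symm
    have hiff := nodup_cutPoints (u := u) ht.1
    by_cases hd : (cutPoints u t).Nodup
    · refine (if_pos ⟨ht.1, ht.2.1, ht.2.2, hiff.1 hd⟩).trans ?_
      rw [evalVerts_of_nodup _ _ hd]
      simp only [verts_cutPoints]
      rw [← Finset.Ico_add_one_right_eq_Icc, Finset.prod_Ico_eq_prod_range, Finset.prod_range]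
      refine Finset.prod_congr rfl fun j _ => ?_
      rw [Nat.add_comm 1, hy]
    · rw [evalVerts_of_not_nodup _ _ hd]
      exact if_neg fun h => hd (hiff.2 h.2.2.2)
  · exact (if_neg fun h => ht ⟨h.1, h.2.1, h.2.2.1⟩).trans (if_neg ht).symm

/-- The action on cochains in terms of lattice paths. -/
theorem act_val {n : ℕ} (hn : 1 ≤ n) {U : Strings} (hU : U ∈ SJ (Finset.Icc 1 n))
    (x : Fin n → Cochains S) {y : ℕ → RawCochains S} (hy : ∀ j : Fin n, y (j + 1) = (x j).1) :
    (act n U x).1 = rawAct (Finset.Icc 1 n) U y := by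
  have h : (act n U x).1 = ((Cochains S).subtype ∘ₗ lift fun u => actStr n u x) U := rfl
  rw [h, rawAct]
  refine SJ_ext (fun u hu => ?_) hU
  rw [LinearMap.comp_apply, lift_str, lift_str]
  funext ⟨N, σ⟩
  exact actStr_val hn (isSurj_iff.2 hu) x hy σ

/-- The cup product of functions. -/
noncomputable def rawCup (x y : RawCochains S) : RawCochains S := fun σ =>
  ∑ i : Fin (σ.1 + 1), evalFace x σ.2 (Finset.Iic i) * evalFace y σ.2 (Finset.Ici i)

theorem cup_val (x y : Cochains S) : (cup S x y).1 = rawCup x.1 y.1 := rfl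

theorem evalVerts_singleton (a : ℕ) (x : ℕ → RawCochains S) (σ : Simp S N)
    (s : Finset (Fin (N + 1))) :
    evalVerts {a} x σ (s.val.map (a, ·)) = evalFace (x a) σ s := by
  rw [evalVerts_of_nodup _ _ (s.nodup.map fun v w h => (Prod.mk.inj h).2), Finset.prod_singleton]
  congr 1
  ext v
  simp

theorem rawAct_pair {a b : ℕ} (h : a ≠ b) (x : ℕ → RawCochains S) :
    rawAct {a, b} (str [a, b]) x = rawCup (x a) (x b) := by
  funext ⟨N, σ⟩
  have h1 := pathSumFrom_cons a [b] (0 : Fin (N + 1)) (evalVerts {a, b} x σ)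
  rw [pathSumFrom, if_neg (by simp), Fin.val_zero, List.drop_zero] at h1
  rw [rawAct_str, h1]
  refine Finset.sum_congr rfl fun t _ => ?_
  rw [if_pos (Fin.zero_le _), pathSumFrom_cons, Finset.sum_eq_single (Fin.last N), if_pos (Fin.le_last _),
    pathSumFrom, if_pos rfl, if_pos rfl, add_zero, show ({a, b} : Finset ℕ) = {a} ∪ {b} from rfl,
    evalVerts_add (by simpa using h), evalVerts_singleton, evalVerts_singleton]
  · congr 2
  · intro e he
    obtain ⟨v, -, rfl⟩ := Multiset.mem_map.1 he
    simp
  · intro e he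
    obtain ⟨v, -, rfl⟩ := Multiset.mem_map.1 he
    simp
  · intro t' _ ht'
    rw [pathSumFrom, if_pos rfl, if_neg ht', ite_self]
  · simp

theorem rawAct_single (a : ℕ) (x : ℕ → RawCochains S) : rawAct {a} (str [a]) x = x a := by
  funext ⟨N, σ⟩
  have h1 := pathSumFrom_cons a [] (0 : Fin (N + 1)) (evalVerts {a} x σ)
  rw [pathSumFrom, if_neg (by simp), Fin.val_zero, List.drop_zero] at h1
  rw [rawAct_str, h1, Finset.sum_eq_single (Fin.last N), if_pos (Fin.zero_le _), pathSumFrom,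
    if_pos rfl, if_pos rfl, add_zero, evalVerts_singleton, ← evalFace_univ (x a)]
  · congr 1
    ext
    simp [Fin.le_last]
  · intro t' _ ht'
    rw [pathSumFrom, if_pos rfl, if_neg ht', ite_self]
  · simp

theorem act_mu (x y : Cochains S) : act 2 mu ![x, y] = cup S x y := by
  apply Subtype.ext
  have h : ∀ j : Fin 2, (fun j => if j = 1 then x.1 else y.1) ((j : ℕ) + 1) = (![x, y] j).1 := by
    rw [Fin.forall_fin_two]
    exact ⟨rfl, rfl⟩
  rw [act_val (y := fun j => if j = 1 then x.1 else y.1) (by norm_num) mu_mem _ h, cup_val]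
  exact rawAct_pair (a := 1) (b := 2) (by norm_num) _

end

end SSetCochains

namespace SurjOperad

/-- The step of a lattice path between two neighbouring columns lies in one row. -/
theorem exists_sublist_of_mem_latticePaths' {α β : Type*} {u₁ u₂ : List α} {vs : List β} {a a' : α}
    {p : List (α × β)} (hp : p ∈ latticePaths (u₁ ++ a :: a' :: u₂) vs) :
    ∃ b, [(a, b), (a', b)].Sublist p := by
  induction vs generalizing u₁ p with
  | nil =>
    cases u₁ <;> simp [latticePaths] at hp
  | cons b vs ih =>
    induction u₁ generalizing p with
    | nil =>
      simp only [List.nil_append] at hp ih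
      rw [latticePaths] at hp
      obtain ⟨p, hp', rfl⟩ := List.mem_map.1 hp
      rcases List.mem_append.1 hp' with hp | hp
      · rw [latticePaths] at hp
        obtain ⟨p, -, rfl⟩ := List.mem_map.1 hp
        exact ⟨b, by simp⟩
      · obtain ⟨c, hc⟩ := ih (u₁ := []) hp
        exact ⟨c, hc.cons _⟩
    | cons d u₁ ihu =>
      rw [List.cons_append, latticePaths] at hp
      obtain ⟨p, hp', rfl⟩ := List.mem_map.1 hp
      rcases List.mem_append.1 hp' with hp | hp
      · obtain ⟨c, hc⟩ := ihu hp
        exact ⟨c, hc.cons _⟩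
      · obtain ⟨c, hc⟩ := ih (u₁ := d :: u₁) hp
        exact ⟨c, hc.cons _⟩

end SurjOperad

namespace SSetCochains

open SurjOperad

/-! ### Transfer of the operad differential and of composites -/

section

variable {S : SSet.{u}}

/-- A missing letter leaves an empty face for its input. At equal neighbours the path passes
horizontally from one column to the next and meets the same point twice. -/
theorem rawAct_str_eq_zero {J : Finset ℕ} {u : List ℕ} (hu : ∀ a ∈ u, a ∈ J)
    (h : ¬ HasLetters J u) (x : ℕ → RawCochains S) : rawAct J (str u) x = 0 := by
  funext ⟨N, σ⟩
  rw [rawAct_str]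
  refine (pathSum_congr fun p hp => ?_).trans (pathSum_zero u _)
  by_cases hc : u.IsChain (· ≠ ·)
  · obtain ⟨j, hj, hju⟩ : ∃ j ∈ J, j ∉ u := by
      by_contra hno
      push Not at hno
      exact h (hasLetters_iff.2 ⟨fun a => ⟨hu a, hno a⟩, hc⟩)
    refine evalVerts_eq_zero x σ hj fun e he => ?_
    rintro rfl
    exact hju (mem_of_mem_latticePaths hp he).1
  · rw [List.isChain_iff_forall_rel_of_append_cons_cons] at hc
    push Not at hc
    obtain ⟨a, b, u₁, u₂, rfl, hab⟩ := hc
    subst hab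
    obtain ⟨v, hv⟩ := exists_sublist_of_mem_latticePaths' hp
    refine evalVerts_of_not_nodup _ _ fun hn => ?_
    have := (Multiset.coe_nodup.1 hn).sublist hv
    simp at this

/-- The projection in `bdry` discards only strings that act by zero. -/
theorem rawAct_bdry {n : ℕ} {U : Strings} (hU : U ∈ SJ (Finset.Icc 1 n))
    (x : ℕ → RawCochains S) :
    rawAct (Finset.Icc 1 n) (bdry n U) x = rawAct (Finset.Icc 1 n) (dd U) x := by
  rw [bdry_eq_surjProj]
  refine SJ_induction (p := fun U => rawAct (Finset.Icc 1 n) (surjProj n (dd U)) x =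
    rawAct (Finset.Icc 1 n) (dd U) x) (by simp) ?_ ?_ hU
  · intro U V h h'
    rw [map_add, map_add, rawAct_add, rawAct_add, h, h']
  · intro u hu
    rw [dd_str]
    have : ∀ l : List (List ℕ), (∀ w ∈ l, ∀ a ∈ w, a ∈ Finset.Icc 1 n) →
        rawAct (Finset.Icc 1 n) (surjProj n (strs l)) x = rawAct (Finset.Icc 1 n) (strs l) x := by
      intro l hl
      induction l with
      | nil => simp
      | cons w l ih =>
        rw [strs_cons, map_add, rawAct_add, rawAct_add, ih fun w hw => hl w (by simp [hw])]
        congr 1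
        rw [surjProj, lift_str]
        split_ifs with h
        · rfl
        · rw [rawAct_str_eq_zero (hl w (by simp)) (by rwa [← isSurj_iff]), rawAct_zero]
    refine this _ fun w hw a ha => ?_
    rw [dels_eq, List.mem_map] at hw
    obtain ⟨j, -, rfl⟩ := hw
    exact ((hasLetters_iff.1 hu).1 _).1 (List.mem_of_mem_eraseIdx ha)

theorem dFun_rawAct_Icc {n : ℕ} (hn : 1 ≤ n) {U : Strings} (hU : U ∈ SJ (Finset.Icc 1 n))
    (x : ℕ → RawCochains S) :
    dFun (rawAct (Finset.Icc 1 n) U x) +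
        ∑ j ∈ Finset.Icc 1 n, rawAct (Finset.Icc 1 n) U (Function.update x j (dFun (x j))) =
      rawAct (Finset.Icc 1 n) (bdry n U) x := by
  rw [rawAct_bdry hU, dFun_rawAct ⟨1, by simpa using hn⟩ hU]

/-- The inputs of `U` in `U ∘ᵢ V`, where `V` has arity `m` and `y` is its output. -/
def insertInput (i m : ℕ) (y : RawCochains S) (x : ℕ → RawCochains S) : ℕ → RawCochains S :=
  fun j => if j < i then x j else if j = i then y else x (j + m - 1)

theorem getD_range' {s n k : ℕ} (h : k < n) : (List.range' s n).getD k 0 = s + k := by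
  simp [List.getD_eq_getElem?_getD, h]

/-- This is `rawAct_plug` after the inputs have been given names, with i + m + k + 1 (for the
shifted i) as a fresh name for the slot. -/
theorem rawAct_circ {n m i : ℕ} (hi : 1 ≤ i) (hin : i ≤ n) (hm : 1 ≤ m) {U V : Strings}
    (hU : U ∈ SJ (Finset.Icc 1 n)) (hV : V ∈ SJ (Finset.Icc 1 m)) (x : ℕ → RawCochains S) :
    rawAct (Finset.Icc 1 (n + m - 1)) (circ i m U V) x = rawAct (Finset.Icc 1 n) U
      (insertInput i m (rawAct (Finset.Icc 1 m) V fun j => x (j + i - 1)) x) := by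
  obtain ⟨i, rfl⟩ : ∃ i', i = i' + 1 := ⟨i - 1, by omega⟩
  obtain ⟨k, rfl⟩ : ∃ k, n = i + 1 + k := ⟨n - (i + 1), by omega⟩
  have hmem := circ_mem hi hin hm hU hV
  have h := relabel_circ (l₁ := List.range' 1 i) (l := List.range' (i + 1) m)
    (l₃ := List.range' (i + 1 + m) k) (z := i + m + k + 1) (by simpa using hU) (by simpa using hV)
    (by simp; omega) (by simp; omega) (by simp; omega)
  have hr : List.range' 1 i ++ List.range' (i + 1) m ++ List.range' (i + 1 + m) k =
      List.range' 1 (i + 1 + k + m - 1) := by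
    rw [Nat.add_comm i 1, List.range'_append_1, show 1 + i + m = 1 + (i + m) by omega,
      List.range'_append_1]
    congr 1; omega
  rw [List.length_range', List.length_range', hr, relabel_range' hmem] at h
  have hl : (List.range' (i + 1) m).Nodup := List.nodup_range'
  have hl' : (List.range' 1 i ++ (i + m + k + 1) :: List.range' (i + 1 + m) k).Nodup := by
    simp only [List.nodup_append, List.nodup_cons, List.mem_range'_1, List.mem_cons]
    exact ⟨List.nodup_range', ⟨by omega, List.nodup_range'⟩, by intros; omega⟩
  have hlen : (List.range' 1 i ++ (i + m + k + 1) :: List.range' (i + 1 + m) k).length =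
      i + 1 + k := by simp; omega
  have hJ : ((List.range' 1 i ++ (i + m + k + 1) :: List.range' (i + 1 + m) k).toFinset.erase
      (i + m + k + 1)) ∪ (List.range' (i + 1) m).toFinset = Finset.Icc 1 (i + 1 + k + m - 1) := by
    ext a
    simp
    omega
  rw [h, ← hJ, rawAct_plug (by simp) _ _ (relabel_mem hl' (by rwa [hlen]))
    (relabel_mem hl (by simpa using hV)), rawAct_relabel hl' (by rwa [hlen]),
    rawAct_relabel hl (by simpa using hV), hlen, List.length_range']
  · refine rawAct_congr (fun j hj => ?_) U
    rw [Finset.mem_Icc] at hj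
    unfold insertInput
    split_ifs with h1 h2
    · rw [getD_append_left (by simp; omega), getD_range' (by omega),
        Function.update_of_ne (by omega)]
      congr 1; omega
    · subst h2
      rw [getD_append_right (by simp), List.length_range', Nat.add_sub_cancel, Nat.sub_self,
        List.getD_cons_zero, Function.update_self]
      refine rawAct_congr (fun r hr => ?_) V
      rw [Finset.mem_Icc] at hr
      rw [getD_range' (by omega)]
      congr 1; omega
    · obtain ⟨r, rfl⟩ : ∃ r, j = i + 1 + (r + 1) := ⟨j - (i + 2), by omega⟩
      rw [getD_append_right (by simp; omega), List.length_range',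
        show i + 1 + (r + 1) - 1 - i = r + 1 by omega, List.getD_cons_succ,
        getD_range' (by omega), Function.update_of_ne (by omega)]
      congr 1; omega
  · rw [Finset.disjoint_left]
    intro a
    simp
    omega
  · refine ⟨i + 1, ?_⟩
    simp; omega

theorem rawAct_idOp (x : ℕ → RawCochains S) : rawAct (Finset.Icc 1 1) idOp x = x 1 :=
  rawAct_single 1 x

theorem rawAct_mu (x : ℕ → RawCochains S) :
    rawAct (Finset.Icc 1 2) mu x = rawCup (x 1) (x 2) :=
  rawAct_pair (a := 1) (b := 2) (by norm_num) x

/-- The values of operations on consecutive blocks of inputs. -/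
noncomputable def blockVals : List (Strings × List ℕ) → (ℕ → RawCochains S) → List (RawCochains S)
  | [], _ => []
  | (V, l) :: L, x =>
    rawAct (Finset.Icc 1 l.length) V x :: blockVals L fun j => x (j + l.length)

theorem blockVals_congr : ∀ (L : List (Strings × List ℕ)) {x y : ℕ → RawCochains S},
    (∀ j, 1 ≤ j → x j = y j) → blockVals L x = blockVals L y
  | [], _, _, _ => rfl
  | (V, l) :: L, x, y, h => by
    rw [blockVals, blockVals, blockVals_congr L fun j hj => h _ (by omega),
      rawAct_congr fun j hj => h j (Finset.mem_Icc.1 hj).1]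

/-- The first i inputs pass unchanged, and the others receive the values on consecutive blocks. Each
composition replaces one block by a single input, which explains the shifts. -/
theorem rawAct_compAll : ∀ {L : List (Strings × List ℕ)} {i : ℕ} {U : Strings}, GoodInputs L →
    U ∈ SJ (Finset.Icc 1 (i + L.length)) → ∀ x : ℕ → RawCochains S,
    rawAct (Finset.Icc 1 (i + (L.flatMap Prod.snd).length)) (compAll U (i + 1) L) x =
      rawAct (Finset.Icc 1 (i + L.length)) U fun j =>
        if j ≤ i then x j else (blockVals L fun r => x (r + i)).getD (j - i - 1) 0
  | [], i, U, _, hU, x => by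
    simp only [List.flatMap_nil, List.length_nil, Nat.add_zero, compAll]
    exact rawAct_congr (fun j hj => (if_pos (Finset.mem_Icc.1 hj).2).symm) U
  | (V, l) :: L, i, U, hL, hU, x => by
    have h1 := hL (V, l) (by simp)
    have hpos := List.length_pos_iff.2 h1.2
    have hL' : GoodInputs L := fun p hp => hL p (by simp [hp])
    have hU' : U ∈ SJ (Finset.Icc 1 (i + 1 + L.length)) := by
      rw [List.length_cons] at hU; convert hU using 3; omega
    have h := rawAct_circ (i := i + 1) (by omega) (by omega) hpos (compAll_mem hL' hU') h1.1 x
    rw [compAll, List.flatMap_cons, List.length_append]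
    rw [show i + 1 + (L.flatMap Prod.snd).length + l.length - 1 =
      i + (l.length + (L.flatMap Prod.snd).length) by omega] at h
    rw [h, rawAct_compAll hL' hU', List.length_cons, show i + (L.length + 1) = i + 1 + L.length by omega]
    refine rawAct_congr (fun j hj => ?_) U
    have hb : (blockVals L fun r => insertInput (i + 1) l.length
        (rawAct (Finset.Icc 1 l.length) V fun j => x (j + (i + 1) - 1)) x (r + (i + 1))) =
        blockVals L fun r => x (r + l.length + i) := by
      refine blockVals_congr L fun r hr => ?_
      rw [insertInput, if_neg (by omega), if_neg (by omega)]
      congr 1; omega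
    rw [hb, blockVals]
    rcases lt_trichotomy j (i + 1) with hlt | rfl | hlt
    · rw [if_pos (by omega), if_pos (by omega), insertInput, if_pos hlt]
    · rw [if_pos le_rfl, if_neg (by omega), insertInput, if_neg (lt_irrefl _), if_pos rfl,
        show i + 1 - i - 1 = 0 by omega, List.getD_cons_zero]
      refine rawAct_congr (fun r hr => ?_) V
      congr 1
    · rw [if_neg (by omega), if_neg (by omega), show j - i - 1 = (j - (i + 1) - 1) + 1 by omega,
        List.getD_cons_succ]

theorem blockVals_flatMap : ∀ (L : List (Strings × List ℕ)) (x : ℕ → RawCochains S),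
    (blockVals L fun j => x ((L.flatMap Prod.snd).getD (j - 1) 0)) =
      L.map fun p => rawAct (Finset.Icc 1 p.2.length) p.1 fun j => x (p.2.getD (j - 1) 0)
  | [], _ => rfl
  | (V, l) :: L, x => by
    rw [blockVals, List.map_cons, ← blockVals_flatMap L x, List.flatMap_cons]
    dsimp only
    congr 1
    · refine rawAct_congr (fun j hj => ?_) V
      rw [Finset.mem_Icc] at hj
      rw [getD_append_left (by omega)]
    · refine blockVals_congr L fun j hj => ?_
      rw [getD_append_right (by omega)]
      congr 2
      omega

theorem rawAct_subst {L : List (Strings × List ℕ)} {U : Strings} (hL : GoodInputs L)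
    (hn : (L.flatMap Prod.snd).Nodup) (hU : U ∈ SJ (Finset.Icc 1 L.length))
    (x : ℕ → RawCochains S) :
    rawAct (L.flatMap Prod.snd).toFinset (subst U L) x =
      rawAct (Finset.Icc 1 L.length) U fun j => (L.map fun p =>
        rawAct (Finset.Icc 1 p.2.length) p.1 fun j => x (p.2.getD (j - 1) 0)).getD (j - 1) 0 := by
  have hc := compAll_mem (i := 0) hL (by rwa [Nat.zero_add])
  rw [Nat.zero_add, Nat.zero_add] at hc
  have h := rawAct_compAll (i := 0) hL (by rwa [Nat.zero_add])
    fun j => x ((L.flatMap Prod.snd).getD (j - 1) 0)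
  rw [Nat.zero_add, Nat.zero_add, Nat.zero_add] at h
  rw [subst, rawAct_relabel hn hc, h]
  refine rawAct_congr (fun j hj => ?_) U
  rw [Finset.mem_Icc] at hj
  rw [if_neg (by omega), Nat.sub_zero]
  simp only [Nat.add_zero]
  rw [blockVals_flatMap]

/-- Substitution into (1,2), whose action is the cup product of its two inputs. -/
theorem rawAct_prodOp {U V : Strings} {l l' : List ℕ} (hU : U ∈ SJ (Finset.Icc 1 l.length))
    (hV : V ∈ SJ (Finset.Icc 1 l'.length)) (hl : l ≠ []) (hl' : l' ≠ []) (hn : (l ++ l').Nodup)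
    (x : ℕ → RawCochains S) :
    rawAct (l ++ l').toFinset (prodOp U l V l') x =
      rawCup (rawAct (Finset.Icc 1 l.length) U fun j => x (l.getD (j - 1) 0))
        (rawAct (Finset.Icc 1 l'.length) V fun j => x (l'.getD (j - 1) 0)) := by
  have hL : GoodInputs [(U, l), (V, l')] := by
    intro p hp
    simp only [List.mem_cons, List.not_mem_nil, or_false] at hp
    rcases hp with rfl | rfl
    · exact ⟨hU, hl⟩
    · exact ⟨hV, hl'⟩
  have hf : [(U, l), (V, l')].flatMap Prod.snd = l ++ l' := by simp
  have h := rawAct_subst hL (by rwa [hf]) mu_mem x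
  rw [hf] at h
  exact h.trans (rawAct_mu _)

end

open SurjOperad

/-! ### The differential graded algebra of cochains -/

section

variable {S : SSet.{u}}

theorem circ_mu_mu : circ 1 2 mu mu = circ 2 2 mu mu := by
  have h : compStr 1 2 [1, 2] [1, 2] = compStr 2 2 [1, 2] [1, 2] := by decide
  simp [circ, mu, str, h]

theorem bdry_mu : bdry 2 mu = 0 := by
  have h1 : ¬ IsSurj 2 [2] := by decide
  have h2 : ¬ IsSurj 2 [1] := by decide
  rw [bdry, mu, str, Finsupp.sum_single_index]
  · simp [Finset.sum_range_succ, h1, h2]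
  · simp

/-- The sequence with entries `x, y, z, z, …`, starting with number `1`. -/
def seqOf (x y z : RawCochains S) : ℕ → RawCochains S := fun j =>
  if j = 1 then x else if j = 2 then y else z

/-- Both composites of (1,2) with itself are (1,2,3). -/
theorem rawCup_assoc (x y z : RawCochains S) :
    rawCup (rawCup x y) z = rawCup x (rawCup y z) := by
  have h1 := rawAct_circ (i := 1) le_rfl (by norm_num) (by norm_num) mu_mem mu_mem (seqOf x y z)
  have h2 := rawAct_circ (i := 2) (by norm_num) le_rfl (by norm_num) mu_mem mu_mem (seqOf x y z)
  rw [← circ_mu_mu, h1, rawAct_mu, rawAct_mu, rawAct_mu, rawAct_mu] at h2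
  exact h2

/-- The operation (1,2) is a cycle, because deleting either letter destroys surjectivity. -/
theorem dFun_rawCup (x y : RawCochains S) :
    dFun (rawCup x y) = rawCup (dFun x) y + rawCup x (dFun y) := by
  have h := dFun_rawAct_Icc (n := 2) (by norm_num) mu_mem (seqOf x y y)
  rw [bdry_mu, rawAct_zero, show Finset.Icc 1 2 = ({1, 2} : Finset ℕ) by rfl,
    Finset.sum_pair (by norm_num)] at h
  simp only [mu, rawAct_pair (show 1 ≠ 2 by norm_num)] at h
  simpa [seqOf] using eq_of_add_eq_zero h

/-- Omitting v and then w leaves the same face as the reverse order, so the terms cancel in pairs.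
-/
theorem dFun_dFun (x : RawCochains S) : dFun (dFun x) = 0 := by
  funext ⟨N, σ⟩
  rw [← evalFace_univ (dFun (dFun x)), evalFace_dFun]
  simp only [evalFace_dFun]
  rw [Finset.sum_sigma']
  refine Finset.sum_involution (fun p _ => ⟨p.2, p.1⟩) ?_ ?_ ?_ ?_
  · rintro ⟨v, w⟩ _
    rw [Finset.erase_right_comm]
    exact SurjOperad.add_self_eq_zero _
  · rintro ⟨v, w⟩ h _ h'
    simp only [Finset.mem_sigma, Finset.mem_erase] at h
    simp only [Sigma.mk.injEq] at h'
    exact h.2.1 h'.1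
  · rintro ⟨v, w⟩ h
    simp only [Finset.mem_sigma, Finset.mem_erase, Finset.mem_univ, and_true, true_and] at h ⊢
    exact fun h' => h h'.symm
  · intros; rfl

theorem evalFace_one (σ : Simp S N) (s : Finset (Fin (N + 1))) :
    evalFace (one S).1 σ s = if s.card = 1 then 1 else 0 := by
  unfold evalFace one
  split_ifs with h1 h2
  · exact if_pos (show s.card - 1 = 0 by omega)
  · have := h1.card_pos
    exact if_neg (show s.card - 1 ≠ 0 by omega)
  · exact absurd (Finset.card_pos.1 (by omega)) h1
  · rfl

theorem rawCup_one_left (x : RawCochains S) : rawCup (one S).1 x = x := by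
  funext ⟨N, σ⟩
  rw [rawCup, Finset.sum_eq_single 0, evalFace_one]
  · rw [if_pos (by simp), one_mul, ← evalFace_univ x]
    congr 1
    ext; simp
  · intro i _ hi
    rw [evalFace_one, if_neg, zero_mul]
    simp only [Fin.card_Iic]
    intro h
    exact hi (Fin.ext (by simpa using h))
  · simp

theorem rawCup_one_right (x : RawCochains S) : rawCup x (one S).1 = x := by
  funext ⟨N, σ⟩
  rw [rawCup, Finset.sum_eq_single (Fin.last N), evalFace_one]
  · rw [if_pos (by simp), mul_one, ← evalFace_univ x]
    congr 1
    ext; simp [Fin.le_last]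
  · intro i _ hi
    rw [evalFace_one, if_neg, mul_zero]
    simp only [Fin.card_Ici]
    intro h
    exact hi (Fin.ext (by simp; omega))
  · simp

theorem coe_directSum (f : DirectSum ℤ fun n => deg S n) (m : ℕ) (σ : Simp S m) :
    (DirectSum.coeAddMonoidHom (deg S) f).1 ⟨m, σ⟩ = (f m).1.1 ⟨m, σ⟩ := by
  induction f using DirectSum.induction_on with
  | zero => simp
  | of n x =>
    rw [DirectSum.coeAddMonoidHom_of]
    by_cases h : (m : ℤ) = n
    · subst h
      rw [DirectSum.of_eq_same]
    · rw [DirectSum.of_eq_of_ne _ _ _ h, x.2 m σ h]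
      rfl
  | add f g hf hg =>
    rw [map_add, DirectSum.add_apply]
    exact congrArg₂ (· + ·) hf hg

/-- A cochain vanishes in all large dimensions, so it is the finite sum of its restrictions to
single dimensions. -/
theorem deg_isInternal : DirectSum.IsInternal (deg S) := by
  constructor
  · rw [injective_iff_map_eq_zero]
    intro f hf
    refine DFinsupp.ext fun n => Subtype.ext (Subtype.ext (funext ?_))
    rintro ⟨m, σ⟩
    by_cases h : (m : ℤ) = n
    · subst h
      have := coe_directSum f m σ
      rw [hf] at this
      exact this.symm
    · exact (f n).2 m σ h
  · intro x
    obtain ⟨B, hB⟩ := x.2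
    let y (n : ℕ) : deg S (n : ℤ) :=
      ⟨⟨fun σ => if σ.1 = n then x.1 σ else 0, n, fun m hm σ => if_neg hm.ne'⟩,
        fun m σ h => if_neg (by simpa using h)⟩
    refine ⟨∑ n ∈ Finset.range (B + 1), DirectSum.of (fun n => deg S n) (n : ℤ) (y n), ?_⟩
    rw [map_sum]
    refine Subtype.ext (funext ?_)
    rintro ⟨m, σ⟩
    simp only [DirectSum.coeAddMonoidHom_of, AddSubmonoidClass.coe_finsetSum, Finset.sum_apply]
    by_cases h : B < m
    · rw [hB m h]
      refine Finset.sum_eq_zero fun n hn => if_neg ?_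
      simp at hn ⊢
      omega
    · rw [Finset.sum_eq_single m]
      · exact if_pos rfl
      · intro n _ hn
        exact if_neg (Ne.symm hn)
      · intro h'
        simp at h'
        omega

theorem evalFace_eq_zero_of_mem_deg {s : ℤ} {x : Cochains S} (hx : x ∈ deg S s) {N : ℕ}
    (σ : Simp S N) (v : Finset (Fin (N + 1))) (h : (v.card : ℤ) ≠ s + 1) :
    evalFace x.1 σ v = 0 := by
  unfold evalFace
  split_ifs with hv
  · refine hx _ _ ?_
    have := hv.card_pos
    omega
  · rfl

theorem isDGAlgebra : IsDGAlgebra (deg S) (d S) (cup S) (one S) where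
  isInternal := deg_isInternal
  d_mem n x hx := by
    rintro (_ | m) σ h
    · rfl
    · change ∑ i : Fin (m + 2), x.1 ⟨m, S.δ i σ⟩ = 0
      refine Finset.sum_eq_zero fun i _ => hx _ _ fun h' => h ?_
      push_cast
      rw [h']
  d_d x := Subtype.ext (dFun_dFun x.1)
  one_mem m σ h := if_neg (by simpa using h)
  mul_mem m n x hx y hy N σ h := by
    change ∑ i : Fin (N + 1), evalFace x.1 σ (Finset.Iic i) * evalFace y.1 σ (Finset.Ici i) = 0
    refine Finset.sum_eq_zero fun i _ => ?_
    by_cases hi : (i : ℤ) = m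
    · rw [evalFace_eq_zero_of_mem_deg hy, mul_zero]
      simp only [Fin.card_Ici]
      omega
    · rw [evalFace_eq_zero_of_mem_deg hx, zero_mul]
      simp only [Fin.card_Iic]
      omega
  one_mul x := Subtype.ext (rawCup_one_left x.1)
  mul_one x := Subtype.ext (rawCup_one_right x.1)
  mul_assoc x y z := Subtype.ext (rawCup_assoc x.1 y.1 z.1)
  leibniz x y := Subtype.ext (dFun_rawCup x.1 y.1)

end

open SurjOperad

/-! ### Multilinearity, degrees and normalization -/

section

variable {S : SSet.{u}}

theorem act_zero (n : ℕ) (x : Fin n → Cochains S) : act n 0 x = 0 := Finsupp.sum_zero_index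

theorem act_apply (n : ℕ) (U : Strings) (x : Fin n → Cochains S) (σ : Σ n : ℕ, Simp S n) :
    (act n U x).1 σ = lift (fun u => (actStr n u x).1 σ) U := by
  have h : (act n U x).1 σ =
    (LinearMap.proj σ ∘ₗ (Cochains S).subtype ∘ₗ lift fun u => actStr n u x) U := rfl
  rw [h]
  congr 1
  exact hom_ext fun u => by simp

theorem exists_actStr_multilinear (n : ℕ) (u : List ℕ) (σ : Σ n : ℕ, Simp S n) :
    ∃ f : MultilinearMap (ZMod 2) (fun _ : Fin n => Cochains S) (ZMod 2),
      ∀ x, f x = (actStr n u x).1 σ := by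
  classical
  let ev (s : Finset (Fin (σ.1 + 1))) : Cochains S →ₗ[ZMod 2] ZMod 2 :=
    { toFun := fun x => evalFace x.1 σ.2 s
      map_add' := fun x y => evalFace_add _ _ _ _
      map_smul' := fun c x => evalFace_smul _ _ _ _ }
  refine ⟨if IsSurj n u then ∑ t : Fin (u.length + 1) → Fin (σ.1 + 1),
    if IsCut u σ.1 t then (MultilinearMap.mkPiAlgebra (ZMod 2) (Fin n) (ZMod 2)).compLinearMap
      fun j => ev (letterVerts u t (j + 1)) else 0 else 0, fun x => ?_⟩
  unfold actStr
  dsimp only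
  split_ifs with hu
  · rw [sum_apply]
    refine Finset.sum_congr rfl fun t _ => ?_
    split_ifs
    · simp [ev]
    · rfl
  · rfl

/-- The action on cochains is multilinear. -/
theorem exists_act_multilinear (n : ℕ) (U : Strings) :
    ∃ f : MultilinearMap (ZMod 2) (fun _ : Fin n => Cochains S) (Cochains S),
      ∀ x, f x = act n U x := by
  have h : ∀ σ, ∃ f : MultilinearMap (ZMod 2) (fun _ : Fin n => Cochains S) (ZMod 2),
      ∀ x, f x = (act n U x).1 σ := by
    intro σ
    choose g hg using fun u => exists_actStr_multilinear (S := S) n u σ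
    refine ⟨∑ u ∈ U.support, U u • g u, fun x => ?_⟩
    rw [act_apply, lift_apply, sum_apply]
    exact Finset.sum_congr rfl fun u _ => by rw [smul_apply, hg]
  choose g hg using h
  refine ⟨⟨act n U, ?_, ?_⟩, fun _ => rfl⟩
  · intro _ x i y z
    refine Subtype.ext (funext fun σ => ?_)
    have := (g σ).map_update_add x i y z
    rwa [hg, hg, hg] at this
  · intro _ x i c y
    refine Subtype.ext (funext fun σ => ?_)
    have := (g σ).map_update_smul x i c y
    rwa [hg, hg] at this

/-- A tuple as a sequence that starts with number `1`. -/
noncomputable def extendTuple {n : ℕ} (x : Fin n → Cochains S) : ℕ → RawCochains S := fun j =>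
  if h : j - 1 < n then (x ⟨j - 1, h⟩).1 else 0

theorem extendTuple_succ {n : ℕ} (x : Fin n → Cochains S) (j : Fin n) :
    extendTuple x (j + 1) = (x j).1 := by
  rw [extendTuple, dif_pos (by simp)]
  rfl

theorem sum_card_verts {N : ℕ} {J : Finset ℕ} {s : Multiset (ℕ × Fin (N + 1))} (hn : s.Nodup)
    (hs : ∀ e ∈ s, e.1 ∈ J) : ∑ j ∈ J, (verts s j).card = s.card := by
  have h := Finset.sum_finset_product (s.toFinset) J (verts s)
    (by rintro ⟨j, v⟩; simpa using fun h => hs _ h) (f := fun _ => 1)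
  simp only [Finset.sum_const, smul_eq_mul, mul_one] at h
  rw [← h, Multiset.card_toFinset, hn.dedup]

/-- Count the points of a path in two ways. Its length is N + n + k for a string of length n + k,
and a nonzero factor needs s j + 1 points in column j. -/
theorem act_mem_deg {n k : ℕ} (hn : 1 ≤ n) {U : Strings} (hU : U ∈ chi n k)
    {s : Fin n → ℤ} {x : Fin n → Cochains S} (hx : ∀ j, x j ∈ deg S (s j)) :
    act n U x ∈ deg S (∑ j, s j - k) := by
  intro N σ hN
  rw [act_apply]
  refine Submodule.span_induction (p := fun U _ => lift (fun u => (actStr n u x).1 ⟨N, σ⟩) U = 0)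
    ?_ (map_zero _) (fun U V _ _ h h' => by rw [map_add, h, h', add_zero])
    (fun c U _ h => by rw [map_smul, h, smul_zero]) hU
  rintro _ ⟨u, ⟨hu, hlen⟩, rfl⟩
  rw [lift_str, actStr_val hn hu x (extendTuple_succ x)]
  refine (pathSum_congr fun p hp => ?_).trans (pathSum_zero u _)
  by_cases hp' : (p : Multiset (ℕ × Fin (N + 1))).Nodup
  · rw [evalVerts_of_nodup _ _ hp']
    by_contra hne
    rw [← ne_eq, Finset.prod_ne_zero_iff] at hne
    have hcard : ∀ j : Fin n, ((verts (p : Multiset (ℕ × Fin (N + 1))) (j + 1)).card : ℤ) =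
        s j + 1 := by
      intro j
      by_contra hj
      refine hne (j + 1) (by simp) ?_
      rw [extendTuple_succ]
      exact evalFace_eq_zero_of_mem_deg (hx j) _ _ hj
    have h1 := sum_card_verts hp' (J := Finset.Icc 1 n) fun e he =>
      ((hasLetters_iff.1 (isSurj_iff.1 hu)).1 _).1 (mem_of_mem_latticePaths hp he).1
    have h2 := length_of_mem_latticePaths hp
    rw [← Finset.Ico_add_one_right_eq_Icc, Finset.sum_Ico_eq_sum_range, Finset.sum_range] at h1
    simp only [Nat.add_comm 1, Multiset.coe_card] at h1
    have h3 : ((∑ j : Fin n, (verts (p : Multiset (ℕ × Fin (N + 1))) (j + 1)).card : ℕ) : ℤ) =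
        ∑ j, s j + n := by
      rw [Nat.cast_sum, Finset.sum_congr rfl fun j _ => hcard j, Finset.sum_add_distrib]
      simp
    have h4 : (∑ j : Fin n, (verts (p : Multiset (ℕ × Fin (N + 1))) (j + 1)).card : ℕ) =
      p.length := h1
    rw [h4] at h3
    rw [List.length_finRange] at h2
    omega
  · exact evalVerts_of_not_nodup _ _ hp'

/-- If σ collapses the vertices i and i + 1, the step between these two rows lies in one column. The
face for that letter contains both vertices and is degenerate. -/
theorem isNormalized_act {n : ℕ} (hn : 1 ≤ n) (U : Strings) {x : Fin n → Cochains S}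
    (hx : ∀ j, IsNormalized (x j)) : IsNormalized (act n U x) := by
  intro N σ hσ
  obtain ⟨m, rfl, i, hi⟩ := exists_collapses σ hσ
  rw [act_apply]
  have h0 : lift (fun u => (actStr n u x).1 ⟨m + 1, σ⟩) = 0 := by
    refine hom_ext fun u => ?_
    rw [lift_str, LinearMap.zero_apply]
    by_cases hu : IsSurj n u
    swap
    · unfold actStr
      exact if_neg hu
    rw [actStr_val hn hu x (extendTuple_succ x)]
    refine (pathSum_congr fun p hp => ?_).trans (pathSum_zero u _)
    have hsplit : List.finRange (m + 2) = (List.finRange (m + 2)).take i ++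
        i.castSucc :: i.succ :: (List.finRange (m + 2)).drop (i + 2) := by
      conv_lhs => rw [← List.take_append_drop i (List.finRange (m + 2))]
      rw [List.drop_eq_getElem_cons (by simp; omega),
        List.drop_eq_getElem_cons (by simp; omega)]
      simp
      exact ⟨rfl, rfl⟩
    rw [hsplit] at hp
    obtain ⟨c, hc⟩ := exists_sublist_of_mem_latticePaths hp
    have h1 : (c, i.castSucc) ∈ p := hc.subset (by simp)
    have h2 : (c, i.succ) ∈ p := hc.subset (by simp)
    have hcn := (hu.1 c).1 (mem_of_mem_latticePaths hp h1).1
    unfold evalVerts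
    split_ifs
    · refine Finset.prod_eq_zero (Finset.mem_Icc.2 hcn) ?_
      refine evalFace_of_collapses ?_ hi (by simpa using h1) (by simpa using h2)
      rw [extendTuple, dif_pos (by omega)]
      exact hx _
    · rfl
  rw [h0, LinearMap.zero_apply]

theorem Collapses.δ_eq {n : ℕ} {σ : Simp S (n + 1)} {i : Fin (n + 1)} (h : Collapses σ i) :
    S.δ i.castSucc σ = S.δ i.succ σ := by
  obtain ⟨τ, rfl⟩ := h
  rw [CategoryTheory.SimplicialObject.δ, CategoryTheory.SimplicialObject.δ,
    ← CategoryTheory.comp_apply, ← CategoryTheory.comp_apply, ← S.map_comp, ← S.map_comp,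
    ← CategoryTheory.op_comp, ← CategoryTheory.op_comp, SimplexCategory.δ_comp_σ_self,
    SimplexCategory.δ_comp_σ_succ]

/-- The two faces opposite the collapsed vertices coincide and cancel; every other face contains
both of these vertices and is degenerate. -/
theorem isNormalized_d {x : Cochains S} (hx : IsNormalized x) : IsNormalized (d S x) := by
  intro N σ hσ
  obtain ⟨m, rfl, i, hi⟩ := exists_collapses σ hσ
  change ∑ v : Fin (m + 2), x.1 ⟨m, S.δ v σ⟩ = 0
  have hne : i.castSucc ≠ i.succ := (Fin.castSucc_lt_succ (i := i)).ne
  rw [Finset.sum_eq_add i.castSucc i.succ hne]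
  · have := hi.δ_eq
    dsimp only at this
    rw [this, SurjOperad.add_self_eq_zero]
  · rintro v - ⟨h1, h2⟩
    have h := evalFace_eq x.1 σ (Fin.succAboveOrderEmb v) (s := Finset.univ.erase v) (by
      ext w
      simp only [Finset.mem_erase, Finset.mem_univ, and_true, Finset.mem_map, true_and]
      exact ⟨fun hw => Fin.exists_succAbove_eq hw, by rintro ⟨j, rfl⟩; exact Fin.succAbove_ne v j⟩)
    refine Eq.trans (Eq.symm h) (evalFace_of_collapses hx hi ?_ ?_)
    · simpa using h1.symm
    · simpa using h2.symm
  · simp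
  · simp

theorem normalizedClosed : NormalizedClosed S where
  d x hx := isNormalized_d hx
  cup x y hx hy := by
    rw [← act_mu]
    refine isNormalized_act (by norm_num) mu fun j => ?_
    fin_cases j
    · exact hx
    · exact hy
  one n σ hσ := by
    obtain ⟨m, rfl, -⟩ := exists_collapses σ hσ
    rfl
  opE k p q a b ha hb := by
    rcases Nat.eq_zero_or_pos p with rfl | hp
    · rw [opE, E_zero_left, act_zero]
      intro n σ _
      rfl
    · refine isNormalized_act (by omega) _ fun j => ?_
      refine Fin.addCases (fun i => ?_) (fun i => ?_) j
      · rw [Fin.append_left]; exact ha i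
      · rw [Fin.append_right]; exact hb i

end

open SurjOperad

/-! ### The identity (ehga) on cochains -/

section

variable {S : SSet.{u}}

theorem opE_val {k p q : ℕ} (h : 1 ≤ p + q) (a b : ℕ → Cochains S) {y : ℕ → RawCochains S}
    (ha : ∀ i < p, y (i + 1) = (a i).1) (hb : ∀ j < q, y (p + j + 1) = (b j).1) :
    (opE S k p q (firsts p a) (firsts q b)).1 = rawAct (Finset.Icc 1 (p + q)) (E k p q) y := by
  refine act_val h (E_mem k p q) _ fun j => ?_
  refine Fin.addCases (fun i => ?_) (fun i => ?_) j
  · rw [Fin.append_left]; exact ha i i.2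
  · rw [Fin.append_right]; exact hb i i.2

/-- This is the form in which `rawAct_prodOp` presents its factors: the groups of inputs are
consecutive stretches, from s and from t, of one sequence x. -/
theorem opE_val_getD {k p q s t : ℕ} (h : 1 ≤ p + q) {a b : ℕ → Cochains S} {x : ℕ → RawCochains S}
    (ha : ∀ i < p, x (s + i) = (a i).1) (hb : ∀ j < q, x (t + j) = (b j).1) :
    (opE S k p q (firsts p a) (firsts q b)).1 =
      rawAct (Finset.Icc 1 (List.range' s p ++ List.range' t q).length) (E k p q)
        fun j => x ((List.range' s p ++ List.range' t q).getD (j - 1) 0) := by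
  rw [List.length_append, List.length_range', List.length_range']
  refine opE_val h a b (fun i hi => ?_) fun j hj => ?_
  · rw [getD_append_left (by simpa using hi), Nat.add_sub_cancel, getD_range' hi, ha i hi]
  · rw [getD_append_right (by simp), List.length_range', Nat.add_sub_cancel,
      Nat.add_sub_cancel_left, getD_range' hj, hb j hj]

theorem nodup_of_toFinset_eq {l : List ℕ} {N : ℕ} (h : l.toFinset = Finset.Icc 1 N)
    (hl : l.length = N) : l.Nodup := by
  rw [← Multiset.coe_nodup, ← Multiset.toFinset_card_eq_card_iff_nodup]
  change l.toFinset.card = l.length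
  rw [h, hl, Nat.card_Icc, Nat.add_sub_cancel]

theorem rawAct_prodOp_of_eq {N : ℕ} {U V : Strings} {l l' : List ℕ}
    (hU : U ∈ SJ (Finset.Icc 1 l.length)) (hV : V ∈ SJ (Finset.Icc 1 l'.length)) (hl : l ≠ [])
    (hl' : l' ≠ []) (hn : (l ++ l').length = N) (hN : (l ++ l').toFinset = Finset.Icc 1 N)
    {x : ℕ → RawCochains S} {y z : Cochains S}
    (hy : y.1 = rawAct (Finset.Icc 1 l.length) U fun j => x (l.getD (j - 1) 0))
    (hz : z.1 = rawAct (Finset.Icc 1 l'.length) V fun j => x (l'.getD (j - 1) 0)) :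
    (cup S y z).1 = rawAct (Finset.Icc 1 N) (prodOp U l V l') x := by
  rw [← hN, rawAct_prodOp hU hV hl hl' (nodup_of_toFinset_eq hN hn), cup_val, hy, hz]

theorem rawAct_prodOp_idOp_left {N c : ℕ} {V : Strings} {l' : List ℕ}
    (hV : V ∈ SJ (Finset.Icc 1 l'.length)) (hl' : l' ≠ []) (hn : (c :: l').length = N)
    (hN : (c :: l').toFinset = Finset.Icc 1 N) {x : ℕ → RawCochains S} {y z : Cochains S}
    (hy : y.1 = x c)
    (hz : z.1 = rawAct (Finset.Icc 1 l'.length) V fun j => x (l'.getD (j - 1) 0)) :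
    (cup S y z).1 = rawAct (Finset.Icc 1 N) (prodOp idOp [c] V l') x := by
  have h : idOp ∈ SJ (Finset.Icc 1 [c].length) := idOp_mem
  refine rawAct_prodOp_of_eq h hV (by simp) hl' hn hN ?_ hz
  rw [hy]
  exact (rawAct_idOp fun j => x ([c].getD (j - 1) 0)).symm

theorem rawAct_prodOp_idOp_right {N c : ℕ} {V : Strings} {l' : List ℕ}
    (hV : V ∈ SJ (Finset.Icc 1 l'.length)) (hl' : l' ≠ []) (hn : (l' ++ [c]).length = N)
    (hN : (l' ++ [c]).toFinset = Finset.Icc 1 N) {x : ℕ → RawCochains S} {y z : Cochains S}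
    (hy : y.1 = x c)
    (hz : z.1 = rawAct (Finset.Icc 1 l'.length) V fun j => x (l'.getD (j - 1) 0)) :
    (cup S z y).1 = rawAct (Finset.Icc 1 N) (prodOp V l' idOp [c]) x := by
  have h : idOp ∈ SJ (Finset.Icc 1 [c].length) := idOp_mem
  refine rawAct_prodOp_of_eq hV h hl' (by simp) hn hN hz ?_
  rw [hy]
  exact (rawAct_idOp fun j => x ([c].getD (j - 1) 0)).symm

theorem rawAct_circ_mu {n i : ℕ} (hi : 1 ≤ i) (hin : i ≤ n) {U : Strings}
    (hU : U ∈ SJ (Finset.Icc 1 n)) (x : ℕ → RawCochains S) :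
    rawAct (Finset.Icc 1 (n + 1)) (circ i 2 U mu) x = rawAct (Finset.Icc 1 n) U
      (insertInput i 2 (rawCup (x i) (x (i + 1))) x) := by
  have h := rawAct_circ hi hin (by norm_num) hU mu_mem x
  rw [rawAct_mu, show 1 + i - 1 = i by omega, show 2 + i - 1 = i + 1 by omega] at h
  exact h

theorem E_mem_length {k p q s t : ℕ} :
    E k p q ∈ SJ (Finset.Icc 1 (List.range' s p ++ List.range' t q).length) := by
  rw [List.length_append, List.length_range', List.length_range']
  exact E_mem k p q

section Ehga

variable {k m n : ℕ} {a b : ℕ → Cochains S} {x : ℕ → RawCochains S}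

/-- The chain map property, with its sum over all inputs split into the two groups. -/
theorem opE_diff_val (hm : 1 ≤ m) (ha : ∀ i < m, x (1 + i) = (a i).1)
    (hb : ∀ j < n, x (m + 1 + j) = (b j).1) :
    dFun (opE S k m n (firsts m a) (firsts n b)).1 +
      ∑ i ∈ Finset.range m, (opE S k m n (firsts m (diffSeq (d S) i a)) (firsts n b)).1 +
      ∑ j ∈ Finset.range n, (opE S k m n (firsts m a) (firsts n (diffSeq (d S) j b))).1 =
    rawAct (Finset.Icc 1 (m + n)) (bdry (m + n) (E k m n)) x := by
  have hd : ∀ (c : ℕ → Cochains S) (i : ℕ), (diffSeq (d S) i c i).1 = dFun (c i).1 := by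
    intro c i
    rw [diffSeq, Function.update_self]
    rfl
  rw [← dFun_rawAct_Icc (by omega) (E_mem k m n), ← Finset.Ico_add_one_right_eq_Icc,
    Finset.sum_Ico_eq_sum_range, Nat.add_sub_cancel, Finset.sum_range_add, ← add_assoc]
  have h0 := opE_val (k := k) (p := m) (q := n) (by omega) a b (y := x) (fun i hi => by rw [Nat.add_comm, ha i hi])
    fun j hj => by rw [← hb j hj]; congr 1; omega
  rw [h0, Finset.Ico_add_one_right_eq_Icc]
  congr 1
  · congr 1
    refine Finset.sum_congr rfl fun i hi => ?_
    rw [Finset.mem_range] at hi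
    refine opE_val (by omega) _ _ (fun i' hi' => ?_) fun j hj => ?_
    · by_cases h : i' = i
      · subst h
        rw [Nat.add_comm i' 1, Function.update_self, hd, ha _ hi]
      · rw [Function.update_of_ne (by omega), diffSeq, Function.update_of_ne h, ← ha _ hi',
          Nat.add_comm]
    · rw [Function.update_of_ne (by omega), ← hb j hj]
      congr 1; omega
  · refine Finset.sum_congr rfl fun j hj => ?_
    rw [Finset.mem_range] at hj
    refine opE_val (by omega) _ _ (fun i' hi' => ?_) fun j' hj' => ?_
    · rw [Function.update_of_ne (by omega), ← ha _ hi', Nat.add_comm]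
    · by_cases h : j' = j
      · subst h
        rw [show m + j' + 1 = 1 + (m + j') by omega, Function.update_self, hd, ← hb _ hj]
        congr 2; omega
      · rw [Function.update_of_ne (by omega), diffSeq, Function.update_of_ne h, ← hb _ hj']
        congr 1; omega

theorem opE_merge_left_val {i : ℕ} (hi : i < m - 1) (ha : ∀ i < m, x (1 + i) = (a i).1)
    (hb : ∀ j < n, x (m + 1 + j) = (b j).1) :
    (opE S k (m - 1) n (firsts (m - 1) (mergeSeq (cup S) i a)) (firsts n b)).1 =
      rawAct (Finset.Icc 1 (m + n)) (circ (i + 1) 2 (E k (m - 1) n) mu) x := by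
  have h := rawAct_circ_mu (i := i + 1) (by omega) (by omega) (E_mem k (m - 1) n) x
  rw [show m - 1 + n + 1 = m + n by omega] at h
  rw [h]
  refine opE_val (by omega) _ _ (fun r hr => ?_) fun j hj => ?_
  · rw [insertInput, mergeSeq]
    rcases lt_trichotomy r i with hlt | rfl | hlt
    · rw [if_pos (by omega), if_pos hlt, ← ha _ (by omega), Nat.add_comm]
    · rw [if_neg (by omega), if_pos rfl, if_neg (by omega), if_pos rfl, cup_val,
        ← ha _ (by omega), ← ha _ (by omega), Nat.add_comm 1 r, Nat.add_comm 1 (r + 1)]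
    · rw [if_neg (by omega), if_neg (by omega), if_neg (by omega), if_neg (by omega),
        ← ha _ (by omega)]
      congr 1; omega
  · rw [insertInput, if_neg (by omega), if_neg (by omega), ← hb j hj]
    congr 1; omega

theorem opE_merge_right_val {j : ℕ} (hj : j < n - 1) (ha : ∀ i < m, x (1 + i) = (a i).1)
    (hb : ∀ j < n, x (m + 1 + j) = (b j).1) :
    (opE S k m (n - 1) (firsts m a) (firsts (n - 1) (mergeSeq (cup S) j b))).1 =
      rawAct (Finset.Icc 1 (m + n)) (circ (m + (j + 1)) 2 (E k m (n - 1)) mu) x := by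
  have h := rawAct_circ_mu (i := m + (j + 1)) (by omega) (by omega) (E_mem k m (n - 1)) x
  rw [show m + (n - 1) + 1 = m + n by omega] at h
  rw [h]
  refine opE_val (by omega) _ _ (fun r hr => ?_) fun r hr => ?_
  · rw [insertInput, if_pos (by omega), ← ha _ hr, Nat.add_comm]
  · rw [insertInput, mergeSeq]
    rcases lt_trichotomy r j with hlt | rfl | hlt
    · rw [if_pos (by omega), if_pos hlt, ← hb _ (by omega)]
      congr 1; omega
    · rw [if_neg (by omega), if_pos (by omega), if_neg (by omega), if_pos rfl, cup_val,
        ← hb _ (by omega), ← hb _ (by omega)]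
      congr 2 <;> omega
    · rw [if_neg (by omega), if_neg (by omega), if_neg (by omega), if_neg (by omega),
        ← hb _ (by omega)]
      congr 1; omega

/-- The sequence x holds the inputs a and b one after the other, matching the letters in `ehgaLeft`;
the terms then correspond one by one. -/
theorem ehgaLeft_val (hm : 1 ≤ m) (hn : 1 ≤ n) (ha : ∀ i < m, x (1 + i) = (a i).1)
    (hb : ∀ j < n, x (m + 1 + j) = (b j).1) :
    let F (k p q : ℕ) (x y : ℕ → Cochains S) : Cochains S := opE S k p q (firsts p x) (firsts q y)
    let T (i k p q : ℕ) (x y : ℕ → Cochains S) : Cochains S :=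
      if Even i then F k p q x y else F k q p y x
    (d S (F k m n a b) +
    ∑ i ∈ Finset.range m, F k m n (diffSeq (d S) i a) b +
    ∑ j ∈ Finset.range n, F k m n a (diffSeq (d S) j b) +
    ∑ i ∈ Finset.range (m - 1), F k (m - 1) n (mergeSeq (cup S) i a) b +
    ∑ j ∈ Finset.range (n - 1), F k m (n - 1) a (mergeSeq (cup S) j b) +
    cup S (a 0) (F k (m - 1) n (dropSeq 1 a) b) +
    cup S (F k (m - 1) n a b) (a (m - 1)) +
    cup S (b 0) (F k m (n - 1) a (dropSeq 1 b)) +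
    cup S (F k m (n - 1) a b) (b (n - 1)) +
    ∑ i ∈ Finset.range (k + 1), ∑ p ∈ Finset.Ico 1 m, ∑ q ∈ Finset.Ico 1 n,
      cup S (F i p q a b) (T i (k - i) (m - p) (n - q) (dropSeq p a) (dropSeq q b))).1 =
    rawAct (Finset.Icc 1 (m + n)) (ehgaLeft E k m n) x := by
  intro F T
  have ha0 := (ha 0 hm).symm
  have hb0 := (hb 0 hn).symm
  have ha1 : (a (m - 1)).1 = x m := by
    rw [← ha _ (by omega)]; congr 1; omega
  have hb1 : (b (n - 1)).1 = x (m + n) := by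
    rw [← hb _ (by omega)]; congr 1; omega
  rw [Nat.add_zero] at ha0 hb0
  rw [ehgaLeft]
  simp only [rawAct_add, rawAct_sum, Submodule.coe_add, AddSubmonoidClass.coe_finsetSum,
    List.range'_one]
  congr 1
  congr 1
  congr 1
  congr 1
  congr 1
  congr 1
  congr 1
  · exact opE_diff_val hm ha hb
  · rw [Finset.sum_Ico_eq_sum_range]
    refine Finset.sum_congr rfl fun i hi => ?_
    rw [Nat.add_comm 1 i]
    exact opE_merge_left_val (by simpa using hi) ha hb
  · rw [Finset.sum_Ico_eq_sum_range]
    refine Finset.sum_congr rfl fun i hi => ?_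
    rw [Nat.add_comm 1 i]
    exact opE_merge_right_val (by simpa using hi) ha hb
  · have h : (F k (m - 1) n (dropSeq 1 a) b).1 = _ :=
      opE_val_getD (x := x) (s := 2) (by omega) (fun i hi => by
        rw [dropSeq, ← ha _ (by omega)]; congr 1; omega) hb
    refine rawAct_prodOp_idOp_left E_mem_length (by simp; omega) ?_ ?_ ha0 h
    · simp; omega
    · ext; simp; omega
  · have h : (F k (m - 1) n a b).1 = _ :=
      opE_val_getD (x := x) (by omega) (fun i hi => ha i (by omega)) hb
    refine rawAct_prodOp_idOp_right E_mem_length (by simp; omega) ?_ ?_ ha1 h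
    · simp; omega
    · ext; simp; omega
  · have h : (F k m (n - 1) a (dropSeq 1 b)).1 = _ :=
      opE_val_getD (x := x) (t := m + 2) (by omega) ha fun j hj => by
        rw [dropSeq, ← hb _ (by omega)]; congr 1; omega
    refine rawAct_prodOp_idOp_left E_mem_length (by simp; omega) ?_ ?_ hb0 h
    · simp; omega
    · ext; simp; omega
  · have h : (F k m (n - 1) a b).1 = _ :=
      opE_val_getD (x := x) (by omega) ha fun j hj => hb j (by omega)
    refine rawAct_prodOp_idOp_right E_mem_length (by simp; omega) ?_ ?_ hb1 h
    · simp; omega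
    · ext; simp; omega
  · refine Finset.sum_congr rfl fun i _ => Finset.sum_congr rfl fun p hp =>
      Finset.sum_congr rfl fun q hq => ?_
    rw [Finset.mem_Ico] at hp hq
    have h : (F i p q a b).1 = _ := opE_val_getD (x := x) (by omega)
      (fun i hi => ha i (by omega)) fun j hj => hb j (by omega)
    have ha' : ∀ r < m - p, x (p + 1 + r) = (dropSeq p a r).1 := by
      intro r hr
      rw [dropSeq, ← ha _ (by omega)]; congr 1; omega
    have hb' : ∀ r < n - q, x (m + (q + 1) + r) = (dropSeq q b r).1 := by
      intro r hr
      rw [dropSeq, ← hb _ (by omega)]; congr 1; omega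
    simp only [T]
    split_ifs with hi
    · refine rawAct_prodOp_of_eq E_mem_length E_mem_length (by simp; omega) (by simp; omega) ?_ ?_
        h (opE_val_getD (by omega) ha' hb')
      · simp; omega
      · ext; simp; omega
    · refine rawAct_prodOp_of_eq E_mem_length E_mem_length (by simp; omega) (by simp; omega) ?_ ?_
        h (opE_val_getD (by omega) hb' ha')
      · simp; omega
      · ext; simp; omega

end Ehga

end

end SSetCochains

/-! ### Letters in the composition of braces -/

namespace SurjOperad

theorem flatten_map_singleton (C : ℕ → ℕ) (l : List ℕ) :
    (l.map fun j => [C j]).flatten = l.map C := by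
  induction l <;> simp_all

/-- Every b and every c occurs exactly once among the inputs, as the substitution rule
`rawAct_subst` requires. -/
theorem perm_interleave {C : ℕ → ℕ} {n : ℕ} : ∀ {bs : List ℕ} {L : List (ℕ × ℕ)} {s : ℕ},
    bs.length = L.length → s ≤ n → (∀ p ∈ L, s ≤ p.1) → (∀ p ∈ L, p.1 + p.2 ≤ n) →
    L.Pairwise (fun p q => p.1 + p.2 ≤ q.1) →
    ((interleave (fun j => [C j]) n s (List.zipWith
      (fun b p => (p.1, p.2, b :: (List.range' p.1 p.2).map C)) bs L)).flatten).Perm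
        (bs ++ (List.range' s (n - s)).map C)
  | [], [], s, _, _, _, _, _ => by
    simp only [List.zipWith_nil_left, interleave, flatten_map_singleton, List.nil_append]
    exact List.Perm.refl _
  | b :: bs, (k, l) :: L, s, hl, hs, h1, h2, h3 => by
    rw [List.pairwise_cons] at h3
    have hk := h1 (k, l) (by simp)
    have hkl := h2 (k, l) (by simp)
    dsimp only at hk hkl
    have ih := perm_interleave (C := C) (by simpa using hl) hkl h3.1
      (fun p hp => h2 p (by simp [hp])) h3.2
    simp only [List.zipWith_cons_cons, interleave, List.flatten_append, List.flatten_cons]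
    have hr : List.range' s (n - s) = List.range' s (k - s) ++ (List.range' k l ++
        List.range' (k + l) (n - (k + l))) := by
      obtain ⟨r, rfl⟩ : ∃ r, k = s + r := ⟨k - s, by omega⟩
      rw [List.range'_append_1, Nat.add_sub_cancel_left, List.range'_append_1]
      congr 1; omega
    rw [hr, flatten_map_singleton]
    rw [List.perm_iff_count] at ih ⊢
    intro c
    have := ih c
    simp only [List.count_append, List.count_cons, List.map_append, List.cons_append] at this ⊢
    omega
  | [], _ :: _, _, h, _, _, _, _ => by simp at h
  | _ :: _, [], _, h, _, _, _, _ => by simp at h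

end SurjOperad

namespace SSetCochains

open SurjOperad

/-! ### Homotopy G-algebra identities on cochains -/

section

variable {S : SSet.{u}}

/-- The operation `E_{1,q}` on cochains. -/
noncomputable def opBrace (q : ℕ) (a : Cochains S) (b : Fin q → Cochains S) : Cochains S :=
  if q = 0 then a else opE S 0 1 q (fun _ => a) b

theorem opBrace_val {q : ℕ} {a : Cochains S} {b : Fin q → Cochains S} {y : ℕ → RawCochains S}
    (ha : y 1 = a.1) (hb : ∀ j : Fin q, y (2 + j) = (b j).1) :
    (opBrace q a b).1 = rawAct (Finset.Icc 1 (1 + q)) (braceOp q) y := by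
  unfold opBrace braceOp
  split_ifs with h
  · subst h
    rw [rawAct_idOp, ha]
  · refine act_val (by omega) (E_mem 0 1 q) _ fun j => ?_
    refine Fin.addCases (fun i => ?_) (fun i => ?_) j
    · rw [Fin.append_left, Subsingleton.elim i 0]; exact ha
    · rw [Fin.append_right, ← hb i]
      congr 1
      simp
      omega

theorem opBrace_val_getD {q c s : ℕ} {a : Cochains S} {b : ℕ → Cochains S} {x : ℕ → RawCochains S}
    (ha : x c = a.1) (hb : ∀ j < q, x (s + j) = (b j).1) :
    (opBrace q a (firsts q b)).1 =
      rawAct (Finset.Icc 1 (c :: List.range' s q).length) (braceOp q)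
        fun j => x ((c :: List.range' s q).getD (j - 1) 0) := by
  rw [List.length_cons, List.length_range', Nat.add_comm q 1]
  refine opBrace_val ha fun j => ?_
  rw [show 2 + (j : ℕ) - 1 = j + 1 by omega, List.getD_cons_succ, getD_range' j.2, hb j j.2]
  rfl

theorem braceOp_mem_length {c s q : ℕ} :
    braceOp q ∈ SJ (Finset.Icc 1 (c :: List.range' s q).length) := by
  rw [List.length_cons, List.length_range', Nat.add_comm]
  exact braceOp_mem q

theorem opBrace_diff {q : ℕ} (hq : 1 ≤ q) (a : Cochains S) (b : ℕ → Cochains S) :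
    d S (opBrace q a (firsts q b)) + opBrace q (d S a) (firsts q b) +
        ∑ j ∈ Finset.range q, opBrace q a (firsts q (diffSeq (d S) j b)) =
      cup S (b 0) (opBrace (q - 1) a (firsts (q - 1) (dropSeq 1 b))) +
      ∑ j ∈ Finset.range (q - 1), opBrace (q - 1) a (firsts (q - 1) (mergeSeq (cup S) j b)) +
      cup S (opBrace (q - 1) a (firsts (q - 1) b)) (b (q - 1)) := by
  let x : ℕ → RawCochains S := fun j => if j = 1 then a.1 else (b (j - 2)).1
  have ha : x 1 = a.1 := rfl
  have hb : ∀ j, x (2 + j) = (b j).1 := by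
    intro j
    simp only [x]
    rw [if_neg (by omega), Nat.add_sub_cancel_left]
  have h := congrArg (fun U => rawAct (Finset.Icc 1 (1 + q)) U x) (braceOp_diff q hq)
  simp only [rawAct_add, rawAct_sum] at h
  apply Subtype.ext
  simp only [Submodule.coe_add, AddSubmonoidClass.coe_finsetSum]
  refine Eq.trans ?_ (h.trans ?_)
  · rw [← dFun_rawAct_Icc (by omega) (braceOp_mem q), ← Finset.Ico_add_one_right_eq_Icc,
      Finset.sum_Ico_eq_sum_range, Nat.add_sub_cancel, Finset.sum_range_add, ← add_assoc,
      Finset.sum_range_one, Finset.Ico_add_one_right_eq_Icc]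
    have h0 := opBrace_val (q := q) (b := firsts q b) ha fun j => hb j
    congr 1
    · congr 1
      · rw [← h0]; rfl
      · refine opBrace_val (by rw [Nat.add_zero, Function.update_self]; rfl) fun j => ?_
        rw [Function.update_of_ne (by omega)]; exact hb j
    · refine Finset.sum_congr rfl fun j hj => ?_
      refine opBrace_val (by rw [Function.update_of_ne (by omega), ha]) fun j' => ?_
      rw [firsts, diffSeq]
      by_cases h : (j' : ℕ) = j
      · rw [h, ← add_assoc, Function.update_self, Function.update_self]
        exact congrArg dFun (hb j)
      · rw [Function.update_of_ne (by omega), Function.update_of_ne h]; exact hb j'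
  · congr 1
    · congr 1
      · symm
        refine rawAct_prodOp_idOp_left braceOp_mem_length (by simp) (by simp; omega)
          (by ext; simp; omega) (hb 0).symm (opBrace_val_getD ha fun j hj => ?_)
        rw [dropSeq, ← hb]; congr 1; omega
      · rw [Finset.sum_Ico_eq_sum_range]
        refine Finset.sum_congr rfl fun j hj => ?_
        rw [Finset.mem_range] at hj
        have h := rawAct_circ_mu (i := 1 + (1 + j)) (by omega) (by omega) (braceOp_mem (q - 1)) x
        rw [show 1 + (q - 1) + 1 = 1 + q by omega] at h
        rw [h]
        symm
        refine opBrace_val (by rw [insertInput, if_pos (by omega), ha]) fun r => ?_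
        rw [insertInput, firsts, mergeSeq]
        rcases lt_trichotomy (r : ℕ) j with hlt | hr | hlt
        · rw [if_pos (by omega), if_pos hlt, hb]
        · rw [if_neg (by omega), if_pos (by omega), if_neg (by omega), if_pos hr, cup_val,
            ← hb, ← hb]
          congr 2 <;> omega
        · rw [if_neg (by omega), if_neg (by omega), if_neg (by omega), if_neg (by omega), ← hb]
          exact congrArg x (by omega)
    · symm
      have hl : List.range' 1 q = 1 :: List.range' 2 (q - 1) := by
        obtain ⟨r, rfl⟩ : ∃ r, q = r + 1 := ⟨q - 1, by omega⟩
        rfl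
      rw [hl]
      refine rawAct_prodOp_idOp_right braceOp_mem_length (by simp) (by simp; omega)
          (by ext; simp; omega) ?_ (opBrace_val_getD ha fun j hj => hb j)
      rw [← hb]; congr 1; omega

theorem opBrace_hirsch {q : ℕ} (hq : 1 ≤ q) (a₁ a₂ : Cochains S) (b : ℕ → Cochains S) :
    cup S a₁ (opBrace q a₂ (firsts q b)) + opBrace q (cup S a₁ a₂) (firsts q b) +
        cup S (opBrace q a₁ (firsts q b)) a₂ =
      ∑ p ∈ Finset.Ico 1 q, cup S (opBrace p a₁ (firsts p b))
        (opBrace (q - p) a₂ (firsts (q - p) (dropSeq p b))) := by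
  let x : ℕ → RawCochains S := fun j =>
    if j = 1 then a₁.1 else if j = 2 then a₂.1 else (b (j - 3)).1
  have ha : x 1 = a₁.1 := rfl
  have ha' : x 2 = a₂.1 := rfl
  have hb : ∀ j, x (3 + j) = (b j).1 := by
    intro j
    simp only [x]
    rw [if_neg (by omega), if_neg (by omega), Nat.add_sub_cancel_left]
  have h := congrArg (fun U => rawAct (Finset.Icc 1 (q + 2)) U x) (braceOp_hirsch q hq)
  simp only [rawAct_add, rawAct_sum] at h
  apply Subtype.ext
  simp only [Submodule.coe_add, AddSubmonoidClass.coe_finsetSum]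
  refine Eq.trans ?_ (h.trans ?_)
  · congr 1
    · congr 1
      · exact rawAct_prodOp_idOp_left braceOp_mem_length (by simp) (by simp)
          (by ext; simp; omega) ha.symm (opBrace_val_getD ha' fun j hj => hb j)
      · have h := rawAct_circ_mu (i := 1) le_rfl (by omega) (braceOp_mem q) x
        rw [show 1 + q + 1 = q + 2 by omega] at h
        rw [h]
        refine opBrace_val rfl fun r => ?_
        rw [insertInput, if_neg (by omega), if_neg (by omega), firsts, ← hb]
        congr 1; omega
    · exact rawAct_prodOp_idOp_right braceOp_mem_length (by simp) (by simp)
          (by ext; simp; omega) ha'.symm (opBrace_val_getD ha fun j hj => hb j)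
  · refine Finset.sum_congr rfl fun p hp => ?_
    rw [Finset.mem_Ico] at hp
    symm
    refine rawAct_prodOp_of_eq braceOp_mem_length braceOp_mem_length (by simp) (by simp)
      (by simp; omega) (by ext; simp; omega) (opBrace_val_getD ha fun j hj => hb j)
      (opBrace_val_getD ha' fun j hj => ?_)
    rw [dropSeq, ← hb]; congr 1; omega

/-- Each summand is evaluated by `rawAct_subst`; the list of values of its inputs is the interleaved
list of cochains on the right. -/
theorem opBrace_assoc {m n : ℕ} (a : Cochains S) (b c : ℕ → Cochains S) :
    opBrace n (opBrace m a (firsts m b)) (firsts n c) =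
      ∑ f ∈ blocks m n,
        let inputs : List (Cochains S) := interleave c n 0
          (List.ofFn fun j : Fin m =>
            (((f j).1 : ℕ), ((f j).2 : ℕ),
              opBrace (f j).2 (b j) (firsts (f j).2 (dropSeq (f j).1 c))))
        opBrace inputs.length a inputs.get := by
  -- The positions 1, then 2, …, m + 1, then those from m + 2 on hold a, the b's and the c's, like
  -- the letters in the operad identity.
  let x : ℕ → RawCochains S := fun j =>
    if j = 1 then a.1 else if j < m + 2 then (b (j - 2)).1 else (c (j - (m + 2))).1
  have ha : x 1 = a.1 := rfl
  have hb : ∀ j < m, x (2 + j) = (b j).1 := by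
    intro j hj
    simp only [x]
    rw [if_neg (by omega), if_pos (by omega), Nat.add_sub_cancel_left]
  have hc : ∀ j, x (m + 2 + j) = (c j).1 := by
    intro j
    simp only [x]
    rw [if_neg (by omega), if_neg (by omega), Nat.add_sub_cancel_left]
  have h := congrArg (fun U => rawAct (Finset.Icc 1 (1 + m + n)) U x) (braceOp_assoc (m := m) (n := n))
  simp only [rawAct_sum] at h
  apply Subtype.ext
  simp only [AddSubmonoidClass.coe_finsetSum]
  refine Eq.trans ?_ (h.trans ?_)
  · have h := rawAct_circ (i := 1) le_rfl (by omega) (by omega) (braceOp_mem n) (braceOp_mem m) x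
    rw [show 1 + n + (1 + m) - 1 = 1 + m + n by omega] at h
    rw [h]
    refine opBrace_val (opBrace_val ha fun j => hb j j.2).symm fun r => ?_
    rw [insertInput, if_neg (by omega), if_neg (by omega), firsts, ← hc]
    congr 1; omega
  · refine Finset.sum_congr rfl fun f hf => ?_
    simp only [blocks, Finset.mem_filter, Finset.mem_univ, true_and] at hf
    have hflat : (((idOp, [1]) :: assocInputs m n f).flatMap Prod.snd).Perm
        (List.range' 1 (1 + m + n)) := by
      have hz : List.zipWith (fun b (p : ℕ × ℕ) =>
          (p.1, p.2, b :: (List.range' p.1 p.2).map fun j => m + 2 + j))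
          (List.range' 2 m) (List.ofFn fun j => (((f j).1 : ℕ), ((f j).2 : ℕ))) =
          List.ofFn fun j : Fin m => (((f j).1 : ℕ), ((f j).2 : ℕ),
            (2 + (j : ℕ)) :: List.range' (m + 2 + (f j).1) (f j).2) := by
        refine List.ext_getElem (by simp) fun i h1 h2 => ?_
        simp [List.map_add_range']
      have hp := perm_interleave (C := fun j => m + 2 + j) (n := n) (s := 0)
        (bs := List.range' 2 m) (L := List.ofFn fun j => (((f j).1 : ℕ), ((f j).2 : ℕ)))
        (by simp) (Nat.zero_le n) (by simp) (by
          intro p hp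
          obtain ⟨j, rfl⟩ := (List.mem_ofFn' _ _).1 hp
          exact hf.1 j) (List.pairwise_ofFn.2 fun i j hij => hf.2 i j hij)
      rw [hz, Nat.sub_zero, List.map_add_range', Nat.add_zero, Nat.add_comm m 2,
        List.range'_append_1] at hp
      rw [List.flatMap_cons, List.flatMap_def, assocInputs, interleave_map, List.map_ofFn,
        show 1 + m + n = (m + n) + 1 by omega, List.range'_succ]
      refine List.Perm.cons 1 ?_
      rw [Nat.add_comm m 2]
      exact hp
    have hgood : GoodInputs ((idOp, [1]) :: assocInputs m n f) := by
      intro p hp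
      rcases List.mem_cons.1 hp with rfl | hp
      · exact ⟨idOp_mem, by simp⟩
      · exact goodInputs_assocInputs m n f p hp
    have h := rawAct_subst hgood (hflat.nodup_iff.2 List.nodup_range')
      (U := braceOp (assocInputs m n f).length)
      (by rw [List.length_cons, Nat.add_comm]; exact braceOp_mem _) x
    rw [List.toFinset_eq_of_perm _ _ hflat, show (List.range' 1 (1 + m + n)).toFinset =
      Finset.Icc 1 (1 + m + n) by ext; simp; omega] at h
    rw [h]
    let inputs : List (Cochains S) := interleave c n 0 (List.ofFn fun j : Fin m =>
      (((f j).1 : ℕ), ((f j).2 : ℕ), opBrace (f j).2 (b j) (firsts (f j).2 (dropSeq (f j).1 c))))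
    change _ = (opBrace inputs.length a inputs.get).1
    have hmap : ((idOp, [1]) :: assocInputs m n f).map (fun p => rawAct
        (Finset.Icc 1 p.2.length) p.1 fun j => x (p.2.getD (j - 1) 0)) =
        a.1 :: inputs.map Subtype.val := by
      rw [List.map_cons, assocInputs, interleave_map, interleave_map, List.map_ofFn, List.map_ofFn]
      congr 1
      · exact rawAct_idOp _
      · congr 1
        · funext j
          exact (rawAct_idOp _).trans (hc j)
        · congr 1
          funext j
          refine Prod.ext rfl (Prod.ext rfl ?_)
          refine (opBrace_val_getD (hb j j.2) fun i hi => ?_).symm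
          rw [dropSeq, ← hc]
          exact congrArg x (by omega)
    have hlen : (assocInputs m n f).length = inputs.length := by
      have := congrArg List.length hmap
      simpa using this
    rw [hmap, List.length_cons, hlen, Nat.add_comm inputs.length 1]
    symm
    refine opBrace_val rfl fun j => ?_
    rw [show 2 + (j : ℕ) - 1 = j + 1 by omega, List.getD_cons_succ]
    simp [List.getD_eq_getElem?_getD]

end

open SurjOperad

/-! ### The algebra structures on cochains -/

section

variable {S : SSet.{u}}

theorem opE_zero_left (k q : ℕ) (a : Fin 0 → Cochains S) (b : Fin q → Cochains S) :
    opE S k 0 q a b = 0 := by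
  rw [opE, E_zero_left, act_zero]

theorem opE_zero_right (k p : ℕ) (a : Fin p → Cochains S) (b : Fin 0 → Cochains S) :
    opE S k p 0 a b = 0 := by
  rw [opE, E_zero_right, act_zero]

theorem opE_mem_deg {k p q : ℕ} {s : Fin p → ℤ} {t : Fin q → ℤ} {a : Fin p → Cochains S}
    {b : Fin q → Cochains S} (ha : ∀ i, a i ∈ deg S (s i)) (hb : ∀ j, b j ∈ deg S (t j)) :
    opE S k p q a b ∈ deg S (∑ i, s i + ∑ j, t j + (1 - k - p - q)) := by
  rcases Nat.eq_zero_or_pos p with rfl | hp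
  · rw [opE_zero_left]; exact zero_mem _
  rcases Nat.eq_zero_or_pos q with rfl | hq
  · rw [opE_zero_right]; exact zero_mem _
  have h := act_mem_deg (n := p + q) (s := Fin.append s t) (x := Fin.append a b) (by omega)
    (E_mem_chi (k := k) hp hq) fun j => by
      refine Fin.addCases (fun i => ?_) (fun i => ?_) j
      · rw [Fin.append_left, Fin.append_left]; exact ha i
      · rw [Fin.append_right, Fin.append_right]; exact hb i
  rw [Fin.sum_univ_add] at h
  simp only [Fin.append_left, Fin.append_right] at h
  rw [Nat.cast_sub (by omega)] at h
  push_cast at h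
  rw [show (∑ i, s i + ∑ j, t j + (1 - k - p - q) : ℤ) =
    ∑ i, s i + ∑ j, t j - (k + p + q - 1) by ring]
  exact h

theorem exists_opE_multilinear (k p q : ℕ) :
    ∃ f : MultilinearMap (ZMod 2) (fun _ : Fin p ⊕ Fin q => Cochains S) (Cochains S),
      ∀ a b, opE S k p q a b = f (Sum.elim a b) := by
  obtain ⟨f, hf⟩ := exists_act_multilinear (S := S) (p + q) (E k p q)
  refine ⟨f.domDomCongr finSumFinEquiv.symm, fun a b => ?_⟩
  rw [MultilinearMap.domDomCongr_apply, hf, opE]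
  congr 1
  funext j
  refine Fin.addCases (fun i => ?_) (fun i => ?_) j <;> simp

theorem exists_opBrace_multilinear (q : ℕ) :
    ∃ f : MultilinearMap (ZMod 2) (fun _ : Fin (q + 1) => Cochains S) (Cochains S),
      ∀ a b, opBrace q a b = f (Fin.cons a b) := by
  rcases Nat.eq_zero_or_pos q with rfl | hq
  · exact ⟨MultilinearMap.ofSubsingleton (ι := Fin 1) (ZMod 2) _ _ 0 LinearMap.id, fun _ _ => rfl⟩
  · obtain ⟨f, hf⟩ := exists_act_multilinear (S := S) (1 + q) (E 0 1 q)
    refine ⟨f.domDomCongr (finCongr (Nat.add_comm 1 q)), fun a b => ?_⟩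
    rw [MultilinearMap.domDomCongr_apply, hf, opBrace, if_neg (by omega), opE]
    congr 1
    funext j
    refine Fin.addCases (fun i => ?_) (fun i => ?_) j
    · rw [Fin.append_left, Subsingleton.elim i 0]; rfl
    · rw [Fin.append_right]
      have : finCongr (Nat.add_comm 1 q) (Fin.natAdd 1 i) = i.succ := by
        ext; simp
      rw [this, Fin.cons_succ]

theorem isHomotopyGAlgebra :
    IsHomotopyGAlgebra (deg S) (d S) (cup S) (one S) opBrace where
  dga := isDGAlgebra
  multilinear := exists_opBrace_multilinear
  degree q s t a b ha hb := by
    rcases Nat.eq_zero_or_pos q with rfl | hq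
    · simpa [opBrace] using ha
    · rw [opBrace, if_neg (by omega)]
      have h := opE_mem_deg (k := 0) (s := fun _ : Fin 1 => s) (a := fun _ => a) (fun _ => ha) hb
      rw [Finset.univ_unique, Finset.sum_singleton] at h
      convert h using 2
      push_cast
      ring
  e_zero _ _ := if_pos rfl
  diff _ hq := opBrace_diff hq
  hirsch _ hq := opBrace_hirsch hq
  assoc _ _ _ _ := opBrace_assoc

theorem isExtendedHomotopyGAlgebra :
    IsExtendedHomotopyGAlgebra (deg S) (d S) (cup S) (one S) (opE S) where
  multilinear := exists_opE_multilinear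
  degree _ _ _ _ _ _ _ ha hb := opE_mem_deg ha hb
  zero_left := opE_zero_left
  zero_right := opE_zero_right
  E_zero p q a b hp := by rw [opE, E_zero_of_one_lt hp, act_zero]
  homotopyG := isHomotopyGAlgebra
  ehga k m n hk hm hn a b := by
    intro F T
    let x : ℕ → RawCochains S := fun j => if j ≤ m then (a (j - 1)).1 else (b (j - (m + 1))).1
    have ha : ∀ i < m, x (1 + i) = (a i).1 := by
      intro i hi
      simp only [x]
      rw [if_pos (by omega), Nat.add_sub_cancel_left]
    have hb : ∀ j < n, x (m + 1 + j) = (b j).1 := by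
      intro j hj
      simp only [x]
      rw [if_neg (by omega), Nat.add_sub_cancel_left]
    apply Subtype.ext
    refine (ehgaLeft_val hm hn ha hb).trans ?_
    rw [E_isExtendedHomotopyGInChi.ehga k m n hk hm hn, rawAct_add, Submodule.coe_add]
    congr 1
    · symm
      exact opE_val (by omega) a b (fun i hi => by rw [Nat.add_comm, ha i hi])
        fun j hj => by rw [Nat.add_right_comm, hb j hj]
    · have h : (List.range' (m + 1) n ++ List.range' 1 m).toFinset = Finset.Icc 1 (m + n) := by
        ext; simp; omega
      rw [← h, rawAct_relabel (nodup_of_toFinset_eq h (by simp; omega)) E_mem_length]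
      exact (opE_val_getD (by omega) hb ha).symm

end

end SSetCochains

theorem mainTheorem1 :
    -- the elements `E^k_{p,q}` of the surjection operad and the identities that they satisfy there
    (∀ q : ℕ, 1 ≤ q → SurjOperad.E 0 1 q = SurjOperad.str (SurjOperad.braceStr q)) ∧
    SurjOperad.IsExtendedHomotopyGInChi SurjOperad.E ∧
    -- the structure that they define on the singular cochain complex of a topological space
    (∀ X : TopCat.{u},
      IsExtendedHomotopyGAlgebra (SSetCochains.deg (SSetCochains.Sing X))
        (SSetCochains.d (SSetCochains.Sing X)) (SSetCochains.cup (SSetCochains.Sing X))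
        (SSetCochains.one (SSetCochains.Sing X)) (SSetCochains.opE (SSetCochains.Sing X))) ∧
    -- the element `(1,2)` acts as the cup product
    (∀ (X : TopCat.{u}) (x y : SSetCochains.Cochains (SSetCochains.Sing X)),
      SSetCochains.act 2 SurjOperad.mu ![x, y] = SSetCochains.cup (SSetCochains.Sing X) x y) ∧
    -- the normalized cochains are closed under the whole structure
    (∀ X : TopCat.{u}, SSetCochains.NormalizedClosed (SSetCochains.Sing X)) := by
  exact ⟨fun q hq => SurjOperad.E_zero_one q hq, SurjOperad.E_isExtendedHomotopyGInChi,
    fun X => SSetCochains.isExtendedHomotopyGAlgebra, fun X x y => SSetCochains.act_mu x y,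
    fun X => SSetCochains.normalizedClosed⟩
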